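/- **Local well-posedness, small-data scattering and persistence of regularity for the cubic resonant system.** Consider the system $$(i\partial_t+\Delta_x)u_j=\sum_{(j_1,j_2,j_3)\in R(j)}u_{j_1}\overline{u_{j_2}}u_{j_3},\qquad j\in\mathbb Z^2,\tag{R}$$ $$R(j)=\{(j_1,j_2,j_3)\in(\mathbb Z^2)^3:\ j_1-j_2+j_3=j,\ |j_1|^2-|j_2|^2+|j_3|^2=|j|^2\},$$ for $\vec u=\{u_j\}_{j\in\mathbb Z^2}$, $u_j:\mathbb R_t\times\mathbb R^2_x\to\mathbb C$. With $\langle p\rangle=(1+|p|^2)^{1/2}$ put $$\|\vec\phi\|_{h^{\eta}H^{k}}^2=\sum_{p\in\mathbb Z^2}\langle p\rangle^{2\eta}\|\phi_p\|_{H^k(\mathbb R^2)}^2,\qquad \|\vec u\|_{\vec W(I)}^2=\sum_{p\in\mathbb Z^2}\langle p\rangle^2\|u_p\|_{L^4_{t,x}(I\times\mathbb R^2)}^2,$$ and $h^1L^2=h^1H^0$. For an open interval $I\ni 0$, a solution of (R) on $I$ with data $\vec u_0$ means a function $\vec u\in C^0_t(I:h^1L^2)\cap\vec W(I)$ with $\vec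 u(0)=\vec u_0$ that satisfies (R) in the sense of distributions, i.e. for all $j\in\mathbb Z^2$ and $t\in I$, with $F_j$ the right-hand side of (R), $$i\,(u_j(t)-u_{0,j})+\int_0^t\Delta_x u_j(s)\,ds=\int_0^tF_j(s)\,ds\quad\text{in }\mathcal S'(\mathbb R^2).$$ 1. For every $\vec u_0\in h^1L^2$ there is an open interval $I$ containing $0$ and a solution of (R) on $I$ with data $\vec u_0$. On every open interval $I$ containing $0$ there is at most one solution of (R) with data $\vec u_0$. 2. There is $E_0>0$ such that for every $\vec u_0$ with $\|\vec u_0\|_{h^1L^2}\le E_0$ the solution is global, that is, there is a solution $\vec u\in C^0_t(\mathbb R:h^1L^2)\cap\vec W(\mathbb R)$ of (R) with data $\vec u_0$, and it scatters in both directions: there are $\vec v^{\pm\infty}\in h^1L^2$ with $\|\vec u(t)-e^{it\Delta_x}\vec v^{\pm\infty}\|_{h^1L^2}\to0$ as $t\to\pm\infty$. 3. (Persistence of regularity) Let $\vec u$ be the solution of (R) on an open interval $I\ni0$ with data $\vec u_0\in h^1L^2$. If $\vec u_0\in h^{\eta}H^{k}$ for some real $\eta\ge1$ and $k\ge0$,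 then $\vec u\in C^0_t(I:h^{\eta}H^{k})$. -/

import Mathlib

open MeasureTheory Set Filter Topology FourierTransform Laplacian
open scoped ENNReal SchwartzMap

noncomputable section

namespace Resonant

/-- The Euclidean plane `ℝ²` of the space variable. -/
abbrev Plane : Type := EuclideanSpace ℝ (Fin 2)

/-- `L²(ℝ²; ℂ)`. -/
abbrev L2 : Type := Lp ℂ 2 (volume : Measure Plane)

/-- Sequences `{φ_p}` of `L²` functions indexed by the lattice `ℤ²`. -/
abbrev Seq : Type := ℤ × ℤ → L2

/-- `|p|²` for a lattice point `p`. -/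
def latSq (p : ℤ × ℤ) : ℤ := p.1 ^ 2 + p.2 ^ 2

/-- The weight `⟨p⟩^(2s) = (1 + |p|²)^s`. -/
def weight (s : ℝ) (p : ℤ × ℤ) : ℝ≥0∞ := ENNReal.ofReal ((1 + (latSq p : ℝ)) ^ s)

/-- The set `R(j)` of triples with `j₁ - j₂ + j₃ = j` and `|j₁|² - |j₂|² + |j₃|² = |j|²`. -/
def resonantSet (j : ℤ × ℤ) : Set ((ℤ × ℤ) × (ℤ × ℤ) × (ℤ × ℤ)) :=
  {q | q.1 - q.2.1 + q.2.2 = j ∧ latSq q.1 - latSq q.2.1 + latSq q.2.2 = latSq j}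

/-- The squared Sobolev norm `‖f‖²_{H^k} = ∫ (1 + |2πξ|²)^k |f̂(ξ)|² dξ`; the factor `2π` comes from
the normalization `f̂(ξ) = ∫ f(x) exp(-2πi x·ξ) dx`. -/
def sobolevSq (k : ℝ) (f : L2) : ℝ≥0∞ :=
  ∫⁻ ξ : Plane, ENNReal.ofReal ((1 + (2 * Real.pi * ‖ξ‖) ^ 2) ^ k) * ‖(𝓕 f : L2) ξ‖ₑ ^ 2

/-- The norm of `h^η H^k`, with value `∞` off the space. -/
def hHNorm (η k : ℝ) (φ : Seq) : ℝ≥0∞ :=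
  (∑' p : ℤ × ℤ, weight η p * sobolevSq k (φ p)) ^ (1 / 2 : ℝ)

/-- The norm of `W(I)`: the square root of `∑_p ⟨p⟩² ‖u_p‖²_{L⁴(I × ℝ²)}`. -/
def wNorm (I : Set ℝ) (u : ℝ → Seq) : ℝ≥0∞ :=
  (∑' p : ℤ × ℤ, weight 1 p *
    (∫⁻ t in I, (eLpNorm (u t p) 4 (volume : Measure Plane)) ^ 4) ^ (1 / 2 : ℝ)) ^ (1 / 2 : ℝ)

/-- `u ∈ C⁰(I : h^η H^k)`. -/
def ContinuousIn (η k : ℝ) (I : Set ℝ) (u : ℝ → Seq) : Prop :=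
  (∀ t ∈ I, hHNorm η k (u t) < ∞) ∧
    ∀ t₀ ∈ I, Tendsto (fun t => hHNorm η k (u t - u t₀)) (𝓝[I] t₀) (𝓝 0)

/-- The nonlinearity `∑_{(j₁,j₂,j₃) ∈ R(j)} φ_{j₁} conj(φ_{j₂}) φ_{j₃}` as a function of `x`. -/
def nonlinearity (φ : Seq) (j : ℤ × ℤ) (x : Plane) : ℂ :=
  ∑' q : resonantSet j,
    φ q.1.1 x * (starRingEnd ℂ) (φ q.1.2.1 x) * φ q.1.2.2 x

/-- `u` is a solution on `I` in the class `C⁰(I : h¹L²) ∩ W(I)` with `u(0) = u₀` of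
`(i∂_t + Δ_x) u_j = ∑_{R(j)} u_{j₁} conj(u_{j₂}) u_{j₃}`, `j ∈ ℤ²`. The equation is understood as an
identity of tempered distributions in `x`, integrated in time. -/
structure IsSolution (I : Set ℝ) (u₀ : Seq) (u : ℝ → Seq) : Prop where
  continuousIn : ContinuousIn 1 0 I u
  wNorm_lt_top : wNorm I u < ∞
  initial : u 0 = u₀
  equation : ∀ j : ℤ × ℤ, ∀ t ∈ I, ∀ φ : 𝓢(Plane, ℂ),
    Complex.I * ((∫ x, u t j x * φ x) - ∫ x, u₀ j x * φ x)
        + ∫ s in (0 : ℝ)..t, ∫ x, u s j x * (Δ φ) x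
      = ∫ s in (0 : ℝ)..t, ∫ x, nonlinearity (u s) j x * φ x

/-- The symbol of the free propagator times `f̂`. -/
def propagatorFun (t : ℝ) (f : L2) (ξ : Plane) : ℂ :=
  Complex.exp (((-(t * (2 * Real.pi * ‖ξ‖) ^ 2) : ℝ) : ℂ) * Complex.I) * (𝓕 f : L2) ξ

theorem memLp_propagatorFun (t : ℝ) (f : L2) :
    MemLp (propagatorFun t f) 2 (volume : Measure Plane) := by
  refine (Lp.memLp (𝓕 f : L2)).of_le (f := propagatorFun t f) ?_ ?_
  · refine AEStronglyMeasurable.mul ?_ (Lp.aestronglyMeasurable _)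
    exact Continuous.aestronglyMeasurable (by fun_prop)
  · refine Eventually.of_forall fun ξ => ?_
    rw [propagatorFun, norm_mul, Complex.norm_exp_ofReal_mul_I, one_mul]

/-- The free Schrödinger propagator `e^{itΔ}` on `L²(ℝ²)`, the Fourier multiplier with symbol
`exp(-it|2πξ|²)`. -/
def propagator (t : ℝ) (f : L2) : L2 := 𝓕⁻ ((memLp_propagatorFun t f).toLp (propagatorFun t f))

/-- `u` scatters along `l` (`atTop` for `t → +∞`, `atBot` for `t → -∞`): there is `v ∈ h¹L²` with
`‖u(t) - e^{itΔ} v‖_{h¹L²} → 0`. -/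
def Scatters (l : Filter ℝ) (u : ℝ → Seq) : Prop :=
  ∃ v : Seq, hHNorm 1 0 v < ∞ ∧
    Tendsto (fun t => hHNorm 1 0 (u t - fun p => propagator t (v p))) l (𝓝 0)

end Resonant

end

/-! The equation is a perturbation of the free flow, and the proof rests on one linear and one
arithmetic estimate. The linear one is the `L⁴` Strichartz bound `strichartz` on the plane with its
retarded form `N4_le_of_increments`: forcing in `L^{4/3}` of space-time produces a curve in `L⁴`.
The arithmetic one is `Hn_triSum_le`: the cubic sum over `R(j)` is bounded in every weight `W` with
`W_j ≤ A (W_{j₁} + W_{j₃})`, at the price of the `W` norm of one factor and the `h¹` norms of the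
other two. Hölder and Minkowski combine them into estimates for the nonlinearity in `W(I)`.

Strichartz follows from Plancherel twice: in space for the square of the solution, and in time after
the substitution `s = 4π|η|²`. The retarded form cuts the forcing into dyadic pieces of equal mass
and sums over generations. The trilinear bound holds because a resonant triple is fixed by `j`, `j₂`
and a point `j₁` of a circle; a vertical line meets a circle at most twice, so `⟨p⟩⁻²` sums over all
circles to at most `2 ∑ 1/(1+x²)`, and two uses of Cauchy-Schwarz suffice.

Distributional solutions and Duhamel solutions are the same (`weak_of_duhamel`, `duhamel_of_weak`),
so the rest concerns `Mild`. When the `W` norm of the free evolution is small, on a short interval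
or for small data on the whole line, the Picard iteration converges (`exists_mild`). Uniqueness is
the difference estimate on short intervals, glued by connectedness (`propagate`). A global solution
scatters because its forcing has finite `L^{4/3}` norm, so the Duhamel integral converges at both
ends.

Lattice weights persist because the estimate is linear in the `W` norm with a coefficient that is
small on short intervals. Sobolev regularity is obtained without a Leibniz rule: three factors of
frequency below `R` have no product frequency above `3R` (`high_duh_low`), so the part above `3R` is
forced only by terms with a factor above `R` (`Mild.high_le`). Along the scales `R 3ⁿ` this is a
recursion with small coefficient, and the sum of the squared high frequency norms with weights
`9^{kn}` is the `H^k` norm up to low frequencies. -/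

noncomputable section

namespace Resonant

/-! ### The Fourier transform on `L²`. -/

section

/-- A smooth compactly supported real function, viewed as a complex Schwartz function. -/
theorem exists_schwartz_ofReal {E : Type*} [NormedAddCommGroup E] [InnerProductSpace ℝ E]
    {g : E → ℝ} (hg : ContDiff ℝ (⊤ : ℕ∞) g) (hc : HasCompactSupport g) :
    ∃ ψ : 𝓢(E, ℂ), ∀ x, ψ x = (g x : ℂ) := by
  have h1 : ContDiff ℝ (⊤ : ℕ∞) (fun x => (g x : ℂ)) := Complex.ofRealCLM.contDiff.comp hg
  have h2 : HasCompactSupport (fun x => (g x : ℂ)) :=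
    hc.comp_left (g := fun r : ℝ => (r : ℂ)) Complex.ofReal_zero
  exact ⟨h2.toSchwartzMap h1, fun x => rfl⟩

section Bridge

variable {E : Type*} [NormedAddCommGroup E] [InnerProductSpace ℝ E] [FiniteDimensional ℝ E]
  [MeasurableSpace E] [BorelSpace E]

/-- Smooth compactly supported functions are Schwartz, so the fundamental lemma of the calculus of
variations applies. It converts identities of tempered distributions into identities almost
everywhere. -/
theorem ae_eq_of_integral_schwartz {f g : E → ℂ} (hf : LocallyIntegrable f volume)
    (hg : LocallyIntegrable g volume)
    (h : ∀ ψ : 𝓢(E, ℂ), ∫ x, ψ x * f x = ∫ x, ψ x * g x) : f =ᵐ[volume] g := by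
  refine ae_eq_of_integral_contDiff_smul_eq hf hg fun φ hφ hc => ?_
  obtain ⟨ψ, hψ⟩ := exists_schwartz_ofReal hφ hc
  simpa [hψ] using h ψ

theorem integral_fourier_mul_eq_of_integrable {f g : E → ℂ} (hf : Integrable f)
    (hg : Integrable g) : ∫ ξ, 𝓕 f ξ * g ξ = ∫ x, f x * 𝓕 g x := by
  have := VectorFourier.integral_fourierIntegral_smul_eq_flip (L := innerₗ E)
    (μ := (volume : Measure E)) (ν := (volume : Measure E)) (e := Real.fourierChar)
    Real.continuous_fourierChar continuous_inner hf hg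
  simpa [Real.fourier_eq, VectorFourier.fourierIntegral, real_inner_comm] using this

theorem continuous_fourier_of_integrable {f : E → ℂ} (hf : Integrable f) : Continuous (𝓕 f) :=
  VectorFourier.fourierIntegral_continuous Real.continuous_fourierChar continuous_inner hf

/-- On `L¹ ∩ L²` the `L²` Fourier transform is the Fourier integral. -/
theorem fourier_toLp_ae_eq {h : E → ℂ} (h1 : Integrable h) (h2 : MemLp h 2 volume) :
    ((𝓕 (h2.toLp h) : Lp ℂ 2 (volume : Measure E)) : E → ℂ) =ᵐ[volume] 𝓕 h := by
  refine ae_eq_of_integral_schwartz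
    ((Lp.memLp _).locallyIntegrable (by norm_num))
    (continuous_fourier_of_integrable h1).locallyIntegrable fun ψ => ?_
  have e1 := congrArg (fun T => T ψ) (Lp.fourier_toTemperedDistribution_eq (h2.toLp h))
  simp only [TemperedDistribution.fourier_apply, Lp.toTemperedDistribution_apply,
    smul_eq_mul] at e1
  rw [← e1]
  have e2 := integral_fourier_mul_eq_of_integrable ψ.integrable h1
  rw [← e2, SchwartzMap.fourier_coe]
  exact integral_congr_ae (h2.coeFn_toLp.mono fun x hx => by simp [hx])

/-- The reflection `x ↦ -x` turns the inverse transform into the forward one, and the argument of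
`fourier_toLp_ae_eq` repeats. -/
theorem fourierInv_toLp_ae_eq {h : E → ℂ} (h1 : Integrable h) (h2 : MemLp h 2 volume) :
    ((𝓕⁻ (h2.toLp h) : Lp ℂ 2 (volume : Measure E)) : E → ℂ) =ᵐ[volume] 𝓕⁻ h := by
  have hmp : MeasurePreserving (fun x : E => -x) volume volume :=
    Measure.measurePreserving_neg _
  have h1n : Integrable (fun x => h (-x)) := h1.comp_neg
  have h2n : MemLp (fun x => h (-x)) 2 volume := h2.comp_measurePreserving hmp
  have hinv : 𝓕⁻ h = 𝓕 (fun x => h (-x)) := by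
    exact Real.fourierInv_eq_fourier_comp_neg h
  refine ae_eq_of_integral_schwartz
    ((Lp.memLp _).locallyIntegrable (by norm_num))
    (by rw [hinv]; exact (continuous_fourier_of_integrable h1n).locallyIntegrable) fun ψ => ?_
  have e1 := congrArg (fun T => T ψ) (Lp.fourierInv_toTemperedDistribution_eq (h2.toLp h))
  simp only [TemperedDistribution.fourierInv_apply, Lp.toTemperedDistribution_apply,
    smul_eq_mul] at e1
  rw [← e1, hinv]
  have e2 := integral_fourier_mul_eq_of_integrable ψ.integrable h1n
  rw [← e2, ← integral_neg_eq_self, SchwartzMap.fourierInv_coe]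
  refine integral_congr_ae ?_
  have hq := hmp.quasiMeasurePreserving.ae_eq_comp h2.coeFn_toLp
  filter_upwards [hq] with x hx
  simp only [Function.comp_apply] at hx
  rw [hx, Real.fourierInv_eq_fourier_neg, neg_neg]

theorem enorm_sq_Lp (f : Lp ℂ 2 (volume : Measure E)) : ‖f‖ₑ ^ 2 = ∫⁻ x, ‖f x‖ₑ ^ 2 := by
  rw [Lp.enorm_def, eLpNorm_eq_lintegral_rpow_enorm_toReal (by norm_num) (by norm_num)]
  simp only [ENNReal.toReal_ofNat]
  rw [← ENNReal.rpow_natCast, ← ENNReal.rpow_mul]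
  norm_num

/-- Plancherel on `L¹ ∩ L²`. -/
theorem lintegral_enorm_sq_fourier {h : E → ℂ} (h1 : Integrable h) (h2 : MemLp h 2 volume) :
    ∫⁻ ξ, ‖𝓕 h ξ‖ₑ ^ 2 = ∫⁻ x, ‖h x‖ₑ ^ 2 := by
  have e : ‖(𝓕 (h2.toLp h) : Lp ℂ 2 (volume : Measure E))‖ₑ = ‖h2.toLp h‖ₑ := by
    rw [← ofReal_norm, ← ofReal_norm, Lp.norm_fourier_eq]
  have e2 := congrArg (· ^ 2) e
  simp only [enorm_sq_Lp] at e2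
  calc _ = ∫⁻ ξ, ‖(𝓕 (h2.toLp h) : Lp ℂ 2 (volume : Measure E)) ξ‖ₑ ^ 2 :=
        lintegral_congr_ae ((fourier_toLp_ae_eq h1 h2).mono fun x hx => by simp only [hx])
    _ = _ := e2
    _ = _ := lintegral_congr_ae (h2.coeFn_toLp.mono fun x hx => by simp only [hx])

end Bridge

theorem enorm_fourier_eq (f : L2) : ‖(𝓕 f : L2)‖ₑ = ‖f‖ₑ := by
  rw [← ofReal_norm, ← ofReal_norm, Lp.norm_fourier_eq]

theorem sobolevSq_zero (f : L2) : sobolevSq 0 f = ‖f‖ₑ ^ 2 := by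
  simp [sobolevSq, ← enorm_fourier_eq f, enorm_sq_Lp]

/-! ### Fourier multipliers and the free propagator. -/

/-- Measurable Fourier symbols bounded by one. -/
structure Symbol where
  /-- the underlying function of the frequency -/
  toFun : Plane → ℂ
  measurable' : Measurable toFun
  bound' : ∀ ξ, ‖toFun ξ‖ ≤ 1

namespace Symbol

instance : CoeFun Symbol (fun _ => Plane → ℂ) := ⟨toFun⟩

theorem memLp (m : Symbol) (f : L2) :
    MemLp (fun ξ => m ξ * f ξ) 2 (volume : Measure Plane) := by
  refine (Lp.memLp f).of_le (m.measurable'.aestronglyMeasurable.mul (Lp.aestronglyMeasurable f))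
    (Eventually.of_forall fun ξ => ?_)
  rw [norm_mul]
  exact mul_le_of_le_one_left (norm_nonneg _) (m.bound' ξ)

/-- Multiplication by a symbol, on `L²`. -/
def mulLin (m : Symbol) : L2 →ₗ[ℂ] L2 where
  toFun f := (m.memLp f).toLp _
  map_add' f g := by
    rw [← MemLp.toLp_add]
    refine MemLp.toLp_congr _ _ ((Lp.coeFn_add f g).mono fun x hx => ?_)
    simp only [hx, Pi.add_apply, mul_add]
  map_smul' c f := by
    rw [RingHom.id_apply, ← MemLp.toLp_const_smul]
    refine MemLp.toLp_congr _ _ ((Lp.coeFn_smul c f).mono fun x hx => ?_)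
    simp only [hx, Pi.smul_apply, smul_eq_mul]
    ring

theorem coeFn_mulLin (m : Symbol) (f : L2) : m.mulLin f =ᵐ[volume] fun ξ => m ξ * f ξ :=
  (m.memLp f).coeFn_toLp

theorem norm_mulLin_le (m : Symbol) (f : L2) : ‖m.mulLin f‖ ≤ ‖f‖ := by
  refine Lp.norm_le_norm_of_ae_le ((m.coeFn_mulLin f).mono fun x hx => ?_)
  rw [hx, norm_mul]
  exact mul_le_of_le_one_left (norm_nonneg _) (m.bound' x)

/-- The Fourier multiplier with a given symbol. -/
def op (m : Symbol) : L2 →L[ℂ] L2 :=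
  LinearMap.mkContinuous
    ((Lp.fourierTransformₗᵢ Plane ℂ).symm.toLinearEquiv.toLinearMap ∘ₗ m.mulLin ∘ₗ
      (Lp.fourierTransformₗᵢ Plane ℂ).toLinearEquiv.toLinearMap) 1 (fun f => by
        simpa using m.norm_mulLin_le (Lp.fourierTransformₗᵢ Plane ℂ f))

theorem fourier_op (m : Symbol) (f : L2) : (𝓕 (m.op f) : L2) = m.mulLin (𝓕 f) := by
  change (𝓕 (𝓕⁻ (m.mulLin (𝓕 f)) : L2) : L2) = _
  exact fourier_fourierInv_eq _

theorem fourier_op_ae (m : Symbol) (f : L2) :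
    (𝓕 (m.op f) : L2) =ᵐ[volume] fun ξ => m ξ * (𝓕 f : L2) ξ := by
  rw [fourier_op]; exact m.coeFn_mulLin _

theorem norm_op_le (m : Symbol) (f : L2) : ‖m.op f‖ ≤ ‖f‖ := by
  rw [← Lp.norm_fourier_eq, fourier_op, ← Lp.norm_fourier_eq f]
  exact m.norm_mulLin_le _

theorem enorm_op_le (m : Symbol) (f : L2) : ‖m.op f‖ₑ ≤ ‖f‖ₑ := by
  rw [enorm_le_iff_norm_le]; exact m.norm_op_le f

end Symbol

theorem L2.fourier_injective {f g : L2} (h : (𝓕 f : L2) = 𝓕 g) : f = g := by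
  calc f = (𝓕⁻ (𝓕 f : L2) : L2) := (fourierInv_fourier_eq f).symm
    _ = (𝓕⁻ (𝓕 g : L2) : L2) := by rw [h]
    _ = g := fourierInv_fourier_eq g

namespace Symbol

theorem op_eq_of_ae {m : Symbol} {f g : L2}
    (h : (𝓕 g : L2) =ᵐ[volume] fun ξ => m ξ * (𝓕 f : L2) ξ) : m.op f = g :=
  L2.fourier_injective (Lp.ext ((m.fourier_op_ae f).trans h.symm))

theorem op_op {m n k : Symbol} (h : ∀ ξ, k ξ = m ξ * n ξ) (f : L2) : m.op (n.op f) = k.op f := by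
  refine op_eq_of_ae ?_
  filter_upwards [k.fourier_op_ae f, n.fourier_op_ae f] with x h1 h2
  rw [h1, h2, h, mul_assoc]

theorem op_comm (m n : Symbol) (f : L2) : m.op (n.op f) = n.op (m.op f) := by
  refine op_eq_of_ae ?_
  filter_upwards [n.fourier_op_ae (m.op f), n.fourier_op_ae f, m.fourier_op_ae f] with x h1 h2 h3
  rw [h1, h2, h3]; ring

theorem inner_op {m n : Symbol} (h : ∀ ξ, n ξ = starRingEnd ℂ (m ξ)) (f g : L2) :
    inner ℂ (m.op f) g = inner ℂ f (n.op g) := by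
  rw [← Lp.inner_fourier_eq, ← Lp.inner_fourier_eq f, L2.inner_def, L2.inner_def]
  refine integral_congr_ae ?_
  filter_upwards [m.fourier_op_ae f, n.fourier_op_ae g] with x h1 h2
  rw [h1, h2, h]
  simp only [RCLike.inner_apply, map_mul]
  ring

theorem enorm_sq_op_sub (m n : Symbol) (f : L2) :
    ‖m.op f - n.op f‖ₑ ^ 2 = ∫⁻ ξ, ‖m ξ - n ξ‖ₑ ^ 2 * ‖(𝓕 f : L2) ξ‖ₑ ^ 2 := by
  have h : (𝓕 (m.op f - n.op f) : L2) = m.mulLin (𝓕 f) - n.mulLin (𝓕 f) := by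
    rw [← fourier_op, ← fourier_op]
    exact map_sub (Lp.fourierTransformₗᵢ Plane ℂ) _ _
  rw [← enorm_fourier_eq, h, enorm_sq_Lp]
  refine lintegral_congr_ae ?_
  filter_upwards [Lp.coeFn_sub (m.mulLin (𝓕 f)) (n.mulLin (𝓕 f)), m.coeFn_mulLin (𝓕 f),
    n.coeFn_mulLin (𝓕 f)] with x h1 h2 h3
  rw [h1, Pi.sub_apply, h2, h3, ← sub_mul, enorm_mul, mul_pow]

/-- On the Fourier side the squared error is `∫ |m_i - m₀|² |𝓕 f|²`, dominated by `4 |𝓕 f|²`. Strong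
continuity of the propagator and the removal of frequency cutoffs are both instances. -/
theorem tendsto_op {ι : Type*} {l : Filter ι} [l.IsCountablyGenerated] {m : ι → Symbol}
    {m₀ : Symbol} (h : ∀ ξ, Tendsto (fun i => m i ξ) l (𝓝 (m₀ ξ))) (f : L2) :
    Tendsto (fun i => (m i).op f) l (𝓝 (m₀.op f)) := by
  have key : Tendsto (fun i => ‖(m i).op f - m₀.op f‖ₑ ^ 2) l (𝓝 0) := by
    simp only [enorm_sq_op_sub]
    have hz : (0 : ℝ≥0∞) = ∫⁻ _ : Plane, 0 := by simp
    rw [hz]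
    refine tendsto_lintegral_filter_of_dominated_convergence
      (fun ξ => 4 * ‖(𝓕 f : L2) ξ‖ₑ ^ 2) (Eventually.of_forall fun i => ?_)
      (Eventually.of_forall fun i => Eventually.of_forall fun ξ => ?_) ?_
      (Eventually.of_forall fun ξ => ?_)
    · have := (m i).measurable'
      have := m₀.measurable'
      have := (Lp.stronglyMeasurable (𝓕 f : L2)).measurable
      fun_prop
    · have hb : ‖m i ξ - m₀ ξ‖ₑ ≤ 2 := by
        refine (enorm_sub_le).trans ?_
        have h1 : ‖m i ξ‖ₑ ≤ 1 := by
          rw [← ofReal_norm]; exact ENNReal.ofReal_le_one.2 ((m i).bound' ξ)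
        have h2 : ‖m₀ ξ‖ₑ ≤ 1 := by
          rw [← ofReal_norm]; exact ENNReal.ofReal_le_one.2 (m₀.bound' ξ)
        exact (add_le_add h1 h2).trans (by norm_num)
      have : ‖m i ξ - m₀ ξ‖ₑ ^ 2 ≤ 4 := (pow_le_pow_left' hb 2).trans (by norm_num)
      gcongr
    · rw [lintegral_const_mul' _ _ (by norm_num), ← enorm_sq_Lp]
      exact ENNReal.mul_ne_top (by norm_num) (ENNReal.pow_ne_top enorm_ne_top)
    · have h0 : Tendsto (fun i => ‖m i ξ - m₀ ξ‖ₑ) l (𝓝 0) := by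
        have := ((h ξ).sub_const (m₀ ξ)).enorm
        simpa using this
      have h1 := ENNReal.Tendsto.mul_const (b := ‖(𝓕 f : L2) ξ‖ₑ ^ 2)
        (ENNReal.Tendsto.pow (n := 2) h0) (Or.inr (ENNReal.pow_ne_top enorm_ne_top))
      simpa using h1
  rw [tendsto_iff_norm_sub_tendsto_zero]
  have k2 := (ENNReal.tendsto_toReal ENNReal.zero_ne_top).comp key
  have k3 : Tendsto (fun i => ‖(m i).op f - m₀.op f‖ ^ 2) l (𝓝 0) := by
    simpa [Function.comp_def] using k2
  have k4 := k3.sqrt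
  simpa using k4

end Symbol

/-- The symbol of the free propagator. -/
def freeSymbol (t : ℝ) : Symbol where
  toFun ξ := Complex.exp (((-(t * (2 * Real.pi * ‖ξ‖) ^ 2) : ℝ) : ℂ) * Complex.I)
  measurable' := by fun_prop
  bound' ξ := by rw [Complex.norm_exp_ofReal_mul_I]

/-- The free propagator as a bounded operator. -/
def U (t : ℝ) : L2 →L[ℂ] L2 := (freeSymbol t).op

theorem propagator_eq (t : ℝ) (f : L2) : propagator t f = U t f := rfl

theorem U_add (s t : ℝ) (f : L2) : U s (U t f) = U (s + t) f := by
  refine Symbol.op_op (fun ξ => ?_) f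
  simp only [freeSymbol, ← Complex.exp_add]
  congr 1; push_cast; ring

theorem U_zero (f : L2) : U 0 f = f := by
  refine Symbol.op_eq_of_ae (Eventually.of_forall fun ξ => ?_)
  simp [freeSymbol]

theorem U_neg_U (t : ℝ) (f : L2) : U (-t) (U t f) = f := by rw [U_add]; simp [U_zero]

theorem norm_U (t : ℝ) (f : L2) : ‖U t f‖ = ‖f‖ := by
  refine le_antisymm ((freeSymbol t).norm_op_le f) ?_
  conv_lhs => rw [← U_neg_U t f]
  exact (freeSymbol (-t)).norm_op_le _

theorem enorm_U (t : ℝ) (f : L2) : ‖U t f‖ₑ = ‖f‖ₑ := by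
  rw [← ofReal_norm, ← ofReal_norm, norm_U]

theorem inner_U (t : ℝ) (f g : L2) : inner ℂ (U t f) g = inner ℂ f (U (-t) g) := by
  refine Symbol.inner_op (fun ξ => ?_) f g
  simp only [freeSymbol, ← Complex.exp_conj]
  congr 1
  rw [map_mul, Complex.conj_ofReal, Complex.conj_I]
  push_cast; ring

theorem continuous_U (f : L2) : Continuous fun t => U t f := by
  rw [continuous_iff_continuousAt]
  intro t
  refine Symbol.tendsto_op (m := freeSymbol) (m₀ := freeSymbol t) (fun ξ => ?_) f
  have : Continuous fun t => freeSymbol t ξ := by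
    simp only [freeSymbol]; fun_prop
  exact this.tendsto t

/-- Strong continuity in time, together with the isometry property, which makes the error from
varying the function uniform in time. -/
theorem continuous_U_uncurry : Continuous fun p : ℝ × L2 => U p.1 p.2 := by
  rw [continuous_iff_continuousAt]
  rintro ⟨t, f⟩
  have h1 : Tendsto (fun p : ℝ × L2 => U p.1 f) (𝓝 (t, f)) (𝓝 (U t f)) :=
    ((continuous_U f).comp continuous_fst).tendsto (t, f)
  have h2 : Tendsto (fun p : ℝ × L2 => U p.1 (p.2 - f)) (𝓝 (t, f)) (𝓝 0) := by
    rw [tendsto_zero_iff_norm_tendsto_zero]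
    simp only [norm_U]
    have : Continuous fun p : ℝ × L2 => ‖p.2 - f‖ := by fun_prop
    simpa using this.tendsto (t, f)
  have h3 := h1.add h2
  simpa [ContinuousAt] using h3

theorem continuous_U_comp {X : Type*} [TopologicalSpace X] {a : X → ℝ} {f : X → L2}
    (ha : Continuous a) (hf : Continuous f) : Continuous fun x => U (a x) (f x) :=
  Continuous.comp (g := fun p : ℝ × L2 => U p.1 p.2) (f := fun x => (a x, f x))
    continuous_U_uncurry (ha.prodMk hf)

end

/-! ### Jointly measurable representatives of curves in the separable space `L²`. -/

instance : Fact ((2 : ℝ≥0∞) ≠ ∞) := ⟨by norm_num⟩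

instance : MeasurableSpace L2 := borel _

instance : BorelSpace L2 := ⟨rfl⟩

section Evaluation

theorem exists_denseSeq_dist_lt (n : ℕ) (f : L2) :
    ∃ k, dist f (TopologicalSpace.denseSeq L2 k) < (1 / 2 : ℝ) ^ n := by
  have := (TopologicalSpace.denseRange_denseSeq L2).exists_dist_lt f
    (ε := (1 / 2 : ℝ) ^ n) (by positivity)
  exact this

open Classical in
/-- The first element of a dense sequence at distance less than `2⁻ⁿ`. -/
def approxIdx (n : ℕ) (f : L2) : ℕ := Nat.find (exists_denseSeq_dist_lt n f)

open Classical in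
theorem measurable_approxIdx (n : ℕ) : Measurable (approxIdx n) := by
  refine measurable_find (exists_denseSeq_dist_lt n) fun k => ?_
  exact measurableSet_lt (by fun_prop) measurable_const

/-- A countably valued approximation of the evaluation map. -/
def approxEv (n : ℕ) (z : L2 × Plane) : ℂ :=
  TopologicalSpace.denseSeq L2 (approxIdx n z.1) z.2

theorem measurable_approxEv (n : ℕ) : Measurable (approxEv n) := by
  have h : Measurable fun z : ℕ × Plane => TopologicalSpace.denseSeq L2 z.1 z.2 :=
    measurable_from_prod_countable_right fun k =>
      (Lp.stronglyMeasurable (TopologicalSpace.denseSeq L2 k)).measurable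
  exact h.comp (((measurable_approxIdx n).comp measurable_fst).prodMk measurable_snd)

/-- A jointly measurable evaluation map on `L² × ℝ²`. -/
def ev (z : L2 × Plane) : ℂ := limUnder atTop fun n => approxEv n z

theorem measurable_ev : Measurable ev :=
  (StronglyMeasurable.limUnder fun n => (measurable_approxEv n).stronglyMeasurable).measurable

/-- The approximants are within `2⁻ⁿ` of `f` in `L²`, so the squared errors have a finite integrated
sum and tend to zero almost everywhere. Elements of `L²` are only classes; `ev` chooses
representatives measurably, so that a measurable curve in `L²` becomes a measurable function of
space-time. -/
theorem ev_ae (f : L2) : (fun x => ev (f, x)) =ᵐ[volume] f := by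
  have hb : ∀ n, ∫⁻ x, ‖approxEv n (f, x) - f x‖ₑ ^ 2 ≤ (1 / 4 : ℝ≥0∞) ^ n := by
    intro n
    set d := TopologicalSpace.denseSeq L2 (approxIdx n f) with hd
    have h1 : ‖d - f‖ < (1 / 2 : ℝ) ^ n := by
      rw [← dist_eq_norm, dist_comm]
      classical
      exact Nat.find_spec (exists_denseSeq_dist_lt n f)
    have h2 : ∫⁻ x, ‖approxEv n (f, x) - f x‖ₑ ^ 2 = ‖d - f‖ₑ ^ 2 := by
      rw [enorm_sq_Lp]
      refine lintegral_congr_ae ((Lp.coeFn_sub d f).mono fun x hx => ?_)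
      simp only [hx]
      rfl
    have h3 : ‖d - f‖ₑ ≤ (1 / 2 : ℝ≥0∞) ^ n := by
      rw [← ofReal_norm]
      refine (ENNReal.ofReal_le_ofReal h1.le).trans ?_
      rw [ENNReal.ofReal_pow (by positivity)]
      gcongr
      rw [ENNReal.ofReal_div_of_pos (by norm_num)]
      simp
    rw [h2]
    calc ‖d - f‖ₑ ^ 2 ≤ ((1 / 2 : ℝ≥0∞) ^ n) ^ 2 := by gcongr
      _ = (1 / 4 : ℝ≥0∞) ^ n := by
        rw [← pow_mul, mul_comm, pow_mul]
        congr 1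
        rw [one_div, one_div, ← ENNReal.inv_pow]; norm_num
  have hs : ∫⁻ x, ∑' n, ‖approxEv n (f, x) - f x‖ₑ ^ 2 ≠ ∞ := by
    rw [lintegral_tsum]
    · refine ne_top_of_le_ne_top ?_ (ENNReal.tsum_le_tsum hb)
      rw [ENNReal.tsum_geometric]
      refine ENNReal.inv_ne_top.2 (tsub_pos_of_lt ?_).ne'
      rw [ENNReal.div_lt_iff (by norm_num) (by norm_num)]; norm_num
    · intro n
      have h1 : Measurable fun x => approxEv n (f, x) :=
        (measurable_approxEv n).comp (by fun_prop)
      have h2 := (Lp.stronglyMeasurable f).measurable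
      fun_prop
  have hlt := ae_lt_top' (AEMeasurable.tsum fun n => by
      have h1 : Measurable fun x => approxEv n (f, x) :=
        (measurable_approxEv n).comp (by fun_prop)
      have h2 := (Lp.stronglyMeasurable f).measurable
      fun_prop) hs
  filter_upwards [hlt] with x hx
  have ht := ENNReal.tendsto_cofinite_zero_of_tsum_ne_top hx.ne
  rw [Nat.cofinite_eq_atTop] at ht
  have ht2 : Tendsto (fun n => ‖approxEv n (f, x) - f x‖ ^ 2) atTop (𝓝 0) := by
    have := (ENNReal.tendsto_toReal ENNReal.zero_ne_top).comp ht
    simpa [Function.comp_def] using this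
  have ht3 : Tendsto (fun n => approxEv n (f, x)) atTop (𝓝 (f x)) := by
    rw [tendsto_iff_norm_sub_tendsto_zero]
    simpa using ht2.sqrt
  exact ht3.limUnder_eq

end Evaluation

/-! ### Space-time `L⁴` norms and their lower semicontinuity. -/

theorem isClosed_eLpNorm_le (p : ℝ≥0∞) (c : ℝ≥0∞) :
    IsClosed {f : L2 | eLpNorm f p volume ≤ c} := by
  refine isClosed_of_closure_subset fun f hf => ?_
  obtain ⟨g, hg, hlim⟩ := mem_closure_iff_seq_limit.1 hf
  obtain ⟨ns, -, hns⟩ := (tendstoInMeasure_of_tendsto_Lp hlim).exists_seq_tendsto_ae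
  have h := Lp.eLpNorm_lim_le_liminf_eLpNorm (p := p)
    (fun n => Lp.aestronglyMeasurable (g (ns n))) f hns
  refine h.trans ?_
  refine (liminf_le_liminf (v := fun _ => c) (Eventually.of_forall fun n => hg (ns n))).trans ?_
  simp

theorem eLpNorm_le_liminf (p : ℝ≥0∞) {g : ℕ → L2} {f : L2} (h : Tendsto g atTop (𝓝 f)) :
    eLpNorm f p volume ≤ liminf (fun n => eLpNorm (g n) p volume) atTop := by
  have hl : LowerSemicontinuous fun f : L2 => eLpNorm f p volume :=
    lowerSemicontinuous_iff_isClosed_preimage.2 fun c => isClosed_eLpNorm_le p c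
  refine (LowerSemicontinuousAt.le_liminf (hl f)).trans ?_
  have : liminf (fun f : L2 => eLpNorm f p volume) (map g atTop)
    = liminf (fun n => eLpNorm (g n) p volume) atTop := rfl
  rw [← this]
  exact liminf_le_liminf_of_le h

/-- Space-time Lebesgue measure on `J × ℝ²`. -/
def stMeasure (J : Set ℝ) : Measure (ℝ × Plane) := (volume.restrict J).prod volume

/-- The space-time function of a curve in `L²`. -/
def fld (u : ℝ → L2) (z : ℝ × Plane) : ℂ := ev (u z.1, z.2)

theorem measurable_fld {u : ℝ → L2} (hu : Measurable u) : Measurable (fld u) :=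
  measurable_ev.comp ((hu.comp measurable_fst).prodMk measurable_snd)

theorem fld_ae (u : ℝ → L2) (t : ℝ) : (fun x => fld u (t, x)) =ᵐ[volume] u t := ev_ae (u t)

/-- The `L⁴(J × ℝ²)` norm. -/
def N4 (J : Set ℝ) (u : ℝ → L2) : ℝ≥0∞ := eLpNorm (fld u) 4 (stMeasure J)

/-- Fubini for null sets. Pointwise identities between classes hold almost everywhere in space at
each time; measurability in both variables is what makes them space-time identities. -/
theorem ae_stMeasure {J : Set ℝ} {p : ℝ × Plane → Prop} (hp : MeasurableSet {z | p z})
    (h : ∀ t, ∀ᵐ x, p (t, x)) : ∀ᵐ z ∂(stMeasure J), p z := by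
  rw [stMeasure, Measure.ae_prod_iff_ae_ae hp]
  exact Eventually.of_forall h

theorem fld_add {u v : ℝ → L2} (hu : Measurable u) (hv : Measurable v) (J : Set ℝ) :
    fld (u + v) =ᵐ[stMeasure J] fld u + fld v := by
  refine ae_stMeasure (measurableSet_eq_fun (measurable_fld (hu.add hv))
    ((measurable_fld hu).add (measurable_fld hv))) fun t => ?_
  filter_upwards [fld_ae (u + v) t, fld_ae u t, fld_ae v t, Lp.coeFn_add (u t) (v t)]
    with x h1 h2 h3 h4
  simp only [Pi.add_apply] at h1 h4 ⊢
  rw [h1, h4, h2, h3]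

theorem fld_sub {u v : ℝ → L2} (hu : Measurable u) (hv : Measurable v) (J : Set ℝ) :
    fld (u - v) =ᵐ[stMeasure J] fld u - fld v := by
  refine ae_stMeasure (measurableSet_eq_fun (measurable_fld (hu.sub hv))
    ((measurable_fld hu).sub (measurable_fld hv))) fun t => ?_
  filter_upwards [fld_ae (u - v) t, fld_ae u t, fld_ae v t, Lp.coeFn_sub (u t) (v t)]
    with x h1 h2 h3 h4
  simp only [Pi.sub_apply] at h1 h4 ⊢
  rw [h1, h4, h2, h3]

theorem eLpNorm_four_pow {α : Type*} [MeasurableSpace α] (f : α → ℂ) (μ : Measure α) :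
    eLpNorm f 4 μ ^ 4 = ∫⁻ x, ‖f x‖ₑ ^ 4 ∂μ := by
  rw [eLpNorm_eq_lintegral_rpow_enorm_toReal (by norm_num) (by norm_num)]
  simp only [ENNReal.toReal_ofNat]
  rw [← ENNReal.rpow_natCast, ← ENNReal.rpow_mul]
  norm_num

theorem measurable_eLpNorm_four {u : ℝ → L2} (hu : Measurable u) :
    Measurable fun t => eLpNorm (u t) 4 volume ^ 4 := by
  have h : (fun t => eLpNorm (u t) 4 volume ^ 4) = fun t => ∫⁻ x, ‖fld u (t, x)‖ₑ ^ 4 := by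
    ext t
    rw [eLpNorm_four_pow]
    exact lintegral_congr_ae ((fld_ae u t).mono fun x hx => by simp only [hx])
  rw [h]
  exact Measurable.lintegral_prod_right' (f := fun z => ‖fld u z‖ₑ ^ 4)
    ((measurable_fld hu).enorm.pow_const 4)

theorem N4_pow {u : ℝ → L2} (hu : Measurable u) (J : Set ℝ) :
    N4 J u ^ 4 = ∫⁻ t in J, eLpNorm (u t) 4 volume ^ 4 := by
  rw [N4, eLpNorm_four_pow, stMeasure,
    lintegral_prod _ ((measurable_fld hu).enorm.pow_const 4).aemeasurable]
  refine lintegral_congr fun t => ?_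
  rw [eLpNorm_four_pow]
  exact lintegral_congr_ae ((fld_ae u t).mono fun x hx => by simp only [hx])

theorem N4_congr {u v : ℝ → L2} (hu : Measurable u) (hv : Measurable v) {J : Set ℝ}
    (hJ : MeasurableSet J) (h : EqOn u v J) : N4 J u = N4 J v := by
  have : N4 J u ^ 4 = N4 J v ^ 4 := by
    rw [N4_pow hu, N4_pow hv]
    exact setLIntegral_congr_fun hJ fun t ht => by simp only [h ht]
  exact (ENNReal.pow_right_strictMono (n := 4) (by norm_num)).injective this

theorem N4_mono {J K : Set ℝ} (h : J ⊆ K) (u : ℝ → L2) : N4 J u ≤ N4 K u :=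
  eLpNorm_mono_measure _ (Measure.prod_mono (Measure.restrict_mono h le_rfl) le_rfl)

theorem N4_add_le {u v : ℝ → L2} (hu : Measurable u) (hv : Measurable v) (J : Set ℝ) :
    N4 J (u + v) ≤ N4 J u + N4 J v := by
  rw [N4, eLpNorm_congr_ae (fld_add hu hv J)]
  exact eLpNorm_add_le (measurable_fld hu).aestronglyMeasurable
    (measurable_fld hv).aestronglyMeasurable (by norm_num)

theorem N4_sub_le {u v : ℝ → L2} (hu : Measurable u) (hv : Measurable v) (J : Set ℝ) :
    N4 J (u - v) ≤ N4 J u + N4 J v := by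
  rw [N4, eLpNorm_congr_ae (fld_sub hu hv J)]
  exact eLpNorm_sub_le (measurable_fld hu).aestronglyMeasurable
    (measurable_fld hv).aestronglyMeasurable (by norm_num)

/-- Fatou in time on top of lower semicontinuity in space: norm bounds survive limits that are only
known to hold in `L²` at each time. -/
theorem N4_le_liminf {u : ℕ → ℝ → L2} {v : ℝ → L2} (hu : ∀ n, Measurable (u n))
    (hv : Measurable v) {J : Set ℝ} (hJ : MeasurableSet J)
    (h : ∀ t ∈ J, Tendsto (fun n => u n t) atTop (𝓝 (v t))) :
    N4 J v ≤ liminf (fun n => N4 J (u n)) atTop := by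
  have hmono := (ENNReal.pow_right_strictMono (n := 4) (by norm_num))
  have hlim : ∀ a : ℕ → ℝ≥0∞, liminf a atTop ^ 4 = liminf (fun n => a n ^ 4) atTop := fun a =>
    hmono.monotone.map_liminf_of_continuousAt _ (by fun_prop)
  rw [← ENNReal.pow_le_pow_left_iff (n := 4) (by norm_num), N4_pow hv, hlim]
  calc ∫⁻ t in J, eLpNorm (v t) 4 volume ^ 4
      ≤ ∫⁻ t in J, liminf (fun n => eLpNorm (u n t) 4 volume ^ 4) atTop := by
        refine setLIntegral_mono' hJ fun t ht => ?_
        have h1 := eLpNorm_le_liminf 4 (h t ht)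
        rw [← hlim]
        gcongr
    _ ≤ liminf (fun n => ∫⁻ t in J, eLpNorm (u n t) 4 volume ^ 4) atTop :=
        lintegral_liminf_le fun n => measurable_eLpNorm_four (hu n)
    _ = _ := by simp only [N4_pow (hu _)]

theorem N4_le_of_tendsto {u : ℕ → ℝ → L2} {v : ℝ → L2} (hu : ∀ n, Measurable (u n))
    (hv : Measurable v) {J : Set ℝ} (hJ : MeasurableSet J)
    (h : ∀ t ∈ J, Tendsto (fun n => u n t) atTop (𝓝 (v t))) {b : ℕ → ℝ≥0∞} {c : ℝ≥0∞}
    (hb : ∀ n, N4 J (u n) ≤ b n) (hc : Tendsto b atTop (𝓝 c)) : N4 J v ≤ c :=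
  (N4_le_liminf hu hv hJ h).trans
    ((liminf_le_liminf (Eventually.of_forall hb)).trans_eq hc.liminf_eq)

/-! ### Polar coordinates adapted to the Schrödinger phase. -/

section Polar

/-- Polar parametrization of the plane by `s = 4π|η|²` and the angle. -/
def polarMap (z : ℝ × ℝ) : Plane :=
  !₂[Real.sqrt (z.1 / (4 * Real.pi)) * Real.cos z.2, Real.sqrt (z.1 / (4 * Real.pi)) * Real.sin z.2]

theorem continuous_polarMap : Continuous polarMap := by
  unfold polarMap
  refine (PiLp.continuous_toLp 2 _).comp ?_
  refine continuous_pi fun i => ?_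
  fin_cases i <;> simp <;> fun_prop

theorem norm_sq_polarMap {z : ℝ × ℝ} (hz : 0 ≤ z.1) :
    4 * Real.pi * ‖polarMap z‖ ^ 2 = z.1 := by
  have hp := Real.pi_pos
  have h0 : 0 ≤ z.1 / (4 * Real.pi) := by positivity
  rw [EuclideanSpace.norm_sq_eq]
  simp only [polarMap, Fin.sum_univ_two, PiLp.toLp_apply, Matrix.cons_val_zero,
    Matrix.cons_val_one, Real.norm_eq_abs,
    sq_abs, mul_pow, Real.sq_sqrt h0]
  rw [← mul_add, Real.cos_sq_add_sin_sq]
  field_simp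

/-- The parameter space of `polarMap`. -/
def polarMeasure : Measure (ℝ × ℝ) :=
  (volume.restrict (Ioi 0)).prod (volume.restrict (Ioo (-Real.pi) Real.pi))

/-- The substitution `s = 4πr²` has Jacobian `8πr`, which absorbs the factor `r` of polar
coordinates. Lebesgue measure thus becomes a constant multiple of `ds dθ`, in variables where the
phase is linear in `s`. -/
theorem lintegral_Ioi_comp_sqrt (g : ℝ → ℝ≥0∞) :
    ∫⁻ s in Ioi (0 : ℝ), g (Real.sqrt (s / (4 * Real.pi)))
      = ENNReal.ofReal (8 * Real.pi) * ∫⁻ r in Ioi (0 : ℝ), ENNReal.ofReal r * g r := by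
  have hp := Real.pi_pos
  have himg : (fun r : ℝ => 4 * Real.pi * r ^ 2) '' Ioi 0 = Ioi 0 := by
    ext s
    simp only [mem_image, mem_Ioi]
    constructor
    · rintro ⟨r, hr, rfl⟩; positivity
    · intro hs
      refine ⟨Real.sqrt (s / (4 * Real.pi)), Real.sqrt_pos.2 (by positivity), ?_⟩
      rw [Real.sq_sqrt (by positivity)]; field_simp
  have h := lintegral_image_eq_lintegral_abs_deriv_mul (s := Ioi (0 : ℝ))
    (f := fun r : ℝ => 4 * Real.pi * r ^ 2) (f' := fun r => 4 * Real.pi * (2 * r)) measurableSet_Ioi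
    (fun x _ => by
      have := ((hasDerivAt_pow 2 x).const_mul (4 * Real.pi)).hasDerivWithinAt (s := Ioi 0)
      simpa using this)
    (by
      intro a ha b hb hab
      have ha' : 0 ≤ a := le_of_lt ha
      have hb' : 0 ≤ b := le_of_lt hb
      have : a ^ 2 = b ^ 2 := by
        have h4 : 4 * Real.pi ≠ 0 := by positivity
        exact mul_left_cancel₀ h4 hab
      exact (pow_left_inj₀ ha' hb' (by norm_num)).1 this)
    (fun s => g (Real.sqrt (s / (4 * Real.pi))))
  rw [himg] at h
  rw [h, ← lintegral_const_mul' _ _ ENNReal.ofReal_ne_top]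
  refine setLIntegral_congr_fun measurableSet_Ioi fun r hr => ?_
  have hr' : 0 < r := hr
  have e1 : 4 * Real.pi * r ^ 2 / (4 * Real.pi) = r ^ 2 := by field_simp
  simp only [e1, Real.sqrt_sq hr'.le]
  rw [abs_of_pos (by positivity), ← mul_assoc (ENNReal.ofReal (8 * Real.pi)),
    ← ENNReal.ofReal_mul (by positivity)]
  congr 2; ring

theorem lintegral_polarMap {f : Plane → ℝ≥0∞} (hf : Measurable f) :
    ∫⁻ η, f η = ENNReal.ofReal (8 * Real.pi)⁻¹ * ∫⁻ z, f (polarMap z) ∂polarMeasure := by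
  have hp := Real.pi_pos
  have e1 := (EuclideanSpace.volume_preserving_symm_measurableEquiv_toLp (Fin 2)).symm
  have e2 := (volume_preserving_finTwoArrow ℝ).symm
  have e3 := e1.comp e2
  rw [← e3.lintegral_comp hf, ← lintegral_comp_polarCoord_symm]
  have hm : Measurable fun z : ℝ × ℝ => f (polarMap z) := hf.comp continuous_polarMap.measurable
  rw [polarMeasure, lintegral_prod_symm _ hm.aemeasurable]
  have hcongr : ∀ θ, ∫⁻ s in Ioi (0 : ℝ), f (polarMap (s, θ))
      = ENNReal.ofReal (8 * Real.pi) *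
        ∫⁻ r in Ioi (0 : ℝ), ENNReal.ofReal r * f (!₂[r * Real.cos θ, r * Real.sin θ]) :=
    fun θ => lintegral_Ioi_comp_sqrt fun r => f (!₂[r * Real.cos θ, r * Real.sin θ])
  simp only [hcongr]
  rw [lintegral_const_mul' _ _ ENNReal.ofReal_ne_top, ← mul_assoc,
    ← ENNReal.ofReal_mul (by positivity), inv_mul_cancel₀ (by positivity), ENNReal.ofReal_one,
    one_mul]
  have hc : Continuous fun z : ℝ × ℝ => (!₂[z.1 * Real.cos z.2, z.1 * Real.sin z.2] : Plane) := by
    refine (PiLp.continuous_toLp 2 _).comp ?_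
    refine continuous_pi fun i => ?_
    fin_cases i <;> simp <;> fun_prop
  have hm2 : Measurable fun z : ℝ × ℝ =>
      ENNReal.ofReal z.1 * f (!₂[z.1 * Real.cos z.2, z.1 * Real.sin z.2]) :=
    (ENNReal.measurable_ofReal.comp measurable_fst).mul (hf.comp hc.measurable)
  rw [← lintegral_prod_symm (fun z : ℝ × ℝ =>
      ENNReal.ofReal z.1 * f (!₂[z.1 * Real.cos z.2, z.1 * Real.sin z.2])) hm2.aemeasurable,
    Measure.prod_restrict]
  rfl

theorem map_polarMap :
    Measure.map polarMap (ENNReal.ofReal (8 * Real.pi)⁻¹ • polarMeasure) = volume := by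
  refine Measure.ext_of_lintegral _ fun f hf => ?_
  rw [lintegral_map hf continuous_polarMap.measurable, lintegral_smul_measure,
    lintegral_polarMap hf, smul_eq_mul]

theorem measurePreserving_polarMap :
    MeasurePreserving polarMap (ENNReal.ofReal (8 * Real.pi)⁻¹ • polarMeasure) volume :=
  ⟨continuous_polarMap.measurable, map_polarMap⟩

end Polar

/-! ### The homogeneous Strichartz estimate. -/

theorem sq_lintegral_mul_le {α : Type*} [MeasurableSpace α] (μ : Measure α) {f g : α → ℝ≥0∞}
    (hf : AEMeasurable f μ) (hg : AEMeasurable g μ) :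
    (∫⁻ x, f x * g x ∂μ) ^ 2 ≤ (∫⁻ x, f x ^ 2 ∂μ) * ∫⁻ x, g x ^ 2 ∂μ := by
  have h := ENNReal.lintegral_mul_le_Lp_mul_Lq (p := 2) (q := 2) μ
    (Real.holderConjugate_iff.2 ⟨one_lt_two, by norm_num⟩) hf hg
  have h2 := pow_le_pow_left' h 2
  simp only [Pi.mul_apply] at h2
  refine h2.trans (le_of_eq ?_)
  rw [mul_pow, ← ENNReal.rpow_natCast, ← ENNReal.rpow_natCast, ← ENNReal.rpow_mul,
    ← ENNReal.rpow_mul]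
  norm_num

theorem memLp_two_of_lintegral {α : Type*} [MeasurableSpace α] {μ : Measure α} {f : α → ℂ}
    (hf : AEStronglyMeasurable f μ) (h : ∫⁻ x, ‖f x‖ₑ ^ 2 ∂μ ≠ ∞) : MemLp f 2 μ := by
  refine ⟨hf, ?_⟩
  rw [eLpNorm_lt_top_iff_lintegral_rpow_enorm_lt_top (by norm_num) (by norm_num)]
  simpa using h.lt_top

theorem lintegral_sq_ne_top {α : Type*} [MeasurableSpace α] {μ : Measure α} {f : α → ℂ}
    (h : MemLp f 2 μ) : ∫⁻ x, ‖f x‖ₑ ^ 2 ∂μ ≠ ∞ := by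
  have := (eLpNorm_lt_top_iff_lintegral_rpow_enorm_lt_top (p := 2) (by norm_num)
    (by norm_num)).1 h.2
  simpa using this.ne

/-- In the variables `s = 4π|η|²` and `θ` the inner integral is the one-dimensional Fourier
transform, at `t`, of the angular integral of `H` divided by `8π`. Plancherel in `t` and
Cauchy-Schwarz in `θ` give the bound; the constant is `2π · (8π)⁻¹ = 1/4 ≤ 1`. -/
theorem lintegral_sq_oscillatory_le {H : Plane → ℂ} (h1 : Integrable H) (h2 : MemLp H 2 volume) :
    ∫⁻ t : ℝ, ‖∫ η, Complex.exp (((-2 * Real.pi * (4 * Real.pi * ‖η‖ ^ 2) * t : ℝ) : ℂ)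
      * Complex.I) * H η‖ₑ ^ 2 ≤ ∫⁻ η, ‖H η‖ₑ ^ 2 := by
  have hp := Real.pi_pos
  set c : ℝ := (8 * Real.pi)⁻¹ with hc
  have hc0 : 0 < c := by positivity
  have hmp := measurePreserving_polarMap
  rw [← hc] at hmp
  have hHm := hmp.integrable_comp_of_integrable h1
  have hH2 : MemLp (H ∘ polarMap) 2 (ENNReal.ofReal c • polarMeasure) :=
    h2.comp_measurePreserving hmp
  have hc' : ENNReal.ofReal c ≠ 0 := by simpa using hc0
  have hI : Integrable (H ∘ polarMap) polarMeasure :=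
    (integrable_smul_measure hc' ENNReal.ofReal_ne_top).1 hHm
  set μs : Measure ℝ := volume.restrict (Ioi (0 : ℝ)) with hμs
  set μθ : Measure ℝ := volume.restrict (Ioo (-Real.pi) Real.pi) with hμθ
  let G : ℝ → ℂ := (Ioi (0 : ℝ)).indicator fun s => (c : ℂ) * ∫ θ, H (polarMap (s, θ)) ∂μθ
  have hGi : Integrable G :=
    (integrable_indicator_iff measurableSet_Ioi).2 ((hI.integral_prod_left).const_mul _)
  have hA : ∀ t : ℝ, ∫ η, Complex.exp (((-2 * Real.pi * (4 * Real.pi * ‖η‖ ^ 2) * t : ℝ) : ℂ)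
      * Complex.I) * H η = 𝓕 G t := by
    intro t
    let K : Plane → ℂ := fun η => Complex.exp (((-2 * Real.pi * (4 * Real.pi * ‖η‖ ^ 2) * t : ℝ) : ℂ)
      * Complex.I) * H η
    have hKi : Integrable K := by
      refine h1.bdd_mul (c := 1) ?_ (Eventually.of_forall fun η => ?_)
      · exact Continuous.aestronglyMeasurable (by fun_prop)
      · rw [Complex.norm_exp_ofReal_mul_I]
    have hKp : Integrable (fun z => K (polarMap z)) polarMeasure :=
      (integrable_smul_measure hc' ENNReal.ofReal_ne_top).1
        (hmp.integrable_comp_of_integrable hKi)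
    have e1 : ∫ η, K η = ∫ z, K (polarMap z) ∂(ENNReal.ofReal c • polarMeasure) := by
      have hae : AEStronglyMeasurable K
          (Measure.map polarMap (ENNReal.ofReal c • polarMeasure)) := by
        rw [hmp.map_eq]; exact hKi.1
      rw [← integral_map hmp.measurable.aemeasurable hae, hmp.map_eq]
    change ∫ η, K η = _
    rw [e1, integral_smul_measure, ENNReal.toReal_ofReal hc0.le, polarMeasure,
      integral_prod _ hKp, Real.fourier_real_eq_integral_exp_smul,
      ← integral_indicator measurableSet_Ioi, ← integral_smul]
    congr 1
    ext s
    by_cases hs : s ∈ Ioi (0 : ℝ)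
    · have hs0 : (0 : ℝ) ≤ s := le_of_lt hs
      simp only [G, indicator_of_mem hs, smul_eq_mul, K, Complex.real_smul]
      have : ∀ θ, 4 * Real.pi * ‖polarMap (s, θ)‖ ^ 2 = s := fun θ =>
        norm_sq_polarMap (z := (s, θ)) hs0
      simp only [this]
      rw [integral_const_mul]
      ring
    · simp [G, indicator_of_notMem hs]
  simp only [hA]
  have hbound : ∫⁻ s, ‖G s‖ₑ ^ 2 ≤ ∫⁻ η, ‖H η‖ₑ ^ 2 := by
    have hr : ∫⁻ η, ‖H η‖ₑ ^ 2 = ENNReal.ofReal c *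
        ∫⁻ s, ∫⁻ θ, ‖H (polarMap (s, θ))‖ₑ ^ 2 ∂μθ ∂μs := by
      have hae : AEMeasurable (fun η => ‖H η‖ₑ ^ 2)
          (Measure.map polarMap (ENNReal.ofReal c • polarMeasure)) := by
        rw [hmp.map_eq]; exact h1.1.enorm.pow_const 2
      rw [← hmp.map_eq, lintegral_map' hae hmp.measurable.aemeasurable, lintegral_smul_measure,
        smul_eq_mul, polarMeasure, lintegral_prod]
      exact hI.1.enorm.pow_const 2
    rw [hr, ← lintegral_const_mul' _ _ ENNReal.ofReal_ne_top]
    have e0 : ∀ s, ‖G s‖ₑ ^ 2 = (Ioi (0 : ℝ)).indicator (fun s =>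
        ‖(c : ℂ) * ∫ θ, H (polarMap (s, θ)) ∂μθ‖ₑ ^ 2) s := by
      intro s
      by_cases hs : s ∈ Ioi (0 : ℝ)
      · simp only [G, indicator_of_mem hs]
      · simp [G, indicator_of_notMem hs]
    simp only [e0]
    rw [lintegral_indicator measurableSet_Ioi]
    have hsec := hI.1.prodMk_left
    refine lintegral_mono_ae ?_
    filter_upwards [hsec] with s hs
    rw [enorm_mul, mul_pow]
    have k1 : ‖∫ θ, H (polarMap (s, θ)) ∂μθ‖ₑ ^ 2
        ≤ ENNReal.ofReal (2 * Real.pi) * ∫⁻ θ, ‖H (polarMap (s, θ))‖ₑ ^ 2 ∂μθ := by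
      have := sq_lintegral_mul_le μθ (f := fun _ => 1)
        (g := fun θ => ‖H (polarMap (s, θ))‖ₑ) aemeasurable_const hs.enorm
      simp only [one_mul, one_pow, lintegral_const, hμθ, Measure.restrict_apply_univ,
        Real.volume_Ioo] at this
      refine (pow_le_pow_left' (enorm_integral_le_lintegral_enorm _) 2).trans (this.trans ?_)
      gcongr
      linarith
    have k2 : ‖(c : ℂ)‖ₑ = ENNReal.ofReal c := by
      rw [← ofReal_norm, Complex.norm_real, Real.norm_of_nonneg hc0.le]
    rw [k2]
    refine (mul_le_mul_right k1 _).trans ?_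
    rw [← mul_assoc]
    gcongr
    rw [sq, mul_assoc, ← ENNReal.ofReal_mul hc0.le]
    have : ENNReal.ofReal (c * (2 * Real.pi)) ≤ 1 := by
      refine ENNReal.ofReal_le_one.2 ?_
      rw [hc]; field_simp; norm_num
    calc _ ≤ ENNReal.ofReal c * 1 := by gcongr
      _ = _ := mul_one _
  have hG2 : MemLp G 2 volume :=
    memLp_two_of_lintegral hGi.1 (ne_top_of_le_ne_top (lintegral_sq_ne_top h2) hbound)
  rw [lintegral_enorm_sq_fourier hGi hG2]
  exact hbound

theorem memLp_two_of_bounded {α : Type*} [MeasurableSpace α] {μ : Measure α} {f : α → ℂ}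
    (hf : Integrable f μ) {M : ℝ} (hM : ∀ x, ‖f x‖ ≤ M) : MemLp f 2 μ := by
  rw [memLp_two_iff_integrable_sq_norm hf.1]
  have := hf.norm.bdd_mul (f := fun x => ‖f x‖) (c := M) hf.1.norm
    (Eventually.of_forall fun x => by simpa using hM x)
  simpa [sq] using this

theorem schwartz_bounded (φ : 𝓢(Plane, ℂ)) : ∃ M : ℝ, ∀ x, ‖φ x‖ ≤ M :=
  ⟨SchwartzMap.seminorm ℝ 0 0 φ, fun x => SchwartzMap.norm_le_seminorm ℝ φ x⟩

theorem parallelogram_half (ζ η : Plane) :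
    ‖(1 / 2 : ℝ) • ζ + η‖ ^ 2 + ‖(1 / 2 : ℝ) • ζ - η‖ ^ 2 = ‖ζ‖ ^ 2 / 2 + 2 * ‖η‖ ^ 2 := by
  have h := parallelogram_law_with_norm ℝ ((1 / 2 : ℝ) • ζ) η
  have h2 : ‖(1 / 2 : ℝ) • ζ‖ = 1 / 2 * ‖ζ‖ := by rw [norm_smul]; norm_num
  rw [h2] at h
  nlinarith [h]

/-- The `L⁴` norm is the `L²` norm of the square, hence by Plancherel in `x` that of the
self-convolution `C t`. With frequencies `ζ/2 ± η` the parallelogram law splits the phase into a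
factor of modulus one depending on `ζ` and the phase of `lintegral_sq_oscillatory_le`, which
integrates out time at fixed `ζ`. The forward transform stands in for the inverse one, since a
reflection does not change the norm. -/
theorem strichartz_fourier (φ : 𝓢(Plane, ℂ)) :
    ∫⁻ t, ∫⁻ x, ‖𝓕 (fun ξ => freeSymbol t ξ * φ ξ) x‖ₑ ^ 4 ≤ (∫⁻ ξ, ‖φ ξ‖ₑ ^ 2) ^ 2 := by
  obtain ⟨M, hM⟩ := schwartz_bounded φ
  have hM0 : 0 ≤ M := (norm_nonneg _).trans (hM 0)
  have hφm : Measurable φ := φ.continuous.measurable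
  let g : ℝ → Plane → ℂ := fun t ξ => freeSymbol t ξ * φ ξ
  have hgn : ∀ t ξ, ‖g t ξ‖ = ‖φ ξ‖ := fun t ξ => by
    simp only [g, norm_mul, freeSymbol, Complex.norm_exp_ofReal_mul_I, one_mul]
  have hgc : Continuous fun z : ℝ × Plane => g z.1 z.2 := by
    simp only [g, freeSymbol]
    have := φ.continuous
    fun_prop
  have hgct : ∀ t, Continuous (g t) := fun t =>
    hgc.comp (f := fun ξ : Plane => (t, ξ)) (by fun_prop)
  have hgi : ∀ t, Integrable (g t) := fun t =>
    φ.integrable.congr' (hgct t).aestronglyMeasurable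
      (Eventually.of_forall fun ξ => (hgn t ξ).symm)
  let C : ℝ → Plane → ℂ := fun t => convolution (g t) (g t) (ContinuousLinearMap.mul ℂ ℂ) volume
  have hCdef : ∀ t ζ, C t ζ = ∫ ξ, g t ξ * g t (ζ - ξ) := fun t ζ => rfl
  have hCi : ∀ t, Integrable (C t) := fun t => (hgi t).integrable_convolution _ (hgi t)
  have hCb : ∀ t ζ, ‖C t ζ‖ ≤ M * ∫ ξ, ‖g t ξ‖ := by
    intro t ζ
    rw [hCdef, ← integral_const_mul]
    refine norm_integral_le_of_norm_le ((hgi t).norm.const_mul M) (Eventually.of_forall fun ξ => ?_)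
    rw [norm_mul, mul_comm]
    gcongr
    rw [hgn]; exact hM _
  have hx : ∀ t, ∫⁻ x, ‖𝓕 (g t) x‖ₑ ^ 4 = ∫⁻ ζ, ‖C t ζ‖ₑ ^ 2 := by
    intro t
    rw [← lintegral_enorm_sq_fourier (hCi t) (memLp_two_of_bounded (hCi t) (hCb t))]
    refine lintegral_congr fun x => ?_
    have : 𝓕 (C t) x = 𝓕 (g t) x * 𝓕 (g t) x :=
      Real.fourier_mul_convolution_eq (hgi t) (hgi t) x
    rw [this, enorm_mul]; ring
  have hCm : Measurable fun z : ℝ × Plane => C z.1 z.2 := by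
    have : StronglyMeasurable fun z : (ℝ × Plane) × Plane => g z.1.1 z.2 * g z.1.1 (z.1.2 - z.2) := by
      refine Continuous.stronglyMeasurable ?_
      exact (hgc.comp (f := fun z : (ℝ × Plane) × Plane => (z.1.1, z.2)) (by fun_prop)).mul
        (hgc.comp (f := fun z : (ℝ × Plane) × Plane => (z.1.1, z.1.2 - z.2)) (by fun_prop))
    exact (this.integral_prod_right' (ν := volume)).measurable
  have hζ : ∀ ζ, ∫⁻ t, ‖C t ζ‖ₑ ^ 2 ≤ ∫⁻ ξ, ‖φ ξ‖ₑ ^ 2 * ‖φ (ζ - ξ)‖ₑ ^ 2 := by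
    intro ζ
    let H : Plane → ℂ := fun η => φ ((1 / 2 : ℝ) • ζ + η) * φ ((1 / 2 : ℝ) • ζ - η)
    have hHi : Integrable H := by
      refine (φ.integrable.comp_sub_left _).bdd_mul (c := M) ?_
        (Eventually.of_forall fun η => hM _)
      have := φ.continuous
      exact Continuous.aestronglyMeasurable (by fun_prop)
    have hHb : ∀ η, ‖H η‖ ≤ M * M := fun η => by
      rw [norm_mul]; gcongr <;> exact hM _
    have hosc : ∀ t, ‖C t ζ‖ₑ = ‖∫ η, Complex.exp (((-2 * Real.pi *
        (4 * Real.pi * ‖η‖ ^ 2) * t : ℝ) : ℂ) * Complex.I) * H η‖ₑ := by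
      intro t
      rw [hCdef, ← integral_add_left_eq_self _ ((1 / 2 : ℝ) • ζ)]
      have hpt : ∀ η, g t ((1 / 2 : ℝ) • ζ + η) * g t (ζ - ((1 / 2 : ℝ) • ζ + η))
          = Complex.exp (((-2 * Real.pi ^ 2 * ‖ζ‖ ^ 2 * t : ℝ) : ℂ) * Complex.I) *
            (Complex.exp (((-2 * Real.pi * (4 * Real.pi * ‖η‖ ^ 2) * t : ℝ) : ℂ)
              * Complex.I) * H η) := by
        intro η
        have e1 : ζ - ((1 / 2 : ℝ) • ζ + η) = (1 / 2 : ℝ) • ζ - η := by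
          have : ζ = (1 / 2 : ℝ) • ζ + (1 / 2 : ℝ) • ζ := by rw [← add_smul]; norm_num
          nth_rw 1 [this]; abel
        rw [e1]
        simp only [g, freeSymbol, H]
        have e2 := parallelogram_half ζ η
        rw [mul_mul_mul_comm, ← mul_assoc (Complex.exp _), ← Complex.exp_add, ← Complex.exp_add,
          ← add_mul, ← add_mul, ← Complex.ofReal_add, ← Complex.ofReal_add]
        have e3 : -(t * (2 * Real.pi * ‖(1 / 2 : ℝ) • ζ + η‖) ^ 2)
            + -(t * (2 * Real.pi * ‖(1 / 2 : ℝ) • ζ - η‖) ^ 2)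
            = -2 * Real.pi ^ 2 * ‖ζ‖ ^ 2 * t + -2 * Real.pi * (4 * Real.pi * ‖η‖ ^ 2) * t := by
          linear_combination (-4 * Real.pi ^ 2 * t) * e2
        rw [e3]
      simp only [hpt]
      rw [integral_const_mul, enorm_mul, ← ofReal_norm, Complex.norm_exp_ofReal_mul_I]
      simp
    simp only [hosc]
    refine (lintegral_sq_oscillatory_le hHi (memLp_two_of_bounded hHi hHb)).trans (le_of_eq ?_)
    rw [← lintegral_add_left_eq_self (fun ξ => ‖φ ξ‖ₑ ^ 2 * ‖φ (ζ - ξ)‖ₑ ^ 2) ((1 / 2 : ℝ) • ζ)]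
    refine lintegral_congr fun η => ?_
    have e1 : ζ - ((1 / 2 : ℝ) • ζ + η) = (1 / 2 : ℝ) • ζ - η := by
      have : ζ = (1 / 2 : ℝ) • ζ + (1 / 2 : ℝ) • ζ := by rw [← add_smul]; norm_num
      nth_rw 1 [this]; abel
    simp only [H, enorm_mul, mul_pow, e1]
  calc ∫⁻ t, ∫⁻ x, ‖𝓕 (g t) x‖ₑ ^ 4 = ∫⁻ t, ∫⁻ ζ, ‖C t ζ‖ₑ ^ 2 := lintegral_congr hx
    _ = ∫⁻ ζ, ∫⁻ t, ‖C t ζ‖ₑ ^ 2 :=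
        lintegral_lintegral_swap (hCm.enorm.pow_const 2).aemeasurable
    _ ≤ ∫⁻ ζ, ∫⁻ ξ, ‖φ ξ‖ₑ ^ 2 * ‖φ (ζ - ξ)‖ₑ ^ 2 := lintegral_mono hζ
    _ = ∫⁻ ξ, ∫⁻ ζ, ‖φ ξ‖ₑ ^ 2 * ‖φ (ζ - ξ)‖ₑ ^ 2 := by
        refine lintegral_lintegral_swap (Measurable.aemeasurable ?_)
        exact ((hφm.comp measurable_snd).enorm.pow_const 2).mul
          ((hφm.comp (measurable_fst.sub measurable_snd)).enorm.pow_const 2)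
    _ = ∫⁻ ξ, ‖φ ξ‖ₑ ^ 2 * ∫⁻ ζ, ‖φ ζ‖ₑ ^ 2 := by
        refine lintegral_congr fun ξ => ?_
        rw [lintegral_const_mul' _ _ (ENNReal.pow_ne_top enorm_ne_top),
          lintegral_sub_right_eq_self (fun ζ => ‖φ ζ‖ₑ ^ 2) ξ]
    _ = (∫⁻ ξ, ‖φ ξ‖ₑ ^ 2) ^ 2 := by
        rw [lintegral_mul_const _ (hφm.enorm.pow_const 2), sq]

theorem strichartz_schwartz (ψ : 𝓢(Plane, ℂ)) :
    N4 univ (fun t => U t (ψ.toLp 2)) ≤ ‖(ψ.toLp 2 : L2)‖ₑ := by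
  have hmono := (ENNReal.pow_right_strictMono (n := 4) (by norm_num))
  rw [← hmono.le_iff_le]
  rw [N4_pow (continuous_U _).measurable, Measure.restrict_univ]
  let φ : 𝓢(Plane, ℂ) := 𝓕 ψ
  have hφ : (𝓕 (ψ.toLp 2 : L2) : L2) = φ.toLp 2 := SchwartzMap.toLp_fourier_eq ψ
  have hrhs : ‖(ψ.toLp 2 : L2)‖ₑ ^ 4 = (∫⁻ ξ, ‖φ ξ‖ₑ ^ 2) ^ 2 := by
    rw [show 4 = 2 * 2 from rfl, pow_mul, ← enorm_fourier_eq, hφ, enorm_sq_Lp]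
    congr 1
    exact lintegral_congr_ae ((φ.coeFn_toLp 2 volume).mono fun x hx => by simp only [hx])
  rw [hrhs]
  refine le_trans (le_of_eq ?_) (strichartz_fourier φ)
  refine lintegral_congr fun t => ?_
  rw [eLpNorm_four_pow]
  have hi : Integrable fun ξ => freeSymbol t ξ * φ ξ :=
    φ.integrable.bdd_mul (c := 1) (freeSymbol t).measurable'.aestronglyMeasurable
      (Eventually.of_forall fun ξ => (freeSymbol t).bound' ξ)
  obtain ⟨M, hM⟩ := schwartz_bounded φ
  have h2 : MemLp (fun ξ => freeSymbol t ξ * φ ξ) 2 volume := by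
    refine memLp_two_of_bounded hi (M := M) fun ξ => ?_
    rw [norm_mul]
    exact (mul_le_of_le_one_left (norm_nonneg _) ((freeSymbol t).bound' ξ)).trans (hM ξ)
  have hU : U t (ψ.toLp 2) = 𝓕⁻ (h2.toLp _) := by
    refine Symbol.op_eq_of_ae ?_
    have : (𝓕 (𝓕⁻ (h2.toLp _) : L2) : L2) = h2.toLp _ := fourier_fourierInv_eq _
    rw [this, hφ]
    filter_upwards [h2.coeFn_toLp, φ.coeFn_toLp 2 volume] with x e1 e2
    rw [e1, e2]
  rw [hU, lintegral_congr_ae ((fourierInv_toLp_ae_eq hi h2).mono fun x hx => by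
    simp only [hx]; rfl)]
  simp only [Real.fourierInv_eq_fourier_neg]
  exact lintegral_neg_eq_self (fun x => ‖𝓕 (fun ξ => freeSymbol t ξ * φ ξ) x‖ₑ ^ 4)

/-- The `L⁴` Strichartz estimate in dimension two. -/
theorem strichartz (f : L2) : N4 univ (fun t => U t f) ≤ ‖f‖ₑ := by
  have hd : DenseRange (SchwartzMap.toLpCLM ℂ (E := Plane) ℂ 2 volume) :=
    SchwartzMap.denseRange_toLpCLM ENNReal.ofNat_ne_top
  obtain ⟨g, hg, hlim⟩ := mem_closure_iff_seq_limit.1 (hd f)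
  choose ψ hψ using hg
  -- Density of Schwartz functions, with Fatou replacing an extension of the operator by continuity.
  refine N4_le_of_tendsto (u := fun n t => U t (g n)) (fun n => (continuous_U _).measurable)
    (continuous_U _).measurable MeasurableSet.univ
    (fun t _ => ((U t).continuous.tendsto f).comp hlim) (b := fun n => ‖g n‖ₑ) (fun n => ?_)
    hlim.enorm
  rw [← hψ n]
  exact strichartz_schwartz (ψ n)

/-! ### The retarded estimate: dyadic decomposition of a curve by a control function. -/

section

theorem N4_congr_fun {u v : ℝ → L2} (h : ∀ t, u t = v t) (J : Set ℝ) : N4 J u = N4 J v := by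
  rw [show u = v from funext h]

theorem measurable_U_comp {v : ℝ → L2} (hv : Measurable v) : Measurable fun t => U t (v t) := by
  have h1 : Measurable fun p : ℝ × L2 => U p.1 p.2 := continuous_U_uncurry.measurable
  have h2 : Measurable fun t : ℝ => (t, v t) := measurable_id.prodMk hv
  exact Measurable.comp (g := fun p : ℝ × L2 => U p.1 p.2) (f := fun t : ℝ => (t, v t)) h1 h2

/-- Strichartz for profiles with finitely many values. -/
theorem N4_pow_le_of_finite_range {κ : ℝ → ℕ} (hκ : Measurable κ) {δ : ℕ → L2} {M : ℕ}
    (hM : ∀ t, κ t < M) {ε : ℝ≥0∞} (hε : ∀ t, ‖δ (κ t)‖ₑ ≤ ε) :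
    N4 univ (fun t => U t (δ (κ t))) ^ 4 ≤ M * ε ^ 4 := by
  classical
  have hv : Measurable fun t => δ (κ t) := (measurable_from_nat (f := δ)).comp hκ
  rw [N4_pow (measurable_U_comp hv), Measure.restrict_univ]
  -- Indices that are never attained carry no bound. Setting the large vectors to zero does not
  -- change the profile and bounds every term of the sum over `k < M`.
  let δ' : ℕ → L2 := fun k => if ‖δ k‖ₑ ≤ ε then δ k else 0
  have hδ' : ∀ t, δ (κ t) = δ' (κ t) := fun t => by simp [δ', hε t]
  have hδe : ∀ k, ‖δ' k‖ₑ ≤ ε := fun k => by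
    simp only [δ']; split_ifs with h
    · exact h
    · simp
  calc ∫⁻ t, eLpNorm (U t (δ (κ t))) 4 volume ^ 4
      ≤ ∫⁻ t, ∑ k ∈ Finset.range M, eLpNorm (U t (δ' k)) 4 volume ^ 4 := by
        refine lintegral_mono fun t => ?_
        rw [hδ' t]
        exact Finset.single_le_sum (f := fun k => eLpNorm (U t (δ' k)) 4 volume ^ 4)
          (fun _ _ => zero_le) (Finset.mem_range.2 (hM t))
    _ = ∑ k ∈ Finset.range M, ∫⁻ t, eLpNorm (U t (δ' k)) 4 volume ^ 4 :=
        lintegral_finsetSum _ fun k _ => measurable_eLpNorm_four (continuous_U _).measurable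
    _ ≤ ∑ k ∈ Finset.range M, ε ^ 4 := by
        refine Finset.sum_le_sum fun k _ => ?_
        have h1 := strichartz (δ' k)
        have h2 := N4_pow (continuous_U (δ' k)).measurable univ
        rw [Measure.restrict_univ] at h2
        rw [← h2]
        exact pow_le_pow_left' (h1.trans (hδe k)) 4
    _ = M * ε ^ 4 := by simp

section Variation

variable (ω : ℝ → ℝ)

/-- The dyadic index of generation `n` of the control value `ω t`. -/
def dyIdx (n : ℕ) (t : ℝ) : ℕ := ⌊2 ^ n * ω t⌋₊

open Classical in
/-- A time with a given dyadic index. -/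
def dyRep (n k : ℕ) : ℝ := if h : ∃ t, dyIdx ω n t = k then h.choose else 0

theorem dyIdx_dyRep (n : ℕ) (t : ℝ) : dyIdx ω n (dyRep ω n (dyIdx ω n t)) = dyIdx ω n t := by
  have h : ∃ s, dyIdx ω n s = dyIdx ω n t := ⟨t, rfl⟩
  rw [dyRep, dif_pos h]
  exact h.choose_spec

variable {ω}

/-- Generations are nested, so an increment between consecutive generations is a function of the
finer index alone and takes finitely many values. -/
theorem dyIdx_succ_div (n : ℕ) (t : ℝ) : dyIdx ω (n + 1) t / 2 = dyIdx ω n t := by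
  rw [dyIdx, dyIdx, ← Nat.floor_div_ofNat]
  congr 1; rw [pow_succ]; ring

theorem abs_sub_le_of_dyIdx_eq (h0 : ∀ t, 0 ≤ ω t) {n : ℕ} {s t : ℝ}
    (h : dyIdx ω n s = dyIdx ω n t) : |ω t - ω s| ≤ (1 / 2 : ℝ) ^ n := by
  have hp : (0 : ℝ) < 2 ^ n := by positivity
  have a1 := Nat.floor_le (mul_nonneg hp.le (h0 t))
  have a2 := Nat.lt_floor_add_one (2 ^ n * ω t)
  have b1 := Nat.floor_le (mul_nonneg hp.le (h0 s))
  have b2 := Nat.lt_floor_add_one (2 ^ n * ω s)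
  unfold dyIdx at h
  rw [h] at b1 b2
  have : |2 ^ n * (ω t - ω s)| ≤ 1 := by rw [abs_le]; constructor <;> nlinarith
  rw [abs_mul, abs_of_pos hp] at this
  rw [one_div, inv_pow, ← one_div, le_div_iff₀ hp]
  linarith

/-- If the increments of `w` are controlled by the power `3/4` of the increments of a function with
values in `[0, 1]`, then `e^{itΔ} w(t)` is in `L⁴`. -/
theorem N4_le_of_variation (hω : Measurable ω) (h0 : ∀ t, 0 ≤ ω t) (h1 : ∀ t, ω t ≤ 1)
    {w : ℝ → L2} (hw : Measurable w) {K : ℝ} (hK : 0 ≤ K)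
    (h : ∀ s t, ‖w t - w s‖ ≤ K * |ω t - ω s| ^ (3 / 4 : ℝ)) (a : ℝ) :
    N4 univ (fun t => U t (w t - w a)) ≤ 10 * ENNReal.ofReal K := by
  have hidx : ∀ n, Measurable (dyIdx ω n) := fun n =>
    Nat.measurable_floor.comp (hω.const_mul _)
  have hidx_le : ∀ n t, dyIdx ω n t < 2 ^ n + 1 := by
    intro n t
    refine Nat.lt_succ_of_le (Nat.floor_le_of_le ?_)
    push_cast
    exact mul_le_of_le_one_right (by positivity) (h1 t)
  -- `W n` freezes `w` at one time for each dyadic interval of values of `ω`; `w` is then the limit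
  -- of a telescoping sum of finitely valued profiles.
  let W : ℕ → ℝ → L2 := fun n t => w (dyRep ω n (dyIdx ω n t))
  have hWm : ∀ n, Measurable (W n) := fun n =>
    (measurable_from_nat (f := fun k => w (dyRep ω n k))).comp (hidx n)
  have hWlim : ∀ t, Tendsto (fun n => W n t) atTop (𝓝 (w t)) := by
    intro t
    rw [tendsto_iff_norm_sub_tendsto_zero]
    refine squeeze_zero (g := fun n : ℕ => K * ((1 / 2 : ℝ) ^ n) ^ (3 / 4 : ℝ))
      (fun n => norm_nonneg _) (fun n => ?_) ?_
    · refine (h t _).trans ?_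
      gcongr
      exact abs_sub_le_of_dyIdx_eq h0 (dyIdx_dyRep ω n t).symm
    · have h2 : Tendsto (fun n : ℕ => ((1 / 2 : ℝ) ^ n) ^ (3 / 4 : ℝ)) atTop (𝓝 (0 ^ (3 / 4 : ℝ))) :=
        (tendsto_pow_atTop_nhds_zero_of_lt_one (by norm_num) (by norm_num)).rpow_const
          (Or.inr (by norm_num))
      rw [Real.zero_rpow (by norm_num)] at h2
      simpa using h2.const_mul K
  -- There are at most `2ⁿ⁺¹ + 1` increments of size `K 2^(-3n/4)`, so the fourth power of the norm
  -- is at most `16 K⁴ 2ⁿ 8⁻ⁿ`. Convergence is due to `4 · 3/4 > 1`; the ratio `3/4` of the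
  -- geometric bound is chosen because `1/4 ≤ (3/4)⁴`.
  have hstep : ∀ n, N4 univ (fun t => U t (W (n + 1) t - W n t))
      ≤ 2 * ENNReal.ofReal K * ENNReal.ofReal ((3 / 4 : ℝ) ^ n) := by
    intro n
    let δ : ℕ → L2 := fun k => w (dyRep ω (n + 1) k) - w (dyRep ω n (k / 2))
    have e1 : ∀ t, U t (W (n + 1) t - W n t) = U t (δ (dyIdx ω (n + 1) t)) := by
      intro t; simp only [W, δ, dyIdx_succ_div]
    rw [N4_congr_fun e1]
    have hδ : ∀ t, ‖δ (dyIdx ω (n + 1) t)‖ₑ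
        ≤ ENNReal.ofReal (K * ((1 / 2 : ℝ) ^ n) ^ (3 / 4 : ℝ)) := by
      intro t
      rw [← ofReal_norm]
      refine ENNReal.ofReal_le_ofReal ((h _ _).trans ?_)
      gcongr
      refine abs_sub_le_of_dyIdx_eq h0 ?_
      rw [dyIdx_succ_div, dyIdx_dyRep, ← dyIdx_succ_div n (dyRep ω (n + 1) _), dyIdx_dyRep,
        dyIdx_succ_div]
    have hmain := N4_pow_le_of_finite_range (hidx (n + 1)) (hidx_le (n + 1)) hδ
    refine ((ENNReal.pow_right_strictMono (n := 4) (by norm_num)).le_iff_le).1 (hmain.trans ?_)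
    have e2 : ((2 ^ (n + 1) + 1 : ℕ) : ℝ≥0∞) = ENNReal.ofReal (2 ^ (n + 1) + 1) := by
      rw [← ENNReal.ofReal_natCast]; push_cast; rfl
    have e3 : (2 : ℝ≥0∞) = ENNReal.ofReal 2 := by simp
    rw [e2, e3, ← ENNReal.ofReal_pow (by positivity), ← ENNReal.ofReal_mul (by positivity),
      ← ENNReal.ofReal_mul (by positivity), ← ENNReal.ofReal_mul (by positivity),
      ← ENNReal.ofReal_pow (by positivity)]
    refine ENNReal.ofReal_le_ofReal ?_
    have e4 : (((1 / 2 : ℝ) ^ n) ^ (3 / 4 : ℝ)) ^ 4 = (1 / 8 : ℝ) ^ n := by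
      rw [← Real.rpow_natCast, ← Real.rpow_mul (by positivity)]
      norm_num
      rw [← pow_mul, mul_comm, pow_mul]; norm_num
    rw [mul_pow, e4, mul_pow, mul_pow, ← pow_mul, mul_comm n 4, pow_mul]
    have e5 : (2 ^ (n + 1) + 1 : ℝ) ≤ 16 * 2 ^ n := by
      have : (1 : ℝ) ≤ 2 ^ n := one_le_pow₀ (by norm_num)
      rw [pow_succ]; linarith
    have e6 : (2 : ℝ) ^ n * (1 / 8) ^ n ≤ ((3 / 4 : ℝ) ^ 4) ^ n := by
      rw [← mul_pow]; gcongr; norm_num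
    calc (2 ^ (n + 1) + 1) * (K ^ 4 * (1 / 8) ^ n)
        ≤ (16 * 2 ^ n) * (K ^ 4 * (1 / 8) ^ n) := by gcongr
      _ = 16 * K ^ 4 * (2 ^ n * (1 / 8) ^ n) := by ring
      _ ≤ 16 * K ^ 4 * ((3 / 4 : ℝ) ^ 4) ^ n := by gcongr
      _ = 2 ^ 4 * K ^ 4 * ((3 / 4 : ℝ) ^ 4) ^ n := by norm_num
  have hbase : N4 univ (fun t => U t (W 0 t - w a)) ≤ 2 * ENNReal.ofReal K := by
    let δ : ℕ → L2 := fun k => w (dyRep ω 0 k) - w a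
    have hδ : ∀ t, ‖δ (dyIdx ω 0 t)‖ₑ ≤ ENNReal.ofReal K := by
      intro t
      rw [← ofReal_norm]
      refine ENNReal.ofReal_le_ofReal ((h _ _).trans (mul_le_of_le_one_right hK ?_))
      refine Real.rpow_le_one (abs_nonneg _) ?_ (by norm_num)
      rw [abs_le]
      constructor <;> linarith [h0 a, h1 a, h0 (dyRep ω 0 (dyIdx ω 0 t)),
        h1 (dyRep ω 0 (dyIdx ω 0 t))]
    have hmain := N4_pow_le_of_finite_range (hidx 0) (hidx_le 0) hδ
    refine ((ENNReal.pow_right_strictMono (n := 4) (by norm_num)).le_iff_le).1 (hmain.trans ?_)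
    simp only [mul_pow]
    gcongr
    norm_num
  have hsum : ∀ n, N4 univ (fun t => U t (W n t - w a)) ≤ 2 * ENNReal.ofReal K +
      2 * ENNReal.ofReal K * ∑ m ∈ Finset.range n, ENNReal.ofReal ((3 / 4 : ℝ) ^ m) := by
    intro n
    induction n with
    | zero => simpa using hbase
    | succ n ih =>
      have e : ∀ t, U t (W (n + 1) t - w a)
          = ((fun t => U t (W n t - w a)) + fun t => U t (W (n + 1) t - W n t)) t := by
        intro t; simp only [Pi.add_apply, ← map_add]; congr 1; abel
      rw [N4_congr_fun e, Finset.sum_range_succ, mul_add, ← add_assoc]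
      exact (N4_add_le (measurable_U_comp ((hWm n).sub_const _))
        (measurable_U_comp ((hWm (n + 1)).sub (hWm n))) univ).trans (add_le_add ih (hstep n))
  refine N4_le_of_tendsto (u := fun n t => U t (W n t - w a))
    (fun n => measurable_U_comp ((hWm n).sub_const _)) (measurable_U_comp (hw.sub_const _))
    MeasurableSet.univ
    (fun t _ => ((U t).continuous.tendsto _).comp ((hWlim t).sub_const (w a)))
    (b := fun _ => 10 * ENNReal.ofReal K) (fun n => (hsum n).trans ?_) tendsto_const_nhds
  -- The total `2K + 2K · 4` is the origin of the constant `10`.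
  have hgeo : ∑ m ∈ Finset.range n, ENNReal.ofReal ((3 / 4 : ℝ) ^ m) ≤ 4 := by
    rw [← ENNReal.ofReal_sum_of_nonneg (fun _ _ => by positivity)]
    have : ∑ m ∈ Finset.range n, (3 / 4 : ℝ) ^ m ≤ 4 := by
      rw [geom_sum_eq (by norm_num)]
      have : (0 : ℝ) ≤ (3 / 4) ^ n := by positivity
      rw [div_le_iff_of_neg (by norm_num)]; linarith
    refine (ENNReal.ofReal_le_ofReal this).trans ?_
    simp
  calc _ ≤ 2 * ENNReal.ofReal K + 2 * ENNReal.ofReal K * 4 := by gcongr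
    _ = 10 * ENNReal.ofReal K := by ring

end Variation

end

/-! ### Duhamel integrals of `L^{4/3}` forcing, defined by duality. -/

theorem fld_smul {u : ℝ → L2} (hu : Measurable u) (c : ℂ) (J : Set ℝ) :
    fld (fun t => c • u t) =ᵐ[stMeasure J] fun z => c * fld u z := by
  refine ae_stMeasure (measurableSet_eq_fun (measurable_fld (hu.const_smul c))
    ((measurable_fld hu).const_mul c)) fun t => ?_
  filter_upwards [fld_ae (fun t => c • u t) t, fld_ae u t, Lp.coeFn_smul c (u t)]
    with x h1 h2 h3
  rw [h1, h3, h2]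
  rfl

theorem memLp_fld_U (J : Set ℝ) (g : L2) : MemLp (fld fun t => U t g) 4 (stMeasure J) :=
  ⟨(measurable_fld (continuous_U g).measurable).aestronglyMeasurable,
    ((N4_mono (subset_univ J) _).trans (strichartz g)).trans_lt enorm_lt_top⟩

instance holderTriple_four : ENNReal.HolderTriple 4 (4 / 3) 1 := by
  refine ⟨?_⟩
  rw [ENNReal.inv_div (by norm_num) (by norm_num), inv_one, ← one_div, ← ENNReal.add_div]
  rw [show (1 : ℝ≥0∞) + 3 = 4 by norm_num]
  exact ENNReal.div_self (by norm_num) (by norm_num)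

theorem toReal_four_thirds : (4 / 3 : ℝ≥0∞).toReal = 4 / 3 := by
  rw [ENNReal.toReal_div]; norm_num

theorem four_thirds_ne_zero : (4 / 3 : ℝ≥0∞) ≠ 0 := by
  simp

theorem four_thirds_ne_top : (4 / 3 : ℝ≥0∞) ≠ ∞ :=
  ENNReal.div_ne_top (by norm_num) (by norm_num)

theorem one_le_four_thirds : (1 : ℝ≥0∞) ≤ 4 / 3 := by
  rw [ENNReal.le_div_iff_mul_le (by norm_num) (by norm_num)]; norm_num

/-- Hölder's inequality for the pairing of `L⁴` and `L^{4/3}`. -/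
theorem lintegral_mul_conj_le {α : Type*} [MeasurableSpace α] {μ : Measure α} {f F : α → ℂ}
    (hf : AEStronglyMeasurable f μ) (hF : AEStronglyMeasurable F μ) :
    ∫⁻ z, ‖f z * (starRingEnd ℂ) (F z)‖ₑ ∂μ ≤ eLpNorm f 4 μ * eLpNorm F (4 / 3) μ := by
  have h := eLpNorm_smul_le_mul_eLpNorm (p := 4) (q := 4 / 3) (r := 1) hF hf
  rw [eLpNorm_one_eq_lintegral_enorm] at h
  refine le_trans (le_of_eq (lintegral_congr fun z => ?_)) h
  simp [enorm_mul]

theorem integrable_mul_conj {α : Type*} [MeasurableSpace α] {μ : Measure α} {f F : α → ℂ}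
    (hf : MemLp f 4 μ) (hF : MemLp F (4 / 3) μ) :
    Integrable (fun z => f z * (starRingEnd ℂ) (F z)) μ :=
  ⟨hf.1.mul (Complex.continuous_conj.comp_aestronglyMeasurable hF.1),
    (lintegral_mul_conj_le hf.1 hF.1).trans_lt (ENNReal.mul_lt_top hf.2 hF.2)⟩

/-- The functional `g ↦ ∫∫ e^{itΔ} g conj(F)` on `L²`. -/
def duhForm (F : ℝ × Plane → ℂ) (J : Set ℝ) (h : MemLp F (4 / 3) (stMeasure J)) :
    L2 →L[ℂ] ℂ :=
  LinearMap.mkContinuous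
    { toFun := fun g => ∫ z, fld (fun t => U t g) z * (starRingEnd ℂ) (F z) ∂stMeasure J
      map_add' := fun g g' => by
        rw [← integral_add (integrable_mul_conj (memLp_fld_U J g) h)
          (integrable_mul_conj (memLp_fld_U J g') h)]
        refine integral_congr_ae ?_
        have e : (fun t => U t (g + g')) = (fun t => U t g) + fun t => U t g' := by
          ext1 t; simp
        rw [e]
        filter_upwards [fld_add (continuous_U g).measurable (continuous_U g').measurable J]
          with z hz
        rw [hz, Pi.add_apply, add_mul]
      map_smul' := fun c g => by
        rw [RingHom.id_apply, smul_eq_mul, ← integral_const_mul]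
        refine integral_congr_ae ?_
        have e : (fun t => U t (c • g)) = fun t => c • U t g := by
          ext1 t; simp
        rw [e]
        filter_upwards [fld_smul (continuous_U g).measurable c J] with z hz
        rw [hz, mul_assoc] }
    (eLpNorm F (4 / 3) (stMeasure J)).toReal (fun g => by
      have h1 := (enorm_integral_le_lintegral_enorm (μ := stMeasure J)
        fun z => fld (fun t => U t g) z * (starRingEnd ℂ) (F z)).trans
        ((lintegral_mul_conj_le (memLp_fld_U J g).1 h.1).trans
          (mul_le_mul_left ((N4_mono (subset_univ J) _).trans (strichartz g)) _))
      have h2 := ENNReal.toReal_mono (ENNReal.mul_ne_top enorm_ne_top h.2.ne) h1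
      rw [ENNReal.toReal_mul, toReal_enorm, toReal_enorm, mul_comm] at h2
      exact h2)

open Classical in
/-- The vector `∫_J e^{-isΔ} F(s) ds`. -/
def duh (F : ℝ × Plane → ℂ) (J : Set ℝ) : L2 :=
  if h : MemLp F (4 / 3) (stMeasure J) then (InnerProductSpace.toDual ℂ L2).symm (duhForm F J h)
  else 0

theorem inner_duh {F : ℝ × Plane → ℂ} {J : Set ℝ} (h : MemLp F (4 / 3) (stMeasure J)) (g : L2) :
    inner ℂ (duh F J) g
      = ∫ z, fld (fun t => U t g) z * (starRingEnd ℂ) (F z) ∂stMeasure J := by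
  rw [duh, dif_pos h, InnerProductSpace.toDual_symm_apply]
  rfl

/-- The dual Strichartz estimate: a Riesz representative has the norm of its functional. If the
forcing is not in `L^{4/3}`, then `duh` has the default value zero and the bound is trivial. -/
theorem enorm_duh_le (F : ℝ × Plane → ℂ) (J : Set ℝ) :
    ‖duh F J‖ₑ ≤ eLpNorm F (4 / 3) (stMeasure J) := by
  by_cases h : MemLp F (4 / 3) (stMeasure J)
  · rw [duh, dif_pos h, ← ofReal_norm, LinearIsometryEquiv.norm_map]
    refine (ENNReal.ofReal_le_ofReal
      (LinearMap.mkContinuous_norm_le _ ENNReal.toReal_nonneg _)).trans ?_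
    rw [ENNReal.ofReal_toReal h.2.ne]
  · simp [duh, h]

theorem eq_duh_of_inner {F : ℝ × Plane → ℂ} {J : Set ℝ} (h : MemLp F (4 / 3) (stMeasure J))
    {w : L2} (hw : ∀ g, inner ℂ w g
      = ∫ z, fld (fun t => U t g) z * (starRingEnd ℂ) (F z) ∂stMeasure J) : w = duh F J :=
  ext_inner_right ℂ fun g => by rw [hw, inner_duh h]

theorem memLp_mono_set {F : ℝ × Plane → ℂ} {J K : Set ℝ} (hJK : J ⊆ K) {p : ℝ≥0∞}
    (h : MemLp F p (stMeasure K)) : MemLp F p (stMeasure J) :=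
  h.mono_measure (Measure.prod_mono (Measure.restrict_mono hJK le_rfl) le_rfl)

theorem stMeasure_union {J K : Set ℝ} (hd : Disjoint J K) (hK : MeasurableSet K) :
    stMeasure (J ∪ K) = stMeasure J + stMeasure K := by
  rw [stMeasure, Measure.restrict_union hd hK, Measure.add_prod]; rfl

theorem duh_union {F : ℝ × Plane → ℂ} {J K : Set ℝ} (hd : Disjoint J K) (hK : MeasurableSet K)
    (h : MemLp F (4 / 3) (stMeasure (J ∪ K))) : duh F (J ∪ K) = duh F J + duh F K := by
  have hJ' := memLp_mono_set subset_union_left h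
  have hK' := memLp_mono_set subset_union_right h
  refine (eq_duh_of_inner h fun g => ?_).symm
  rw [inner_add_left, inner_duh hJ', inner_duh hK', stMeasure_union hd hK,
    integral_add_measure (integrable_mul_conj (memLp_fld_U J g) hJ')
      (integrable_mul_conj (memLp_fld_U K g) hK')]

theorem duh_sub {F G : ℝ × Plane → ℂ} {J : Set ℝ} (hF : MemLp F (4 / 3) (stMeasure J))
    (hG : MemLp G (4 / 3) (stMeasure J)) :
    duh F J - duh G J = duh (F - G) J := by
  refine eq_duh_of_inner (hF.sub hG) fun g => ?_
  rw [inner_sub_left, inner_duh hF, inner_duh hG,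
    ← integral_sub (integrable_mul_conj (memLp_fld_U J g) hF)
      (integrable_mul_conj (memLp_fld_U J g) hG)]
  refine integral_congr_ae (Eventually.of_forall fun z => ?_)
  simp only [Pi.sub_apply, map_sub]
  ring

/-- The Duhamel primitive `t ↦ ∫_{J, s < t} e^{-isΔ} F(s) ds`. -/
def duhPrim (F : ℝ × Plane → ℂ) (J : Set ℝ) (t : ℝ) : L2 := duh F (J ∩ Iio t)

theorem duhPrim_sub {F : ℝ × Plane → ℂ} {J : Set ℝ} (hJ : MeasurableSet J)
    (h : MemLp F (4 / 3) (stMeasure J)) {s t : ℝ} (hst : s ≤ t) :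
    duhPrim F J t - duhPrim F J s = duh F (J ∩ Ico s t) := by
  have e : J ∩ Iio t = (J ∩ Iio s) ∪ (J ∩ Ico s t) := by
    rw [← inter_union_distrib_left, Iio_union_Ico_eq_Iio hst]
  have hd : Disjoint (J ∩ Iio s) (J ∩ Ico s t) := by
    refine Disjoint.mono inter_subset_right inter_subset_right ?_
    rw [Set.disjoint_left]; intro x hx hx'; exact absurd hx'.1 (not_le.2 hx)
  have h' : MemLp F (4 / 3) (stMeasure ((J ∩ Iio s) ∪ (J ∩ Ico s t))) := by
    rw [← e]; exact memLp_mono_set inter_subset_left h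
  rw [duhPrim, e, duh_union hd (hJ.inter measurableSet_Ico) h', duhPrim]
  abel

theorem eLpNorm_four_thirds_pow {α : Type*} [MeasurableSpace α] (f : α → ℂ) (μ : Measure α) :
    eLpNorm f (4 / 3) μ = (∫⁻ x, ‖f x‖ₑ ^ (4 / 3 : ℝ) ∂μ) ^ (3 / 4 : ℝ) := by
  rw [eLpNorm_eq_lintegral_rpow_enorm_toReal four_thirds_ne_zero four_thirds_ne_top,
    toReal_four_thirds]
  norm_num

/-- The power `4/3` of the `L^{4/3}` norm over `J × ℝ²`. -/
def mass (F : ℝ × Plane → ℂ) (J : Set ℝ) : ℝ≥0∞ := ∫⁻ z, ‖F z‖ₑ ^ (4 / 3 : ℝ) ∂stMeasure J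

theorem eLpNorm_eq_mass (F : ℝ × Plane → ℂ) (J : Set ℝ) :
    eLpNorm F (4 / 3) (stMeasure J) = mass F J ^ (3 / 4 : ℝ) := eLpNorm_four_thirds_pow _ _

theorem mass_ne_top {F : ℝ × Plane → ℂ} {J : Set ℝ} (h : MemLp F (4 / 3) (stMeasure J)) :
    mass F J ≠ ∞ := by
  have h2 := h.2
  rw [eLpNorm_eq_mass] at h2
  intro hc
  rw [hc, ENNReal.top_rpow_of_pos (by norm_num)] at h2
  exact lt_irrefl _ h2

theorem mass_mono (F : ℝ × Plane → ℂ) {J K : Set ℝ} (h : J ⊆ K) : mass F J ≤ mass F K :=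
  lintegral_mono' (Measure.prod_mono (Measure.restrict_mono h le_rfl) le_rfl) le_rfl

theorem mass_Iio_add (F : ℝ × Plane → ℂ) {J : Set ℝ} (hJ : MeasurableSet J) {s t : ℝ}
    (hst : s ≤ t) : mass F (J ∩ Iio t) = mass F (J ∩ Iio s) + mass F (J ∩ Ico s t) := by
  have e : J ∩ Iio t = (J ∩ Iio s) ∪ (J ∩ Ico s t) := by
    rw [← inter_union_distrib_left, Iio_union_Ico_eq_Iio hst]
  have hd : Disjoint (J ∩ Iio s) (J ∩ Ico s t) := by
    refine Disjoint.mono inter_subset_right inter_subset_right ?_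
    rw [Set.disjoint_left]; intro x hx hx'; exact absurd hx'.1 (not_le.2 hx)
  rw [mass, e, stMeasure_union hd (hJ.inter measurableSet_Ico), lintegral_add_measure]; rfl

/-- Absolute continuity of the integral, applied to the time density `∫ |f(t, x)|^p dx`. -/
theorem exists_small_time {f : ℝ × Plane → ℂ} {J : Set ℝ} {p : ℝ}
    (hf : AEStronglyMeasurable f (stMeasure J)) (hfin : ∫⁻ z, ‖f z‖ₑ ^ p ∂stMeasure J ≠ ∞)
    {ε : ℝ≥0∞} (hε : ε ≠ 0) :
    ∃ δ > (0 : ℝ), ∀ A : Set ℝ, MeasurableSet A → volume A ≤ ENNReal.ofReal δ →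
      ∫⁻ z, ‖f z‖ₑ ^ p ∂stMeasure (J ∩ A) ≤ ε := by
  have hm : AEMeasurable (fun z => ‖f z‖ₑ ^ p) (stMeasure J) := hf.enorm.pow_const p
  let H : ℝ → ℝ≥0∞ := fun t => ∫⁻ x, ‖f (t, x)‖ₑ ^ p
  have e : ∀ A, ∫⁻ z, ‖f z‖ₑ ^ p ∂stMeasure (J ∩ A) = ∫⁻ t in J ∩ A, H t := by
    intro A
    refine lintegral_prod _ (hm.mono_measure ?_)
    exact Measure.prod_mono (Measure.restrict_mono inter_subset_left le_rfl) le_rfl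
  have hfin' : ∫⁻ t in J, H t ≠ ∞ := by
    have := e univ
    rw [inter_univ] at this
    rwa [← this]
  obtain ⟨δ, hδ, h⟩ := exists_pos_setLIntegral_lt_of_measure_lt hfin' hε
  obtain ⟨δ', hδ', hlt⟩ := ENNReal.lt_iff_exists_nnreal_btwn.1 hδ
  refine ⟨δ', by simpa using hδ', fun A hA hv => ?_⟩
  rw [e, inter_comm, ← Measure.restrict_restrict hA]
  refine (h A (lt_of_le_of_lt ?_ hlt)).le
  refine (Measure.restrict_apply_le _ _).trans (hv.trans ?_)
  simp

theorem enorm_duhPrim_sub_le {F : ℝ × Plane → ℂ} {J : Set ℝ} (hJ : MeasurableSet J)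
    (h : MemLp F (4 / 3) (stMeasure J)) {s t : ℝ} (hst : s ≤ t) :
    ‖duhPrim F J t - duhPrim F J s‖ₑ ≤ eLpNorm F (4 / 3) (stMeasure (J ∩ Ico s t)) := by
  rw [duhPrim_sub hJ h hst]; exact enorm_duh_le _ _

theorem enorm_duhPrim_sub_le' {F : ℝ × Plane → ℂ} {J : Set ℝ} (hJ : MeasurableSet J)
    (h : MemLp F (4 / 3) (stMeasure J)) (s t : ℝ) :
    ‖duhPrim F J t - duhPrim F J s‖ₑ
      ≤ eLpNorm F (4 / 3) (stMeasure (J ∩ Icc (min s t) (max s t))) := by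
  rcases le_total s t with hst | hst
  · rw [min_eq_left hst, max_eq_right hst]
    exact (enorm_duhPrim_sub_le hJ h hst).trans (eLpNorm_mono_measure _
      (Measure.prod_mono (Measure.restrict_mono
        (inter_subset_inter_right _ Ico_subset_Icc_self) le_rfl) le_rfl))
  · rw [min_eq_right hst, max_eq_left hst, ← neg_sub, enorm_neg]
    exact (enorm_duhPrim_sub_le hJ h hst).trans (eLpNorm_mono_measure _
      (Measure.prod_mono (Measure.restrict_mono
        (inter_subset_inter_right _ Ico_subset_Icc_self) le_rfl) le_rfl))

theorem continuous_duhPrim {F : ℝ × Plane → ℂ} {J : Set ℝ} (hJ : MeasurableSet J)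
    (h : MemLp F (4 / 3) (stMeasure J)) : Continuous (duhPrim F J) := by
  rw [Metric.continuous_iff]
  intro t ε hε
  have hε2 : ENNReal.ofReal (ε / 2) ^ (4 / 3 : ℝ) ≠ 0 := by
    rw [Ne, ENNReal.rpow_eq_zero_iff]
    rintro (⟨h1, -⟩ | ⟨-, h2⟩)
    · rw [ENNReal.ofReal_eq_zero] at h1; linarith
    · norm_num at h2
  obtain ⟨δ, hδ, hsm⟩ := exists_small_time h.1 (mass_ne_top h) hε2
  refine ⟨δ, hδ, fun s hs => ?_⟩
  have hv : volume (Icc (min t s) (max t s)) ≤ ENNReal.ofReal δ := by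
    rw [Real.volume_Icc, max_sub_min_eq_abs]
    refine ENNReal.ofReal_le_ofReal ?_
    rw [Real.dist_eq] at hs
    exact hs.le
  have h1 := (enorm_duhPrim_sub_le' hJ h t s).trans (le_of_eq (eLpNorm_eq_mass _ _))
  have h2 : ‖duhPrim F J s - duhPrim F J t‖ₑ ≤ ENNReal.ofReal (ε / 2) := by
    refine h1.trans ?_
    calc _ ≤ (ENNReal.ofReal (ε / 2) ^ (4 / 3 : ℝ)) ^ (3 / 4 : ℝ) := by
          gcongr; exact hsm _ measurableSet_Icc hv
      _ = _ := by rw [← ENNReal.rpow_mul]; norm_num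
  rw [← ofReal_norm, ENNReal.ofReal_le_ofReal_iff (by positivity), ← dist_eq_norm] at h2
  linarith

/-- The retarded Strichartz estimate for curves whose increments are controlled by `F`. -/
theorem N4_le_of_increments {F : ℝ × Plane → ℂ} {J : Set ℝ} (hJ : MeasurableSet J)
    (h : MemLp F (4 / 3) (stMeasure J)) {w : ℝ → L2} (hw : Measurable w)
    (hwF : ∀ s t, s ≤ t → ‖w t - w s‖ₑ ≤ eLpNorm F (4 / 3) (stMeasure (J ∩ Ico s t))) (a : ℝ) :
    N4 univ (fun t => U t (w t - w a)) ≤ 10 * eLpNorm F (4 / 3) (stMeasure J) := by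
  have hfin := mass_ne_top h
  have hfin' : ∀ t, mass F (J ∩ Iio t) ≠ ∞ := fun t =>
    ne_top_of_le_ne_top hfin (mass_mono F inter_subset_left)
  set Ω : ℝ := (mass F J).toReal with hΩ
  have hΩ0 : 0 ≤ Ω := ENNReal.toReal_nonneg
  -- The control is the mass of the forcing before time `t`, and the power `3/4` is the reciprocal
  -- of `4/3`. Normalizing the control to `[0, 1]` costs `Ω^(3/4)`, which is the norm of `F`.
  let c : ℝ → ℝ := fun t => (mass F (J ∩ Iio t)).toReal
  have hc0 : ∀ t, 0 ≤ c t := fun t => ENNReal.toReal_nonneg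
  have hc1 : ∀ t, c t ≤ Ω := fun t => ENNReal.toReal_mono hfin (mass_mono F inter_subset_left)
  have hcm : Monotone c := fun s t hst => ENNReal.toReal_mono (hfin' t)
    (mass_mono F (inter_subset_inter_right _ (Iio_subset_Iio hst)))
  have hinc : ∀ s t, s ≤ t → ‖w t - w s‖ ≤ (c t - c s) ^ (3 / 4 : ℝ) := by
    intro s t hst
    have h1 := hwF s t hst
    rw [eLpNorm_eq_mass] at h1
    have hf : mass F (J ∩ Ico s t) ≠ ∞ := ne_top_of_le_ne_top hfin (mass_mono F inter_subset_left)
    have h2 : c t - c s = (mass F (J ∩ Ico s t)).toReal := by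
      simp only [c]
      rw [mass_Iio_add F hJ hst, ENNReal.toReal_add (hfin' s) hf]; ring
    have h3 := ENNReal.toReal_mono (ENNReal.rpow_ne_top_of_nonneg (by norm_num) hf) h1
    rwa [toReal_enorm, ← ENNReal.toReal_rpow, ← h2] at h3
  have hinc' : ∀ s t, ‖w t - w s‖ ≤ |c t - c s| ^ (3 / 4 : ℝ) := by
    intro s t
    rcases le_total s t with hst | hst
    · rw [abs_of_nonneg (sub_nonneg.2 (hcm hst))]; exact hinc s t hst
    · rw [norm_sub_rev, abs_sub_comm, abs_of_nonneg (sub_nonneg.2 (hcm hst))]; exact hinc t s hst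
  have hRHS : eLpNorm F (4 / 3) (stMeasure J) = ENNReal.ofReal (Ω ^ (3 / 4 : ℝ)) := by
    rw [eLpNorm_eq_mass, ← ENNReal.ofReal_rpow_of_nonneg hΩ0 (by norm_num), hΩ,
      ENNReal.ofReal_toReal hfin]
  rw [hRHS]
  refine N4_le_of_variation (ω := fun t => c t / Ω) (hcm.measurable.div_const _)
    (fun t => div_nonneg (hc0 t) hΩ0) (fun t => div_le_one_of_le₀ (hc1 t) hΩ0)
    hw (by positivity) (fun s t => ?_) a
  refine (hinc' s t).trans ?_
  -- If the total mass is zero, the normalized control is a division by zero; then `c` vanishes and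
  -- there is nothing to bound.
  rcases hΩ0.eq_or_lt with h00 | hpos
  · have z1 : c t = 0 := le_antisymm (h00 ▸ hc1 t) (hc0 t)
    have z2 : c s = 0 := le_antisymm (h00 ▸ hc1 s) (hc0 s)
    rw [z1, z2, sub_zero, abs_zero, Real.zero_rpow (by norm_num)]
    positivity
  · rw [← Real.mul_rpow hΩ0 (abs_nonneg _), ← sub_div, abs_div, abs_of_pos hpos,
      mul_div_cancel₀ _ hpos.ne']

/-! ### Sums over the resonant sets. -/

/-- The lattice `ℤ²`. -/
abbrev Lat : Type := ℤ × ℤ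

theorem sq_tsum_mul_le {ι : Type*} (f g : ι → ℝ≥0∞) :
    (∑' i, f i * g i) ^ 2 ≤ (∑' i, f i ^ 2) * ∑' i, g i ^ 2 := by
  let _ : MeasurableSpace ι := ⊤
  have h := sq_lintegral_mul_le (Measure.count : Measure ι) (f := f) (g := g)
    Measurable.of_discrete.aemeasurable Measurable.of_discrete.aemeasurable
  simpa only [lintegral_count] using h

theorem sq_tsum_mul_le_weight {ι : Type*} (w f g : ι → ℝ≥0∞) (h0 : ∀ i, w i ≠ 0)
    (h1 : ∀ i, w i ≠ ∞) :
    (∑' i, f i * g i) ^ 2 ≤ (∑' i, w i * f i ^ 2) * ∑' i, (w i)⁻¹ * g i ^ 2 := by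
  have h := sq_tsum_mul_le (fun i => w i ^ (1 / 2 : ℝ) * f i)
    fun i => (w i)⁻¹ ^ (1 / 2 : ℝ) * g i
  have e1 : ∀ i, w i ^ (1 / 2 : ℝ) * f i * ((w i)⁻¹ ^ (1 / 2 : ℝ) * g i) = f i * g i := by
    intro i
    rw [mul_mul_mul_comm, ← ENNReal.mul_rpow_of_nonneg _ _ (by norm_num),
      ENNReal.mul_inv_cancel (h0 i) (h1 i), ENNReal.one_rpow, one_mul]
  have e2 : ∀ x : ℝ≥0∞, (x ^ (1 / 2 : ℝ)) ^ 2 = x := by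
    intro x; rw [← ENNReal.rpow_natCast, ← ENNReal.rpow_mul]; norm_num
  simpa only [e1, mul_pow, e2] using h

theorem latSq_nonneg (p : Lat) : (0 : ℝ) ≤ (latSq p : ℝ) := by
  unfold latSq; push_cast; positivity

theorem weight_ne_top (s : ℝ) (p : Lat) : weight s p ≠ ∞ := ENNReal.ofReal_ne_top

theorem weight_ne_zero (s : ℝ) (p : Lat) : weight s p ≠ 0 := by
  have := latSq_nonneg p
  have h : 0 < (1 + (latSq p : ℝ)) ^ s := Real.rpow_pos_of_pos (by linarith) s
  simpa [weight] using h

theorem one_le_weight {s : ℝ} (hs : 0 ≤ s) (p : Lat) : 1 ≤ weight s p := by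
  have := latSq_nonneg p
  rw [weight, ENNReal.one_le_ofReal]
  exact Real.one_le_rpow (by linarith) hs

theorem weight_mono {s s' : ℝ} (h : s ≤ s') (p : Lat) : weight s p ≤ weight s' p := by
  have := latSq_nonneg p
  exact ENNReal.ofReal_le_ofReal (Real.rpow_le_rpow_of_exponent_le (by linarith) h)

/-- The constant `2 ∑_x 1/(1+x²)`. -/
def circleConst : ℝ≥0∞ := ∑' x : ℤ, 2 * ENNReal.ofReal ((1 + (x : ℝ) ^ 2)⁻¹)

theorem circleConst_ne_top : circleConst ≠ ∞ := by
  rw [circleConst, ENNReal.tsum_mul_left]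
  refine ENNReal.mul_ne_top (by norm_num) (Summable.tsum_ofReal_ne_top ?_)
  have h1 : Summable fun n : ℤ => 1 / (n : ℝ) ^ 2 := Real.summable_one_div_int_pow.2 (by norm_num)
  have h2 : Summable fun n : ℤ => if n = 0 then (1 : ℝ) else 0 :=
    summable_of_ne_finset_zero (s := {0}) fun n hn => by
      simp only [Finset.mem_singleton] at hn; simp [hn]
  refine Summable.of_nonneg_of_le (fun n => by positivity) (fun n => ?_) (h1.add h2)
  by_cases hn : n = 0
  · simp [hn]
  · have : (0 : ℝ) < (n : ℝ) ^ 2 := by positivity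
    simp only [hn, if_false, add_zero, one_div]
    gcongr
    linarith

/-- Indicator of the circle `|p|² + |k - p|² = τ`. -/
def circ (k : Lat) (τ : ℤ) (p : Lat) : ℝ≥0∞ := if latSq p + latSq (k - p) = τ then 1 else 0

theorem circ_mul_self (k : Lat) (τ : ℤ) (p : Lat) : circ k τ p * circ k τ p = circ k τ p := by
  unfold circ; split_ifs <;> simp

theorem circ_sq (k : Lat) (τ : ℤ) (p : Lat) : circ k τ p ^ 2 = circ k τ p := by
  rw [sq, circ_mul_self]

theorem circ_refl (k : Lat) (τ : ℤ) (p : Lat) : circ k τ (k - p) = circ k τ p := by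
  unfold circ; rw [sub_sub_cancel, add_comm]

/-- For a fixed first coordinate the equation is quadratic in `y` and symmetric under `y ↦ k.2 - y`,
so one solution `y₀` determines both. -/
theorem tsum_circ_le_two (k : Lat) (τ x : ℤ) : ∑' y : ℤ, circ k τ (x, y) ≤ 2 := by
  by_cases h : ∃ y, latSq (x, y) + latSq (k - (x, y)) = τ
  · obtain ⟨y₀, h₀⟩ := h
    have hb : ∀ y, circ k τ (x, y) ≤
        (if y = y₀ then 1 else 0) + (if y = k.2 - y₀ then 1 else 0) := by
      intro y
      unfold circ
      split_ifs with h1 h2 h3 h3 <;> try simp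
      have : (y - y₀) * (y - (k.2 - y₀)) = 0 := by
        simp only [latSq, Prod.fst_sub, Prod.snd_sub] at h1 h₀
        nlinarith
      rcases mul_eq_zero.1 this with h4 | h4
      · exact absurd (sub_eq_zero.1 h4) h2
      · exact absurd (sub_eq_zero.1 h4) h3
    refine (ENNReal.tsum_le_tsum hb).trans ?_
    rw [ENNReal.tsum_add, tsum_ite_eq, tsum_ite_eq]
    norm_num
  · push Not at h
    have : ∀ y, circ k τ (x, y) = 0 := fun y => by unfold circ; rw [if_neg (h y)]
    simp [this]

/-- The lattice points of a circle are uniformly summable against `⟨p⟩⁻²`. -/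
theorem tsum_circ_weight_le (k : Lat) (τ : ℤ) :
    ∑' p : Lat, circ k τ p * (weight 1 p)⁻¹ ≤ circleConst := by
  rw [ENNReal.tsum_prod']
  refine ENNReal.tsum_le_tsum fun x => ?_
  -- Only the first coordinate of the weight is kept. What remains is a convergent sum in one
  -- variable, independent of the circle; no count of the lattice points on it is needed.
  have hw : ∀ y, (weight 1 (x, y))⁻¹ ≤ ENNReal.ofReal ((1 + (x : ℝ) ^ 2)⁻¹) := by
    intro y
    rw [ENNReal.ofReal_inv_of_pos (by positivity), ENNReal.inv_le_inv, weight, Real.rpow_one]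
    refine ENNReal.ofReal_le_ofReal ?_
    simp only [latSq]; push_cast; nlinarith [sq_nonneg (y : ℝ)]
  calc ∑' y, circ k τ (x, y) * (weight 1 (x, y))⁻¹
      ≤ ∑' y, circ k τ (x, y) * ENNReal.ofReal ((1 + (x : ℝ) ^ 2)⁻¹) :=
        ENNReal.tsum_le_tsum fun y => by gcongr; exact hw y
    _ = (∑' y, circ k τ (x, y)) * ENNReal.ofReal ((1 + (x : ℝ) ^ 2)⁻¹) := ENNReal.tsum_mul_right
    _ ≤ _ := by gcongr; exact tsum_circ_le_two k τ x

theorem tsum_circ_weight_le' (k : Lat) (τ : ℤ) :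
    ∑' p : Lat, circ k τ p * (weight 1 (k - p))⁻¹ ≤ circleConst := by
  rw [← (Equiv.subLeft k).tsum_eq]
  simpa only [Equiv.subLeft_apply, circ_refl, sub_sub_cancel] using tsum_circ_weight_le k τ

/-- The squared norm `∑ W_p a_p²`. -/
def Hn (W a : Lat → ℝ≥0∞) : ℝ≥0∞ := ∑' p, W p * a p ^ 2

/-- The trilinear sum over the resonant set. -/
def triSum (a b c : Lat → ℝ≥0∞) (j : Lat) : ℝ≥0∞ :=
  ∑' q : resonantSet j, a q.1.1 * b q.1.2.1 * c q.1.2.2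

/-- A resonant triple is determined by `r = j₂` and `p = j₁`, because `j₃ = j + r - p`; the
quadratic condition then places `p` on the circle `|p|² + |j + r - p|² = |j|² + |r|²`. -/
theorem triSum_le (a b c : Lat → ℝ≥0∞) (j : Lat) :
    triSum a b c j ≤ ∑' r : Lat, b r *
      ∑' p : Lat, circ (j + r) (latSq j + latSq r) p * (a p * c (j + r - p)) := by
  have e : ∑' r : Lat, b r *
      ∑' p : Lat, circ (j + r) (latSq j + latSq r) p * (a p * c (j + r - p))
      = ∑' z : Lat × Lat, b z.1 *
        (circ (j + z.1) (latSq j + latSq z.1) z.2 * (a z.2 * c (j + z.1 - z.2))) := by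
    rw [ENNReal.tsum_prod' (f := fun z : Lat × Lat => b z.1 *
        (circ (j + z.1) (latSq j + latSq z.1) z.2 * (a z.2 * c (j + z.1 - z.2))))]
    exact tsum_congr fun r => ENNReal.tsum_mul_left.symm
  rw [e, triSum]
  let ι : resonantSet j → Lat × Lat := fun q => (q.1.2.1, q.1.1)
  have h3 : ∀ q : resonantSet j, q.1.2.2 = j + q.1.2.1 - q.1.1 := by
    rintro ⟨⟨j1, j2, j3⟩, h1, h2⟩
    change j3 = j + j2 - j1
    rw [← show j1 - j2 + j3 = j from h1]; abel
  have hinj : Function.Injective ι := by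
    intro q q' hqq
    have e1 : q.1.2.1 = q'.1.2.1 := (Prod.ext_iff.1 hqq).1
    have e2 : q.1.1 = q'.1.1 := (Prod.ext_iff.1 hqq).2
    have e3 : q.1.2.2 = q'.1.2.2 := by rw [h3, h3, e1, e2]
    exact Subtype.ext (Prod.ext e2 (Prod.ext e1 e3))
  refine le_trans (le_of_eq (tsum_congr fun q => ?_)) (ENNReal.tsum_comp_le_tsum_of_injective hinj _)
  simp only [ι]
  have hc : circ (j + q.1.2.1) (latSq j + latSq q.1.2.1) q.1.1 = 1 := by
    unfold circ
    rw [← h3 q, if_pos]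
    have := q.2.2
    linarith
  rw [hc, ← h3 q, one_mul]; ring

/-- Cauchy-Schwarz in `r` with weight `⟨r⟩²` extracts the `h¹` norm of `b`, and Cauchy-Schwarz in
`p` with weight `⟨k - p⟩²` extracts that of `c` and one circle sum. Summation over `j` and `r`
produces a second circle sum, so `a` is needed only in `ℓ²`. -/
theorem tsum_sq_triSum_le (a b c : Lat → ℝ≥0∞) :
    ∑' j, triSum a b c j ^ 2
      ≤ circleConst ^ 2 * (Hn (fun _ => 1) a * Hn (weight 1) b * Hn (weight 1) c) := by
  set K := circleConst
  let G : Lat → ℤ → ℝ≥0∞ := fun k τ => ∑' p : Lat, circ k τ p * (a p * c (k - p))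
  let e : Lat → Lat → ℝ≥0∞ := fun k p => weight 1 (k - p) * (a p * c (k - p)) ^ 2
  let E : Lat → ℤ → ℝ≥0∞ := fun k τ => ∑' p : Lat, circ k τ p * e k p
  have hG : ∀ k τ, G k τ ^ 2 ≤ K * E k τ := by
    intro k τ
    have h := sq_tsum_mul_le_weight (fun p => weight 1 (k - p))
      (fun p => circ k τ p * (a p * c (k - p))) (fun p => circ k τ p)
      (fun p => weight_ne_zero 1 _) (fun p => weight_ne_top 1 _)
    have e1 : ∀ p, circ k τ p * (a p * c (k - p)) * circ k τ p
        = circ k τ p * (a p * c (k - p)) := fun p => by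
      rw [mul_right_comm, circ_mul_self]
    simp only [e1] at h
    refine h.trans ?_
    rw [mul_comm]
    refine mul_le_mul' ?_ (le_of_eq ?_)
    · refine le_trans (le_of_eq (tsum_congr fun p => ?_)) (tsum_circ_weight_le' k τ)
      rw [circ_sq, mul_comm]
    · refine tsum_congr fun p => ?_
      simp only [e]; rw [mul_pow, circ_sq]; ring
  have hT : ∀ j, triSum a b c j ^ 2 ≤ Hn (weight 1) b *
      ∑' r, (weight 1 r)⁻¹ * (K * E (j + r) (latSq j + latSq r)) := by
    intro j
    refine (pow_le_pow_left' (triSum_le a b c j) 2).trans ?_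
    refine (sq_tsum_mul_le_weight (weight 1) b
      (fun r => G (j + r) (latSq j + latSq r)) (weight_ne_zero 1) (weight_ne_top 1)).trans ?_
    refine mul_le_mul' le_rfl (ENNReal.tsum_le_tsum fun r => ?_)
    gcongr
    exact hG _ _
  have hconv : ∑' k : Lat, ∑' p : Lat, e k p = Hn (fun _ => 1) a * Hn (weight 1) c := by
    rw [ENNReal.tsum_comm]
    simp only [Hn, one_mul]
    rw [← ENNReal.tsum_mul_right]
    refine tsum_congr fun p => ?_
    rw [← ENNReal.tsum_mul_left,
      ← (Equiv.subRight p).tsum_eq (fun k => a p ^ 2 * (weight 1 k * c k ^ 2))]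
    refine tsum_congr fun k => ?_
    simp only [e, Equiv.subRight_apply]; ring
  -- With `k = j + r` the roles of `p` and `r` are exchanged: for fixed `k` and `p` the index `r`
  -- runs over the circle with center `k/2` through `p`, and `⟨r⟩⁻²` is summable on it.
  have hsum : ∑' j, ∑' r, (weight 1 r)⁻¹ * E (j + r) (latSq j + latSq r)
      ≤ K * ∑' k : Lat, ∑' p : Lat, e k p := by
    calc ∑' j, ∑' r, (weight 1 r)⁻¹ * E (j + r) (latSq j + latSq r)
        = ∑' r : Lat, ∑' k : Lat, (weight 1 r)⁻¹ * E k (latSq (k - r) + latSq r) := by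
          rw [ENNReal.tsum_comm]
          refine tsum_congr fun r => ?_
          rw [← (Equiv.subRight r).tsum_eq]
          refine tsum_congr fun k => ?_
          simp only [Equiv.subRight_apply, sub_add_cancel]
      _ = ∑' k : Lat, ∑' r : Lat, ∑' p : Lat,
            e k p * (circ k (latSq p + latSq (k - p)) r * (weight 1 r)⁻¹) := by
          rw [ENNReal.tsum_comm]
          refine tsum_congr fun k => tsum_congr fun r => ?_
          simp only [E]
          rw [← ENNReal.tsum_mul_left]
          refine tsum_congr fun p => ?_
          have : circ k (latSq (k - r) + latSq r) p = circ k (latSq p + latSq (k - p)) r := by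
            unfold circ
            refine if_congr ?_ rfl rfl
            constructor <;> intro h <;> linarith
          rw [this]; ring
      _ = ∑' k : Lat, ∑' p : Lat, e k p *
            ∑' r : Lat, circ k (latSq p + latSq (k - p)) r * (weight 1 r)⁻¹ := by
          refine tsum_congr fun k => ?_
          rw [ENNReal.tsum_comm]
          simp only [ENNReal.tsum_mul_left]
      _ ≤ ∑' k : Lat, ∑' p : Lat, e k p * K :=
          ENNReal.tsum_le_tsum fun k => ENNReal.tsum_le_tsum fun p => by
            gcongr; exact tsum_circ_weight_le _ _
      _ = _ := by simp only [ENNReal.tsum_mul_right]; rw [mul_comm]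
  calc ∑' j, triSum a b c j ^ 2
      ≤ ∑' j, Hn (weight 1) b * ∑' r, (weight 1 r)⁻¹ * (K * E (j + r) (latSq j + latSq r)) :=
        ENNReal.tsum_le_tsum hT
    _ = Hn (weight 1) b * (K * ∑' j, ∑' r, (weight 1 r)⁻¹ * E (j + r) (latSq j + latSq r)) := by
        rw [ENNReal.tsum_mul_left]
        congr 1
        simp only [← ENNReal.tsum_mul_left]
        refine tsum_congr fun j => tsum_congr fun r => ?_
        ring
    _ ≤ Hn (weight 1) b * (K * (K * (Hn (fun _ => 1) a * Hn (weight 1) c))) := by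
        gcongr; rw [← hconv]; exact hsum
    _ = _ := by ring

theorem triSum_swap (a b c : Lat → ℝ≥0∞) (j : Lat) : triSum a b c j = triSum c b a j := by
  let σ : resonantSet j ≃ resonantSet j :=
    { toFun := fun q => ⟨(q.1.2.2, q.1.2.1, q.1.1), by
        obtain ⟨⟨j1, j2, j3⟩, h1, h2⟩ := q
        refine ⟨?_, ?_⟩
        · simp only at h1 ⊢; rw [← h1]; abel
        · simp only at h2 ⊢; linarith⟩
      invFun := fun q => ⟨(q.1.2.2, q.1.2.1, q.1.1), by
        obtain ⟨⟨j1, j2, j3⟩, h1, h2⟩ := q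
        refine ⟨?_, ?_⟩
        · simp only at h1 ⊢; rw [← h1]; abel
        · simp only at h2 ⊢; linarith⟩
      left_inv := fun q => rfl
      right_inv := fun q => rfl }
  rw [triSum, ← σ.tsum_eq]
  refine tsum_congr fun q => ?_
  simp only [σ, Equiv.coe_fn_mk]
  ring

/-- Weights `W` with `W_j ≤ A (W_{j₁} + W_{j₃})` on the resonant set. -/
def Admissible (A : ℝ≥0∞) (W : Lat → ℝ≥0∞) : Prop :=
  ∀ j, ∀ q ∈ resonantSet j, W j ≤ A * (W q.1 + W q.2.2)

theorem add_sq_le_two_mul (x y : ℝ≥0∞) : (x + y) ^ 2 ≤ 2 * (x ^ 2 + y ^ 2) := by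
  have h := sq_tsum_mul_le (fun i : Bool => if i then x else y) (fun _ => 1)
  simp only [tsum_fintype, Fintype.sum_bool, if_true, mul_one, one_pow] at h
  simp only [Bool.false_eq_true, if_false] at h
  calc _ ≤ (x ^ 2 + y ^ 2) * (1 + 1) := h
    _ = _ := by ring

/-- The weighted trilinear estimate over the resonant sets. -/
theorem Hn_triSum_le {A : ℝ≥0∞} {W : Lat → ℝ≥0∞} (hW : Admissible A W) (a b c : Lat → ℝ≥0∞) :
    Hn W (triSum a b c) ≤ 2 * A * circleConst ^ 2 *
      (Hn W a * Hn (weight 1) b * Hn (weight 1) c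
        + Hn (weight 1) a * Hn (weight 1) b * Hn W c) := by
  have e2 : ∀ x : ℝ≥0∞, (x ^ (1 / 2 : ℝ)) ^ 2 = x := by
    intro x; rw [← ENNReal.rpow_natCast, ← ENNReal.rpow_mul]; norm_num
  -- The square root of the weight is moved onto the first or the third factor, which becomes the
  -- `ℓ²` factor of the unweighted estimate. The conjugated factor never receives it.
  let S : Lat → ℝ≥0∞ := fun p => W p ^ (1 / 2 : ℝ)
  let B : ℝ≥0∞ := A ^ (1 / 2 : ℝ)
  have hS : ∀ j, ∀ q ∈ resonantSet j, S j ≤ B * (S q.1 + S q.2.2) := by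
    intro j q hq
    have h1 := ENNReal.rpow_le_rpow (hW j q hq) (show (0 : ℝ) ≤ 1 / 2 by norm_num)
    rw [ENNReal.mul_rpow_of_nonneg _ _ (by norm_num)] at h1
    refine h1.trans ?_
    gcongr
    exact ENNReal.rpow_add_le_add_rpow _ _ (by norm_num) (by norm_num)
  have hpt : ∀ j, S j * triSum a b c j
      ≤ B * (triSum (fun p => S p * a p) b c j + triSum (fun p => S p * c p) b a j) := by
    intro j
    rw [triSum_swap (fun p => S p * c p) b a]
    simp only [triSum]
    rw [← ENNReal.tsum_mul_left, ← ENNReal.tsum_add, ← ENNReal.tsum_mul_left]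
    refine ENNReal.tsum_le_tsum fun q => ?_
    calc S j * (a q.1.1 * b q.1.2.1 * c q.1.2.2)
        ≤ B * (S q.1.1 + S q.1.2.2) * (a q.1.1 * b q.1.2.1 * c q.1.2.2) := by
          gcongr; exact hS j q.1 q.2
      _ = _ := by ring
  have hone : ∀ f : Lat → ℝ≥0∞, Hn (fun _ => 1) (fun p => S p * f p) = Hn W f := by
    intro f
    simp only [Hn, S, mul_pow, e2, one_mul]
  calc Hn W (triSum a b c) = ∑' j, (S j * triSum a b c j) ^ 2 := by
        simp only [Hn, S, mul_pow, e2]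
    _ ≤ ∑' j, A * (2 * (triSum (fun p => S p * a p) b c j ^ 2
          + triSum (fun p => S p * c p) b a j ^ 2)) := by
        refine ENNReal.tsum_le_tsum fun j => (pow_le_pow_left' (hpt j) 2).trans ?_
        rw [mul_pow, e2]
        gcongr
        exact add_sq_le_two_mul _ _
    _ = A * (2 * (∑' j, triSum (fun p => S p * a p) b c j ^ 2
          + ∑' j, triSum (fun p => S p * c p) b a j ^ 2)) := by
        rw [ENNReal.tsum_mul_left, ENNReal.tsum_mul_left, ENNReal.tsum_add]
    _ ≤ A * (2 * (circleConst ^ 2 * (Hn W a * Hn (weight 1) b * Hn (weight 1) c)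
          + circleConst ^ 2 * (Hn W c * Hn (weight 1) b * Hn (weight 1) a))) := by
        gcongr
        · exact (tsum_sq_triSum_le _ b c).trans (by rw [hone])
        · exact (tsum_sq_triSum_le _ b a).trans (by rw [hone])
    _ = _ := by ring

/-- Dropping `-|j₂|²` from the resonance identity gives `|j|² ≤ |j₁|² + |j₃|²`, so `1 + |j|²` is at
most twice the larger of `1 + |j₁|²` and `1 + |j₃|²`. -/
theorem admissible_weight {s : ℝ} (hs : 0 ≤ s) :
    Admissible (ENNReal.ofReal (2 ^ s)) (weight s) := by
  rintro j ⟨j1, j2, j3⟩ ⟨h1, h2⟩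
  have p1 := latSq_nonneg j1
  have p2 := latSq_nonneg j2
  have p3 := latSq_nonneg j3
  have pj := latSq_nonneg j
  have h2' : (latSq j1 : ℝ) - latSq j2 + latSq j3 = latSq j := by exact_mod_cast h2
  simp only [weight]
  rw [← ENNReal.ofReal_add (by positivity) (by positivity), ← ENNReal.ofReal_mul (by positivity)]
  refine ENNReal.ofReal_le_ofReal ?_
  have hx : (1 : ℝ) ≤ 1 + latSq j1 := by linarith
  have hy : (1 : ℝ) ≤ 1 + latSq j3 := by linarith
  rcases le_total (latSq j1 : ℝ) (latSq j3 : ℝ) with h | h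
  · calc (1 + (latSq j : ℝ)) ^ s ≤ (2 * (1 + (latSq j3 : ℝ))) ^ s :=
          Real.rpow_le_rpow (by positivity) (by linarith) hs
      _ = 2 ^ s * (1 + (latSq j3 : ℝ)) ^ s := Real.mul_rpow (by norm_num) (by positivity)
      _ ≤ _ := by gcongr; exact le_add_of_nonneg_left (by positivity)
  · calc (1 + (latSq j : ℝ)) ^ s ≤ (2 * (1 + (latSq j1 : ℝ))) ^ s :=
          Real.rpow_le_rpow (by positivity) (by linarith) hs
      _ = 2 ^ s * (1 + (latSq j1 : ℝ)) ^ s := Real.mul_rpow (by norm_num) (by positivity)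
      _ ≤ _ := by gcongr; exact le_add_of_nonneg_right (by positivity)

/-- The constant does not depend on the truncation. Bounded weights give norms that are finite a
priori, which is what absorbing a term into the left side requires. -/
theorem Admissible.min {A : ℝ≥0∞} {W : Lat → ℝ≥0∞} (h : Admissible A W) (hA : 1 ≤ A) (n : ℝ≥0∞) :
    Admissible A (fun p => W p ⊓ n) := by
  intro j q hq
  have hj := h j q hq
  simp only
  rcases le_total (W q.1) n with h1 | h1
  · rcases le_total (W q.2.2) n with h2 | h2
    · rw [inf_eq_left.2 h1, inf_eq_left.2 h2]; exact inf_le_left.trans hj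
    · rw [inf_eq_right.2 h2]
      refine inf_le_right.trans (le_trans ?_ (mul_le_mul_left hA _))
      rw [one_mul]; exact le_add_self
  · rw [inf_eq_right.2 h1]
    refine inf_le_right.trans (le_trans ?_ (mul_le_mul_left hA _))
    rw [one_mul]; exact le_self_add

/-! ### Space-time estimates for the nonlinearity. -/

section Holder

variable {α : Type*} [MeasurableSpace α] {μ : Measure α}

/-- Minkowski for finite sums, then monotone convergence along the directed family of finite
subsets. -/
theorem eLpNorm_tsum_le {ι : Type*} [Countable ι] {f : ι → α → ℝ≥0∞}
    (hf : ∀ i, AEMeasurable (f i) μ) {p : ℝ≥0∞} (hp : 1 ≤ p) (hp' : p ≠ ∞) :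
    eLpNorm (fun z => ∑' i, f i z) p μ ≤ ∑' i, eLpNorm (f i) p μ := by
  have hp0 : p ≠ 0 := (zero_lt_one.trans_le hp).ne'
  have hpr : 0 < p.toReal := ENNReal.toReal_pos hp0 hp'
  have key : ∀ s : Finset ι, ∫⁻ z, (∑ i ∈ s, f i z) ^ p.toReal ∂μ
      ≤ (∑' i, eLpNorm (f i) p μ) ^ p.toReal := by
    intro s
    have h1 := eLpNorm_sum_le (s := s) (f := f) (fun i _ => (hf i).aestronglyMeasurable) hp
    rw [eLpNorm_eq_lintegral_rpow_enorm_toReal hp0 hp'] at h1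
    have h2 := h1.trans (ENNReal.sum_le_tsum s)
    have h3 := ENNReal.rpow_le_rpow h2 hpr.le
    rw [← ENNReal.rpow_mul, one_div, inv_mul_cancel₀ hpr.ne', ENNReal.rpow_one] at h3
    refine le_trans (le_of_eq (lintegral_congr fun z => ?_)) h3
    simp
  rw [eLpNorm_eq_lintegral_rpow_enorm_toReal hp0 hp']
  have e1 : ∀ z, (∑' i, f i z) ^ p.toReal = ⨆ s : Finset ι, (∑ i ∈ s, f i z) ^ p.toReal := by
    intro z
    rw [ENNReal.tsum_eq_iSup_sum]
    exact (ENNReal.orderIsoRpow p.toReal hpr).map_iSup _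
  simp only [enorm_eq_self, e1]
  rw [lintegral_iSup_directed]
  · have h4 : (⨆ s : Finset ι, ∫⁻ z, (∑ i ∈ s, f i z) ^ p.toReal ∂μ)
        ≤ (∑' i, eLpNorm (f i) p μ) ^ p.toReal := iSup_le key
    have h5 := ENNReal.rpow_le_rpow h4 (show 0 ≤ 1 / p.toReal by positivity)
    rwa [← ENNReal.rpow_mul, mul_one_div_cancel hpr.ne', ENNReal.rpow_one] at h5
  · intro s
    exact (Finset.aemeasurable_fun_sum s fun i _ => hf i).pow_const _
  · refine Monotone.directed_le fun s t hst z => ?_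
    refine ENNReal.rpow_le_rpow ?_ hpr.le
    exact Finset.sum_le_sum_of_subset hst

instance holderTriple_four_four : ENNReal.HolderTriple 4 4 2 := by
  refine ⟨?_⟩
  rw [← two_mul, show (4 : ℝ≥0∞) = 2 * 2 by norm_num,
    ENNReal.mul_inv (by norm_num) (by norm_num), ← mul_assoc,
    ENNReal.mul_inv_cancel (by norm_num) (by norm_num), one_mul]

instance holderTriple_two_four : ENNReal.HolderTriple 2 4 (4 / 3) := by
  refine ⟨?_⟩
  rw [ENNReal.inv_div (by norm_num) (by norm_num)]
  have : (2 : ℝ≥0∞)⁻¹ = 2 / 4 := by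
    rw [show (4 : ℝ≥0∞) = 2 * 2 by norm_num, ENNReal.div_eq_inv_mul,
      ENNReal.mul_inv (by norm_num) (by norm_num), mul_assoc,
      ENNReal.inv_mul_cancel (by norm_num) (by norm_num), mul_one]
  rw [this, ← one_div, ← ENNReal.add_div]; norm_num

theorem eLpNorm_mul_three_le {a b c : α → ℂ} (ha : AEStronglyMeasurable a μ)
    (hb : AEStronglyMeasurable b μ) (hc : AEStronglyMeasurable c μ) :
    eLpNorm (fun z => ‖a z‖ₑ * ‖b z‖ₑ * ‖c z‖ₑ) (4 / 3) μ
      ≤ eLpNorm a 4 μ * eLpNorm b 4 μ * eLpNorm c 4 μ := by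
  have h1 := eLpNorm_smul_le_mul_eLpNorm (p := 4) (q := 4) (r := 2) hb ha
  have h2 := eLpNorm_smul_le_mul_eLpNorm (p := 2) (q := 4) (r := 4 / 3) hc (ha.smul hb)
  calc eLpNorm (fun z => ‖a z‖ₑ * ‖b z‖ₑ * ‖c z‖ₑ) (4 / 3) μ
      = eLpNorm ((a • b) • c) (4 / 3) μ := by
        rw [← eLpNorm_enorm ((a • b) • c)]
        congr 1
        ext z
        simp [enorm_mul]
    _ ≤ _ := h2.trans (by gcongr)

end Holder

/-- A family of curves in `L²`, each of them measurable. -/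
def MeasCurve (u : ℝ → Seq) : Prop := ∀ p, Measurable fun t => u t p

/-- The space-time function of the component `p`. -/
def cfld (u : ℝ → Seq) (p : Lat) : ℝ × Plane → ℂ := fld fun t => u t p

/-- The nonlinearity as a jointly measurable space-time function. -/
def nlFld (u : ℝ → Seq) (j : Lat) (z : ℝ × Plane) : ℂ :=
  ∑' q : resonantSet j, cfld u q.1.1 z * (starRingEnd ℂ) (cfld u q.1.2.1 z) * cfld u q.1.2.2 z

/-- The absolute trilinear sum. -/
def majFld (a b c : Lat → ℝ × Plane → ℂ) (j : Lat) (z : ℝ × Plane) : ℝ≥0∞ :=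
  ∑' q : resonantSet j, ‖a q.1.1 z‖ₑ * ‖b q.1.2.1 z‖ₑ * ‖c q.1.2.2 z‖ₑ

/-- The sequence of `L⁴(J × ℝ²)` norms. -/
def A4 (J : Set ℝ) (u : ℝ → Seq) (p : Lat) : ℝ≥0∞ := N4 J fun t => u t p

theorem measurable_cfld {u : ℝ → Seq} (hu : MeasCurve u) (p : Lat) : Measurable (cfld u p) :=
  measurable_fld (hu p)

theorem measurable_nlFld {u : ℝ → Seq} (hu : MeasCurve u) (j : Lat) : Measurable (nlFld u j) :=
  Measurable.tsum fun _ => ((measurable_cfld hu _).mul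
    (Complex.continuous_conj.measurable.comp (measurable_cfld hu _))).mul (measurable_cfld hu _)

/-- There are countably many components, so a single null set serves all of them. This ties the
jointly measurable nonlinearity to the one in the equation. -/
theorem nlFld_ae (u : ℝ → Seq) (j : Lat) (t : ℝ) :
    (fun x => nlFld u j (t, x)) =ᵐ[volume] nonlinearity (u t) j := by
  have h : ∀ᵐ x, ∀ p : Lat, cfld u p (t, x) = u t p x :=
    ae_all_iff.2 fun p => fld_ae (fun t => u t p) t
  filter_upwards [h] with x hx
  simp only [nlFld, nonlinearity, hx]

theorem enorm_nlFld_le (u : ℝ → Seq) (j : Lat) (z : ℝ × Plane) :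
    ‖nlFld u j z‖ₑ ≤ majFld (cfld u) (cfld u) (cfld u) j z := by
  refine (enorm_tsum_le_tsum_enorm).trans (le_of_eq (tsum_congr fun q => ?_))
  rw [enorm_mul, enorm_mul, RCLike.enorm_conj]

theorem measurable_majFld {a b c : Lat → ℝ × Plane → ℂ} (ha : ∀ p, Measurable (a p))
    (hb : ∀ p, Measurable (b p)) (hc : ∀ p, Measurable (c p)) (j : Lat) :
    Measurable (majFld a b c j) :=
  Measurable.tsum fun _ => ((ha _).enorm.mul (hb _).enorm).mul (hc _).enorm

theorem eLpNorm_majFld_le {a b c : Lat → ℝ × Plane → ℂ} (ha : ∀ p, Measurable (a p))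
    (hb : ∀ p, Measurable (b p)) (hc : ∀ p, Measurable (c p)) (j : Lat) (μ : Measure (ℝ × Plane)) :
    eLpNorm (majFld a b c j) (4 / 3) μ
      ≤ triSum (fun p => eLpNorm (a p) 4 μ) (fun p => eLpNorm (b p) 4 μ)
        (fun p => eLpNorm (c p) 4 μ) j := by
  refine (eLpNorm_tsum_le (fun q => (((ha _).enorm.mul (hb _).enorm).mul
    (hc _).enorm).aemeasurable) one_le_four_thirds four_thirds_ne_top).trans ?_
  exact ENNReal.tsum_le_tsum fun q => eLpNorm_mul_three_le (ha _).aestronglyMeasurable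
    (hb _).aestronglyMeasurable (hc _).aestronglyMeasurable

theorem eLpNorm_nlFld_le {u : ℝ → Seq} (hu : MeasCurve u) (J : Set ℝ) (j : Lat) :
    eLpNorm (nlFld u j) (4 / 3) (stMeasure J) ≤ triSum (A4 J u) (A4 J u) (A4 J u) j := by
  refine le_trans ?_ (eLpNorm_majFld_le (measurable_cfld hu) (measurable_cfld hu)
    (measurable_cfld hu) j (stMeasure J))
  exact eLpNorm_mono_enorm fun z => by simpa using enorm_nlFld_le u j z

theorem MeasCurve.sub {u v : ℝ → Seq} (hu : MeasCurve u) (hv : MeasCurve v) : MeasCurve (u - v) :=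
  fun p => (hu p).sub (hv p)

theorem cfld_sub_ae {u v : ℝ → Seq} (hu : MeasCurve u) (hv : MeasCurve v) (J : Set ℝ) :
    ∀ᵐ z ∂stMeasure J, ∀ p, cfld (u - v) p z = cfld u p z - cfld v p z :=
  ae_all_iff.2 fun p => fld_sub (hu p) (hv p) J

/-- A finite `L^{4/3}` norm of the absolute sum makes the cubic series converge absolutely almost
everywhere. Without convergence `tsum` is zero by default and differences could not be taken
termwise. -/
theorem ae_majFld_lt_top {u : ℝ → Seq} (hu : MeasCurve u) {J : Set ℝ} {j : Lat}
    (h : triSum (A4 J u) (A4 J u) (A4 J u) j ≠ ∞) :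
    ∀ᵐ z ∂stMeasure J, majFld (cfld u) (cfld u) (cfld u) j z < ∞ := by
  have hm := measurable_majFld (measurable_cfld hu) (measurable_cfld hu) (measurable_cfld hu) j
  have h1 := ((eLpNorm_majFld_le (measurable_cfld hu) (measurable_cfld hu)
    (measurable_cfld hu) j (stMeasure J)).trans_lt h.lt_top)
  rw [eLpNorm_lt_top_iff_lintegral_rpow_enorm_lt_top four_thirds_ne_zero four_thirds_ne_top,
    toReal_four_thirds] at h1
  simp only [enorm_eq_self] at h1
  filter_upwards [ae_lt_top (hm.pow_const _) h1.ne] with z hz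
  rw [lt_top_iff_ne_top] at hz ⊢
  intro hc
  rw [hc] at hz
  exact hz (ENNReal.top_rpow_of_pos (by norm_num))

/-- Changing one factor at a time puts `u - v` into each of the three slots. -/
theorem eLpNorm_nlFld_sub_le {u v : ℝ → Seq} (hu : MeasCurve u) (hv : MeasCurve v) {J : Set ℝ}
    {j : Lat} (h1 : triSum (A4 J u) (A4 J u) (A4 J u) j ≠ ∞)
    (h2 : triSum (A4 J v) (A4 J v) (A4 J v) j ≠ ∞) :
    eLpNorm (nlFld u j - nlFld v j) (4 / 3) (stMeasure J)
      ≤ triSum (A4 J (u - v)) (A4 J u) (A4 J u) j + triSum (A4 J v) (A4 J (u - v)) (A4 J u) j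
        + triSum (A4 J v) (A4 J v) (A4 J (u - v)) j := by
  have hd := hu.sub hv
  let M1 := majFld (cfld (u - v)) (cfld u) (cfld u) j
  let M2 := majFld (cfld v) (cfld (u - v)) (cfld u) j
  let M3 := majFld (cfld v) (cfld v) (cfld (u - v)) j
  have hm1 : Measurable M1 :=
    measurable_majFld (measurable_cfld hd) (measurable_cfld hu) (measurable_cfld hu) j
  have hm2 : Measurable M2 :=
    measurable_majFld (measurable_cfld hv) (measurable_cfld hd) (measurable_cfld hu) j
  have hm3 : Measurable M3 :=
    measurable_majFld (measurable_cfld hv) (measurable_cfld hv) (measurable_cfld hd) j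
  have hpt : ∀ᵐ z ∂stMeasure J, ‖(nlFld u j - nlFld v j) z‖ₑ ≤ ‖(M1 + M2 + M3) z‖ₑ := by
    filter_upwards [cfld_sub_ae hu hv J, ae_majFld_lt_top hu h1, ae_majFld_lt_top hv h2]
      with z hz f1 f2
    have s1 : Summable fun q : resonantSet j =>
        cfld u q.1.1 z * (starRingEnd ℂ) (cfld u q.1.2.1 z) * cfld u q.1.2.2 z := by
      refine Summable.of_norm (tsum_enorm_ne_top_iff_summable_norm.1 ?_)
      simpa only [enorm_mul, RCLike.enorm_conj, majFld] using f1.ne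
    have s2 : Summable fun q : resonantSet j =>
        cfld v q.1.1 z * (starRingEnd ℂ) (cfld v q.1.2.1 z) * cfld v q.1.2.2 z := by
      refine Summable.of_norm (tsum_enorm_ne_top_iff_summable_norm.1 ?_)
      simpa only [enorm_mul, RCLike.enorm_conj, majFld] using f2.ne
    rw [Pi.sub_apply, nlFld, nlFld, ← s1.tsum_sub s2]
    refine enorm_tsum_le_tsum_enorm.trans ?_
    simp only [Pi.add_apply, enorm_eq_self, M1, M2, M3, majFld]
    rw [← ENNReal.tsum_add, ← ENNReal.tsum_add]
    refine ENNReal.tsum_le_tsum fun q => ?_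
    have e : cfld u q.1.1 z * (starRingEnd ℂ) (cfld u q.1.2.1 z) * cfld u q.1.2.2 z
        - cfld v q.1.1 z * (starRingEnd ℂ) (cfld v q.1.2.1 z) * cfld v q.1.2.2 z
        = cfld (u - v) q.1.1 z * (starRingEnd ℂ) (cfld u q.1.2.1 z) * cfld u q.1.2.2 z
        + cfld v q.1.1 z * (starRingEnd ℂ) (cfld (u - v) q.1.2.1 z) * cfld u q.1.2.2 z
        + cfld v q.1.1 z * (starRingEnd ℂ) (cfld v q.1.2.1 z) * cfld (u - v) q.1.2.2 z := by
      simp only [hz, map_sub]; ring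
    rw [e]
    refine (enorm_add_le _ _).trans (add_le_add ((enorm_add_le _ _).trans (le_of_eq ?_))
      (le_of_eq ?_)) <;> simp only [enorm_mul, RCLike.enorm_conj]
  calc eLpNorm (nlFld u j - nlFld v j) (4 / 3) (stMeasure J)
      ≤ eLpNorm (M1 + M2 + M3) (4 / 3) (stMeasure J) := eLpNorm_mono_enorm_ae hpt
    _ ≤ eLpNorm M1 (4 / 3) (stMeasure J) + eLpNorm M2 (4 / 3) (stMeasure J)
        + eLpNorm M3 (4 / 3) (stMeasure J) :=
      (eLpNorm_add_le (hm1.add hm2).aestronglyMeasurable hm3.aestronglyMeasurable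
        one_le_four_thirds).trans (by
          gcongr
          exact eLpNorm_add_le hm1.aestronglyMeasurable hm2.aestronglyMeasurable
            one_le_four_thirds)
    _ ≤ _ := by
      gcongr <;> refine eLpNorm_majFld_le ?_ ?_ ?_ j _ <;>
        first | exact measurable_cfld hd | exact measurable_cfld hu | exact measurable_cfld hv

theorem Hn_mono {W a b : Lat → ℝ≥0∞} (h : ∀ p, a p ≤ b p) : Hn W a ≤ Hn W b :=
  ENNReal.tsum_le_tsum fun p => by gcongr; exact h p

theorem Hn_mono_weight {W W' a : Lat → ℝ≥0∞} (h : ∀ p, W p ≤ W' p) : Hn W a ≤ Hn W' a :=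
  ENNReal.tsum_le_tsum fun p => by gcongr; exact h p

theorem Hn_add_le (W a b : Lat → ℝ≥0∞) : Hn W (fun p => a p + b p) ≤ 2 * (Hn W a + Hn W b) := by
  unfold Hn
  rw [← ENNReal.tsum_add, ← ENNReal.tsum_mul_left]
  refine ENNReal.tsum_le_tsum fun p => ?_
  calc W p * (a p + b p) ^ 2 ≤ W p * (2 * (a p ^ 2 + b p ^ 2)) := by
        gcongr; exact add_sq_le_two_mul _ _
    _ = _ := by ring

theorem Hn_const_mul (W a : Lat → ℝ≥0∞) (c : ℝ≥0∞) :
    Hn W (fun p => c * a p) = c ^ 2 * Hn W a := by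
  unfold Hn
  rw [← ENNReal.tsum_mul_left]
  refine tsum_congr fun p => ?_
  ring

theorem ne_top_of_Hn {W a : Lat → ℝ≥0∞} (hW : ∀ p, W p ≠ 0) (h : Hn W a ≠ ∞) (p : Lat) :
    a p ≠ ∞ := by
  intro hp
  refine h (ENNReal.tsum_eq_top_of_eq_top ⟨p, ?_⟩)
  rw [hp, ENNReal.top_pow (by norm_num), ENNReal.mul_top (hW p)]

/-- The constant of the trilinear estimate for weights with constant `A`. -/
def triConst (A : ℝ≥0∞) : ℝ≥0∞ := 4 * A * circleConst ^ 2

theorem triConst_ne_top {A : ℝ≥0∞} (hA : A ≠ ∞) : triConst A ≠ ∞ :=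
  ENNReal.mul_ne_top (ENNReal.mul_ne_top (by norm_num) hA) (ENNReal.pow_ne_top circleConst_ne_top)

theorem Hn_triSum_le_of_le {A : ℝ≥0∞} {W : Lat → ℝ≥0∞} (hW : Admissible A W)
    (h1 : ∀ p, weight 1 p ≤ W p) (a b c : Lat → ℝ≥0∞) :
    Hn W (triSum a b c) ≤ triConst A * (Hn W a * Hn W b * Hn W c) := by
  refine (Hn_triSum_le hW a b c).trans ?_
  calc 2 * A * circleConst ^ 2 * (Hn W a * Hn (weight 1) b * Hn (weight 1) c
        + Hn (weight 1) a * Hn (weight 1) b * Hn W c)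
      ≤ 2 * A * circleConst ^ 2 * (Hn W a * Hn W b * Hn W c + Hn W a * Hn W b * Hn W c) := by
        gcongr <;> exact Hn_mono_weight h1
    _ = _ := by rw [triConst]; ring

theorem Hn_nlFld_le {A : ℝ≥0∞} {W : Lat → ℝ≥0∞} (hW : Admissible A W) {u : ℝ → Seq}
    (hu : MeasCurve u) (J : Set ℝ) :
    Hn W (fun j => eLpNorm (nlFld u j) (4 / 3) (stMeasure J))
      ≤ triConst A * (Hn W (A4 J u) * Hn (weight 1) (A4 J u) ^ 2) := by
  refine (Hn_mono (eLpNorm_nlFld_le hu J)).trans ((Hn_triSum_le hW _ _ _).trans (le_of_eq ?_))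
  rw [triConst]; ring

theorem admissible_weight_one : Admissible 2 (weight 1) := by
  have := admissible_weight (s := 1) (by norm_num)
  simpa using this

theorem triSum_A4_ne_top {u : ℝ → Seq} {J : Set ℝ} (h : Hn (weight 1) (A4 J u) ≠ ∞) (j : Lat) :
    triSum (A4 J u) (A4 J u) (A4 J u) j ≠ ∞ := by
  refine ne_top_of_Hn (weight_ne_zero 1) (ne_top_of_le_ne_top ?_
    (Hn_triSum_le_of_le admissible_weight_one (fun _ => le_rfl) _ _ _)) j
  exact ENNReal.mul_ne_top (triConst_ne_top (by norm_num))
    (ENNReal.mul_ne_top (ENNReal.mul_ne_top h h) h)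

theorem memLp_nlFld {u : ℝ → Seq} (hu : MeasCurve u) {J : Set ℝ}
    (h : Hn (weight 1) (A4 J u) ≠ ∞) (j : Lat) : MemLp (nlFld u j) (4 / 3) (stMeasure J) :=
  ⟨(measurable_nlFld hu j).aestronglyMeasurable,
    (eLpNorm_nlFld_le hu J j).trans_lt (triSum_A4_ne_top h j).lt_top⟩

/-- `Hn` is a squared norm: each sum costs a factor two, and the cubic difference appears as `d (x +
y)²` in the squared norms `d`, `x`, `y`. -/
theorem Hn_nlFld_sub_le {A : ℝ≥0∞} {W : Lat → ℝ≥0∞} (hW : Admissible A W)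
    (h1 : ∀ p, weight 1 p ≤ W p) {u v : ℝ → Seq} (hu : MeasCurve u) (hv : MeasCurve v)
    {J : Set ℝ} (fu : Hn (weight 1) (A4 J u) ≠ ∞) (fv : Hn (weight 1) (A4 J v) ≠ ∞) :
    Hn W (fun j => eLpNorm (nlFld u j - nlFld v j) (4 / 3) (stMeasure J))
      ≤ 10 * triConst A * (Hn W (A4 J (u - v)) * (Hn W (A4 J u) + Hn W (A4 J v)) ^ 2) := by
  set d := Hn W (A4 J (u - v))
  set x := Hn W (A4 J u)
  set y := Hn W (A4 J v)
  refine (Hn_mono fun j => eLpNorm_nlFld_sub_le hu hv (triSum_A4_ne_top fu j)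
    (triSum_A4_ne_top fv j)).trans ?_
  have b1 := Hn_triSum_le_of_le hW h1 (A4 J (u - v)) (A4 J u) (A4 J u)
  have b2 := Hn_triSum_le_of_le hW h1 (A4 J v) (A4 J (u - v)) (A4 J u)
  have b3 := Hn_triSum_le_of_le hW h1 (A4 J v) (A4 J v) (A4 J (u - v))
  refine (Hn_add_le W _ _).trans ?_
  calc _ ≤ 2 * (2 * (triConst A * (d * x * x) + triConst A * (y * d * x))
        + triConst A * (y * y * d)) := by
        refine mul_le_mul' le_rfl (add_le_add ((Hn_add_le W _ _).trans
          (mul_le_mul' le_rfl (add_le_add b1 b2))) b3)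
    _ = triConst A * d * (4 * (x * x) + 4 * (x * y) + 2 * (y * y)) := by ring
    _ ≤ triConst A * d * (10 * (x * x) + 20 * (x * y) + 10 * (y * y)) := by
        gcongr <;> norm_num
    _ = _ := by ring

/-! ### The Duhamel formula solves the equation in the sense of distributions. -/

/-- The class in `L²` of a Schwartz function. -/
def toL2 (ψ : 𝓢(Plane, ℂ)) : L2 := ψ.toLp 2 volume

theorem toL2_ae (ψ : 𝓢(Plane, ℂ)) : toL2 ψ =ᵐ[volume] ψ := ψ.coeFn_toLp 2 volume

theorem fourier_toL2_ae (ψ : 𝓢(Plane, ℂ)) :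
    (𝓕 (toL2 ψ) : L2) =ᵐ[volume] (𝓕 ψ : 𝓢(Plane, ℂ)) := by
  have : (𝓕 (toL2 ψ) : L2) = toL2 (𝓕 ψ) := SchwartzMap.toLp_fourier_eq ψ
  rw [this]
  exact toL2_ae _

theorem fourier_laplacian (ψ : 𝓢(Plane, ℂ)) (ξ : Plane) :
    (𝓕 (Δ ψ) : 𝓢(Plane, ℂ)) ξ = -(((2 * Real.pi * ‖ξ‖) ^ 2 : ℝ) : ℂ) * (𝓕 ψ : 𝓢(Plane, ℂ)) ξ := by
  rw [SchwartzMap.laplacian_eq_fourierMultiplierCLM, FourierTransform.fourier_smul,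
    SchwartzMap.fourierMultiplierCLM_apply, FourierTransform.fourier_fourierInv_eq,
    smul_apply, SchwartzMap.smulLeftCLM_apply_apply (by fun_prop)]
  simp only [Complex.real_smul]
  push_cast
  ring

theorem fourier_laplacian_ae (ψ : 𝓢(Plane, ℂ)) :
    (𝓕 (toL2 (Δ ψ)) : L2) =ᵐ[volume]
      fun ξ => -(((2 * Real.pi * ‖ξ‖) ^ 2 : ℝ) : ℂ) * (𝓕 (toL2 ψ) : L2) ξ := by
  filter_upwards [fourier_toL2_ae (Δ ψ), fourier_toL2_ae ψ] with ξ h1 h2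
  rw [h1, h2, fourier_laplacian]

/-- The complex conjugate of a Schwartz function. -/
def conjS (ψ : 𝓢(Plane, ℂ)) : 𝓢(Plane, ℂ) :=
  ψ.postcompCLM (Complex.conjCLE : ℂ →L[ℝ] ℂ)

theorem conjS_apply (ψ : 𝓢(Plane, ℂ)) (x : Plane) : conjS ψ x = starRingEnd ℂ (ψ x) := rfl

theorem conjS_conjS (ψ : 𝓢(Plane, ℂ)) : conjS (conjS ψ) = ψ := by
  ext x; simp [conjS_apply]

theorem laplacian_conjS (ψ : 𝓢(Plane, ℂ)) : Δ (conjS ψ) = conjS (Δ ψ) := by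
  ext x
  rw [SchwartzMap.laplacian_apply, conjS_apply, SchwartzMap.laplacian_apply]
  have h := (ψ.smooth 2).contDiffAt (x := x) |>.laplacian_CLM_comp_left
    (l := (Complex.conjCLE : ℂ →L[ℝ] ℂ))
  exact h

theorem inner_toL2 (ψ : 𝓢(Plane, ℂ)) (f : L2) :
    inner ℂ (toL2 ψ) f = ∫ x, f x * starRingEnd ℂ (ψ x) := by
  rw [L2.inner_def]
  refine integral_congr_ae ((toL2_ae ψ).mono fun x hx => ?_)
  simp only [hx, RCLike.inner_apply]

theorem integral_mul_schwartz (φ : 𝓢(Plane, ℂ)) (f : L2) :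
    ∫ x, f x * φ x = inner ℂ (toL2 (conjS φ)) f := by
  rw [inner_toL2]
  simp [conjS_apply]

theorem norm_le_of_fourier {f g : L2} {c : ℝ}
    (h : ∀ᵐ ξ, ‖(𝓕 f : L2) ξ‖ ≤ c * ‖(𝓕 g : L2) ξ‖) : ‖f‖ ≤ c * ‖g‖ := by
  rw [← Lp.norm_fourier_eq f, ← Lp.norm_fourier_eq g]
  exact Lp.norm_le_mul_norm_of_ae_le_mul h

/-- A function with integrable Fourier transform is bounded. -/
theorem ae_norm_le_of_integrable_fourier {f : L2} (h : Integrable (𝓕 f : L2)) :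
    ∀ᵐ x, ‖f x‖ ≤ ∫ ξ, ‖(𝓕 f : L2) ξ‖ := by
  have h1 := fourierInv_toLp_ae_eq h (Lp.memLp _)
  rw [Lp.toLp_coeFn, FourierTransform.fourierInv_fourier_eq] at h1
  filter_upwards [h1] with x hx
  rw [hx, Real.fourierInv_eq]
  refine (norm_integral_le_integral_norm _).trans (le_of_eq ?_)
  simp

/-- Interpolation: `‖f‖₄⁴ ≤ ‖f‖_∞² ‖f‖₂²`. -/
theorem eLpNorm_four_le {f : L2} {a b : ℝ} (ha : 0 ≤ a) (h : ∀ᵐ x, ‖f x‖ ≤ a) (hb : ‖f‖ ≤ b) :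
    eLpNorm f 4 volume ^ 4 ≤ ENNReal.ofReal (a ^ 2 * b ^ 2) := by
  rw [eLpNorm_four_pow]
  calc ∫⁻ x, ‖f x‖ₑ ^ 4 ≤ ∫⁻ x, ENNReal.ofReal a ^ 2 * ‖f x‖ₑ ^ 2 := by
        refine lintegral_mono_ae (h.mono fun x hx => ?_)
        rw [show 4 = 2 + 2 from rfl, pow_add]
        gcongr
        rw [← ofReal_norm]
        exact ENNReal.ofReal_le_ofReal hx
    _ = ENNReal.ofReal a ^ 2 * ‖f‖ₑ ^ 2 := by
        rw [lintegral_const_mul' _ _ (by simp), enorm_sq_Lp]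
    _ ≤ _ := by
        rw [ENNReal.ofReal_mul (by positivity), ENNReal.ofReal_pow ha,
          ENNReal.ofReal_pow ((norm_nonneg _).trans hb)]
        gcongr
        rw [← ofReal_norm]
        exact ENNReal.ofReal_le_ofReal hb

theorem norm_exp_mul_I_sub_one_le (θ : ℝ) : ‖Complex.exp ((θ : ℂ) * Complex.I) - 1‖ ≤ |θ| := by
  have := Real.norm_exp_I_mul_ofReal_sub_one_le (x := θ)
  rwa [mul_comm, Real.norm_eq_abs] at this

theorem norm_exp_mul_I_sub_one_sub_le (θ : ℝ) :
    ‖Complex.exp ((θ : ℂ) * Complex.I) - 1 - (θ : ℂ) * Complex.I‖ ≤ 2 * θ ^ 2 := by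
  have hn : ‖(θ : ℂ) * Complex.I‖ = |θ| := by simp
  rw [← sq_abs]
  rcases le_total |θ| 1 with h | h
  · have := Complex.norm_exp_sub_one_sub_id_le (x := (θ : ℂ) * Complex.I) (by rw [hn]; exact h)
    rw [hn] at this
    nlinarith [sq_nonneg |θ|]
  · refine (norm_sub_le _ _).trans ?_
    rw [hn]
    nlinarith [norm_exp_mul_I_sub_one_le θ]

theorem fourier_U_ae (t : ℝ) (f : L2) : (𝓕 (U t f) : L2) =ᵐ[volume]
    fun ξ => Complex.exp (((-(t * (2 * Real.pi * ‖ξ‖) ^ 2) : ℝ) : ℂ) * Complex.I) * (𝓕 f : L2) ξ :=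
  (freeSymbol t).fourier_op_ae f

theorem L2.fourier_sub_ae (f g : L2) :
    (𝓕 (f - g) : L2) =ᵐ[volume] fun ξ => (𝓕 f : L2) ξ - (𝓕 g : L2) ξ := by
  have : (𝓕 (f - g) : L2) = 𝓕 f - 𝓕 g := by
    have := map_sub (Lp.fourierTransformₗᵢ Plane ℂ) f g
    exact this
  rw [this]; exact Lp.coeFn_sub _ _

theorem fourier_U_sub_ae (a : ℝ) (ψ : 𝓢(Plane, ℂ)) :
    ∀ᵐ ξ, ‖(𝓕 (U a (toL2 ψ) - toL2 ψ) : L2) ξ‖ ≤ |a| * ‖(𝓕 (toL2 (Δ ψ)) : L2) ξ‖ := by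
  filter_upwards [L2.fourier_sub_ae (U a (toL2 ψ)) (toL2 ψ), fourier_U_ae a (toL2 ψ),
    fourier_laplacian_ae ψ] with ξ h1 h2 h3
  rw [h1, h2, h3, ← sub_one_mul, norm_mul, norm_mul, ← mul_assoc]
  gcongr
  refine (norm_exp_mul_I_sub_one_le _).trans (le_of_eq ?_)
  rw [abs_neg, abs_mul, norm_neg, Complex.norm_real, Real.norm_eq_abs]

/-- Taylor expansion of the symbol to first order; the quadratic remainder costs two Laplacians of
the test function. -/
theorem norm_U_sub_add_le (a : ℝ) (ψ : 𝓢(Plane, ℂ)) :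
    ‖U a (toL2 ψ) - toL2 ψ - (a * Complex.I) • toL2 (Δ ψ)‖ ≤ 2 * a ^ 2 * ‖toL2 (Δ (Δ ψ))‖ := by
  refine norm_le_of_fourier ?_
  have hs : (𝓕 (((a : ℂ) * Complex.I) • toL2 (Δ ψ)) : L2) = ((a : ℂ) * Complex.I) • 𝓕 (toL2 (Δ ψ)) :=
    FourierTransform.fourier_smul _ _
  filter_upwards [L2.fourier_sub_ae (U a (toL2 ψ) - toL2 ψ) (((a : ℂ) * Complex.I) • toL2 (Δ ψ)),
    L2.fourier_sub_ae (U a (toL2 ψ)) (toL2 ψ), fourier_U_ae a (toL2 ψ),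
    fourier_laplacian_ae ψ, fourier_laplacian_ae (Δ ψ),
    Lp.coeFn_smul ((a : ℂ) * Complex.I) (𝓕 (toL2 (Δ ψ)) : L2)] with ξ h1 h2 h3 h4 h5 h6
  rw [h1, h2, h3, hs, h6, h5, Pi.smul_apply, h4, smul_eq_mul]
  have h := norm_exp_mul_I_sub_one_sub_le (-(a * (2 * Real.pi * ‖ξ‖) ^ 2))
  have e : ∀ (E l v : ℂ), E * v - v - (a : ℂ) * Complex.I * (-l * v)
      = (E - 1 - (-((a : ℂ) * l)) * Complex.I) * v := by intros; ring
  rw [e, norm_mul, norm_mul, norm_mul, ← mul_assoc, ← mul_assoc]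
  gcongr
  refine (le_of_eq ?_).trans (h.trans (le_of_eq ?_))
  · push_cast; rfl
  · rw [norm_neg, Complex.norm_real, Real.norm_eq_abs, abs_of_nonneg (by positivity)]
    ring

/-- The transform of `U a ψ - ψ` is at most `|a|` times that of `Δ ψ`, which is both integrable and
square integrable. So the difference is `O(|a|)` in `L^∞` and in `L²`, hence in `L⁴`. -/
theorem exists_eLpNorm_U_sub_le (ψ : 𝓢(Plane, ℂ)) : ∃ C : ℝ, 0 ≤ C ∧ ∀ a : ℝ,
    eLpNorm (U a (toL2 ψ) - toL2 ψ : L2) 4 volume ^ 4 ≤ ENNReal.ofReal ((C * a) ^ 4) := by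
  set h : L2 := 𝓕 (toL2 (Δ ψ)) with hh
  have hint : Integrable h := (𝓕 (Δ ψ) : 𝓢(Plane, ℂ)).integrable.congr (fourier_toL2_ae (Δ ψ)).symm
  set A : ℝ := ∫ ξ, ‖h ξ‖
  have hA : 0 ≤ A := integral_nonneg fun _ => norm_nonneg _
  set B : ℝ := ‖toL2 (Δ ψ)‖
  have hB : 0 ≤ B := norm_nonneg _
  refine ⟨A + B, by positivity, fun a => ?_⟩
  have hae := fourier_U_sub_ae a ψ
  have hi : Integrable (𝓕 (U a (toL2 ψ) - toL2 ψ) : L2) :=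
    (hint.norm.const_mul |a|).mono' (Lp.aestronglyMeasurable _) hae
  have h1 : ∀ᵐ x, ‖(U a (toL2 ψ) - toL2 ψ : L2) x‖ ≤ |a| * A := by
    filter_upwards [ae_norm_le_of_integrable_fourier hi] with x hx
    refine hx.trans ?_
    rw [← integral_const_mul]
    exact integral_mono_ae hi.norm (hint.norm.const_mul |a|) hae
  refine (eLpNorm_four_le (by positivity) h1 (norm_le_of_fourier hae)).trans ?_
  refine ENNReal.ofReal_le_ofReal ?_
  have e : (|a| * A) ^ 2 * (|a| * B) ^ 2 = a ^ 4 * (A * B) ^ 2 := by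
    rw [mul_pow, mul_pow, sq_abs]; ring
  rw [e]
  have : A * B ≤ (A + B) ^ 2 := by nlinarith
  calc a ^ 4 * (A * B) ^ 2 ≤ a ^ 4 * ((A + B) ^ 2) ^ 2 := by gcongr
    _ = ((A + B) * a) ^ 4 := by ring

/-- The free evolution with forcing `F`, as a tempered distribution. -/
theorem weak_increment {F : ℝ × Plane → ℂ} {J : Set ℝ} (hJ : MeasurableSet J)
    (hF : MemLp F (4 / 3) (stMeasure J)) (v : L2) (ψ : 𝓢(Plane, ℂ)) {s t : ℝ} (hst : s ≤ t)
    (hJst : Icc s t ⊆ J) :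
    Complex.I * (inner ℂ (toL2 ψ) (U t (v - Complex.I • duhPrim F J t))
        - inner ℂ (toL2 ψ) (U s (v - Complex.I • duhPrim F J s)))
      = Complex.I * inner ℂ (U (s - t) (toL2 ψ) - toL2 ψ) (U s (v - Complex.I • duhPrim F J s))
        + ∫ z, starRingEnd ℂ (fld (fun r => U (r - t) (toL2 ψ)) z) * F z ∂stMeasure (Ico s t) := by
  have e1 : duhPrim F J t = duhPrim F J s + duh F (Ico s t) := by
    rw [← sub_eq_iff_eq_add', duhPrim_sub hJ hF hst,
      inter_eq_self_of_subset_right (Ico_subset_Icc_self.trans hJst)]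
  have hF' : MemLp F (4 / 3) (stMeasure (Ico s t)) :=
    memLp_mono_set (Ico_subset_Icc_self.trans hJst) hF
  -- Moving the unitary group onto the test function turns the Duhamel vector into a space-time
  -- integral against `U (r - t) ψ`.
  have e2 : inner ℂ (toL2 ψ) (U t (duh F (Ico s t)))
      = ∫ z, starRingEnd ℂ (fld (fun r => U (r - t) (toL2 ψ)) z) * F z ∂stMeasure (Ico s t) := by
    have h := inner_U (-t) (toL2 ψ) (duh F (Ico s t))
    rw [neg_neg] at h
    rw [← h, ← inner_conj_symm, inner_duh hF', ← integral_conj]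
    refine integral_congr_ae (Eventually.of_forall fun z => ?_)
    simp only [U_add, map_mul, Complex.conj_conj, sub_eq_add_neg]
  have e3 : U t (v - Complex.I • duhPrim F J t)
      = U (t - s) (U s (v - Complex.I • duhPrim F J s)) - Complex.I • U t (duh F (Ico s t)) := by
    rw [U_add, sub_add_cancel, e1, smul_add, ← sub_sub, map_sub, ContinuousLinearMap.map_smul]
  rw [e3, inner_sub_right, inner_smul_right, e2, inner_sub_left, inner_U, neg_sub]
  linear_combination (-(∫ z, starRingEnd ℂ (fld (fun r => U (r - t) (toL2 ψ)) z) * F z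
    ∂stMeasure (Ico s t))) * Complex.I_mul_I

theorem memLp_fld_const (ψ : 𝓢(Plane, ℂ)) (s t : ℝ) :
    MemLp (fld fun _ => toL2 ψ) 4 (stMeasure (Ico s t)) := by
  refine ⟨(measurable_fld measurable_const).aestronglyMeasurable, ?_⟩
  have h := N4_pow (u := fun _ => toL2 ψ) measurable_const (Ico s t)
  have hfin : eLpNorm (toL2 ψ) 4 (volume : Measure Plane) ≠ ∞ := by
    rw [eLpNorm_congr_ae (toL2_ae ψ)]
    exact (ψ.memLp 4 volume).2.ne
  rw [setLIntegral_const] at h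
  refine lt_top_iff_ne_top.2 fun hc => ?_
  rw [N4, hc] at h
  refine ENNReal.mul_ne_top (ENNReal.pow_ne_top hfin (n := 4)) ?_ h.symm
  simp

theorem weak_forcing {F : ℝ × Plane → ℂ} (ψ : 𝓢(Plane, ℂ)) {s t : ℝ} (hst : s ≤ t)
    (hF : MemLp F (4 / 3) (stMeasure (Ico s t))) :
    IntervalIntegrable (fun r => ∫ x, F (r, x) * starRingEnd ℂ (ψ x)) volume s t ∧
    ∫ r in s..t, ∫ x, F (r, x) * starRingEnd ℂ (ψ x)
      = ∫ z, starRingEnd ℂ (fld (fun _ => toL2 ψ) z) * F z ∂stMeasure (Ico s t) := by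
  have hi : Integrable (fun z => starRingEnd ℂ (fld (fun _ => toL2 ψ) z) * F z)
      (stMeasure (Ico s t)) := by
    have := (integrable_mul_conj (memLp_fld_const ψ s t) hF)
    have h2 := Complex.conjCLE.toContinuousLinearMap.integrable_comp this
    refine h2.congr (Eventually.of_forall fun z => ?_)
    simp
  have e : ∀ r, ∫ x, F (r, x) * starRingEnd ℂ (ψ x)
      = ∫ x, starRingEnd ℂ (fld (fun _ => toL2 ψ) (r, x)) * F (r, x) := by
    intro r
    refine integral_congr_ae ?_
    filter_upwards [fld_ae (fun _ => toL2 ψ) r, toL2_ae ψ] with x h1 h2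
    rw [h1, h2, mul_comm]
  simp only [e]
  rw [intervalIntegrable_iff_integrableOn_Ico_of_le hst, intervalIntegral.integral_of_le hst,
    ← integral_Ico_eq_integral_Ioc]
  exact ⟨hi.integral_prod_left, (integral_prod _ hi).symm⟩

/-- On `[s, t)` the test function moves by at most `C (t - s)` in `L⁴` of space, and integration in
time adds `(t - s)^(1/4) ≤ ε`. This gain makes the error `o(t - s)` although the forcing is only in
`L^{4/3}`. -/
theorem norm_forcing_sub_le (ψ : 𝓢(Plane, ℂ)) : ∃ C : ℝ, 0 ≤ C ∧
    ∀ (F : ℝ × Plane → ℂ) (s t ε : ℝ), s ≤ t → 0 ≤ ε → t - s ≤ ε ^ 4 →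
      MemLp F (4 / 3) (stMeasure (Ico s t)) →
      ‖∫ z, starRingEnd ℂ (fld (fun r => U (r - t) (toL2 ψ)) z) * F z ∂stMeasure (Ico s t)
        - ∫ z, starRingEnd ℂ (fld (fun _ => toL2 ψ) z) * F z ∂stMeasure (Ico s t)‖
        ≤ C * ε * (t - s) * (eLpNorm F (4 / 3) (stMeasure (Ico s t))).toReal := by
  obtain ⟨C, hC, hb⟩ := exists_eLpNorm_U_sub_le ψ
  refine ⟨C, hC, fun F s t ε hst hε hle hF => ?_⟩
  have hm : Measurable fun r => U (r - t) (toL2 ψ) := by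
    have := (continuous_U (toL2 ψ)).comp (g := fun r => U r (toL2 ψ)) (f := fun r : ℝ => r - t)
      (by fun_prop)
    exact this.measurable
  have hm1 : MemLp (fld fun r => U (r - t) (toL2 ψ)) 4 (stMeasure (Ico s t)) := by
    have := memLp_fld_U (Ico s t) (U (-t) (toL2 ψ))
    simpa only [U_add, ← sub_eq_add_neg] using this
  have hm2 := memLp_fld_const ψ s t
  have hmd : Measurable fun r => U (r - t) (toL2 ψ) - toL2 ψ := hm.sub measurable_const
  have hsub := fld_sub hm (measurable_const (a := toL2 ψ)) (Ico s t)
  have hI : ∀ {f : ℝ × Plane → ℂ}, MemLp f 4 (stMeasure (Ico s t)) →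
      Integrable (fun z => starRingEnd ℂ (f z) * F z) (stMeasure (Ico s t)) := by
    intro f hf
    have h2 := Complex.conjCLE.toContinuousLinearMap.integrable_comp (integrable_mul_conj hf hF)
    refine h2.congr (Eventually.of_forall fun z => ?_)
    simp
  rw [← integral_sub (hI hm1) (hI hm2)]
  have hN : N4 (Ico s t) (fun r => U (r - t) (toL2 ψ) - toL2 ψ)
      ≤ ENNReal.ofReal (C * ε * (t - s)) := by
    have h4 : N4 (Ico s t) (fun r => U (r - t) (toL2 ψ) - toL2 ψ) ^ 4
        ≤ ENNReal.ofReal (C * ε * (t - s)) ^ 4 := by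
      rw [N4_pow hmd]
      calc _ ≤ ∫⁻ r in Ico s t, ENNReal.ofReal ((C * (t - s)) ^ 4) := by
            refine setLIntegral_mono measurable_const fun r hr => (hb (r - t)).trans ?_
            refine ENNReal.ofReal_le_ofReal ?_
            rw [mul_pow, mul_pow]
            have : (r - t) ^ 4 ≤ (t - s) ^ 4 := by
              rw [← neg_sub, Even.neg_pow (by decide)]
              exact pow_le_pow_left₀ (by linarith [hr.2]) (by linarith [hr.1]) 4
            gcongr
        _ = ENNReal.ofReal ((C * (t - s)) ^ 4 * (t - s)) := by
            rw [setLIntegral_const, Real.volume_Ico, ENNReal.ofReal_mul (by positivity)]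
        _ ≤ _ := by
            have h0 : 0 ≤ t - s := by linarith
            rw [← ENNReal.ofReal_pow (by positivity)]
            refine ENNReal.ofReal_le_ofReal ?_
            calc (C * (t - s)) ^ 4 * (t - s) ≤ (C * (t - s)) ^ 4 * ε ^ 4 := by gcongr
              _ = _ := by ring
    exact (ENNReal.pow_le_pow_left_iff (by norm_num)).1 h4
  have h1 : ‖∫ z, (starRingEnd ℂ (fld (fun r => U (r - t) (toL2 ψ)) z) * F z
      - starRingEnd ℂ (fld (fun _ => toL2 ψ) z) * F z) ∂stMeasure (Ico s t)‖ₑ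
      ≤ ENNReal.ofReal (C * ε * (t - s)) * eLpNorm F (4 / 3) (stMeasure (Ico s t)) := by
    refine (enorm_integral_le_lintegral_enorm _).trans ?_
    refine le_trans (le_of_eq ?_) ((lintegral_mul_conj_le (μ := stMeasure (Ico s t))
      (measurable_fld hmd).aestronglyMeasurable hF.1).trans
        (mul_le_mul_left hN _))
    refine lintegral_congr_ae (hsub.mono fun z hz => ?_)
    have hz' : fld (fun r => U (r - t) (toL2 ψ) - toL2 ψ) z
      = fld (fun r => U (r - t) (toL2 ψ)) z - fld (fun _ => toL2 ψ) z := hz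
    simp only [hz', ← sub_mul, ← map_sub, enorm_mul, RCLike.enorm_conj]
  have h2 := ENNReal.toReal_mono (ENNReal.mul_ne_top ENNReal.ofReal_ne_top hF.2.ne) h1
  rwa [toReal_enorm, ENNReal.toReal_mul, ENNReal.toReal_ofReal] at h2
  have h0 : 0 ≤ t - s := by linarith
  positivity

theorem continuous_duhamel {F : ℝ × Plane → ℂ} {J : Set ℝ} (hJ : MeasurableSet J)
    (hF : MemLp F (4 / 3) (stMeasure J)) (v : L2) :
    Continuous fun t => U t (v - Complex.I • duhPrim F J t) := by
  have hw : Continuous fun t => Complex.I • duhPrim F J t :=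
    (continuous_duhPrim hJ hF).const_smul Complex.I
  exact continuous_U_comp continuous_id (continuous_const.sub hw)

/-- The Duhamel formula gives a solution of the Schrödinger equation with forcing `F` in the sense
of distributions. -/
theorem weak_of_duhamel {F : ℝ × Plane → ℂ} {J : Set ℝ} (hJ : MeasurableSet J)
    (hF : MemLp F (4 / 3) (stMeasure J)) (v : L2) (ψ : 𝓢(Plane, ℂ)) {a b : ℝ} (hab : a ≤ b)
    (hJab : Icc a b ⊆ J) :
    Complex.I * (inner ℂ (toL2 ψ) (U b (v - Complex.I • duhPrim F J b))
        - inner ℂ (toL2 ψ) (U a (v - Complex.I • duhPrim F J a)))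
      + ∫ r in a..b, inner ℂ (toL2 (Δ ψ)) (U r (v - Complex.I • duhPrim F J r))
      = ∫ r in a..b, ∫ x, F (r, x) * starRingEnd ℂ (ψ x) := by
  set u : ℝ → L2 := fun t => U t (v - Complex.I • duhPrim F J t) with hu
  have huc : Continuous u := continuous_duhamel hJ hF v
  have hic : ∀ g : L2, Continuous fun r => inner ℂ g (u r) := fun g =>
    continuous_const.inner huc
  have hint : ∀ g : L2, ∀ s t, IntervalIntegrable (fun r => (inner ℂ g (u r) : ℂ)) volume s t :=
    fun g s t => (hic g).intervalIntegrable s t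
  have hFst : ∀ {s t}, a ≤ s → t ≤ b → MemLp F (4 / 3) (stMeasure (Ico s t)) := fun h1 h2 =>
    memLp_mono_set ((Ico_subset_Icc_self.trans (Icc_subset_Icc h1 h2)).trans hJab) hF
  set G : ℝ → ℂ := fun r => ∫ x, F (r, x) * starRingEnd ℂ (ψ x) with hG
  have hGint : ∀ {s t}, a ≤ s → s ≤ t → t ≤ b → IntervalIntegrable G volume s t :=
    fun h1 h2 h3 => (weak_forcing ψ h2 (hFst h1 h3)).1
  -- The forcing is merely integrable in time, so the pairing with `u` and the integral of `G` need
  -- not be differentiable. The combination `D` has right derivative zero at every point, hence is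
  -- constant.
  let D : ℝ → ℂ := fun t => Complex.I * inner ℂ (toL2 ψ) (u t)
    + (∫ r in a..t, inner ℂ (toL2 (Δ ψ)) (u r)) - ∫ r in a..t, G r
  have hDc : ContinuousOn D (Icc a b) := by
    refine ContinuousOn.sub (ContinuousOn.add ?_ ?_) ?_
    · exact (continuous_const.mul (hic _)).continuousOn
    · exact (intervalIntegral.continuous_primitive (hint _) a).continuousOn
    · have := intervalIntegral.continuousOn_primitive_interval (μ := volume) (f := G) (a := a)
        (b := b) (by
          rw [uIcc_of_le hab, integrableOn_Icc_iff_integrableOn_Ioc,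
            ← intervalIntegrable_iff_integrableOn_Ioc_of_le hab]
          exact hGint le_rfl hab le_rfl)
      rwa [uIcc_of_le hab] at this
  obtain ⟨C, hC, hforce⟩ := norm_forcing_sub_le ψ
  have hD' : ∀ s ∈ Ico a b, HasDerivWithinAt D 0 (Ici s) s := by
    intro s hs
    rw [hasDerivWithinAt_iff_isLittleO, Asymptotics.isLittleO_iff]
    intro c hc
    set K := ‖u s‖
    set L := ‖toL2 (Δ ψ)‖
    set M := ‖toL2 (Δ (Δ ψ))‖
    set Φ := (eLpNorm F (4 / 3) (stMeasure J)).toReal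
    have hK : 0 ≤ K := norm_nonneg _
    have hL : 0 ≤ L := norm_nonneg _
    have hM : 0 ≤ M := norm_nonneg _
    have hΦ : 0 ≤ Φ := ENNReal.toReal_nonneg
    -- `Q` collects the constants of the Taylor error, of the continuity of `u` and of the forcing
    -- error; each term is at most `η` times its constant times `t - s`.
    set Q := 2 * M * K + L + C * Φ with hQ
    have hQ0 : 0 ≤ Q := by positivity
    set η := c / (1 + Q) with hη
    have hη0 : 0 < η := by positivity
    have hηQ : η * Q ≤ c := by
      rw [hη, div_mul_eq_mul_div, div_le_iff₀ (by positivity)]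
      nlinarith
    obtain ⟨δ, hδ, hclose⟩ := Metric.continuous_iff.1 huc s η hη0
    have hev : ∀ᶠ t in 𝓝[Ici s] s, t ∈ Icc s b ∧ t - s ≤ η ∧ t - s ≤ η ^ 4 ∧ t - s < δ := by
      have h1 : ∀ {e : ℝ}, 0 < e → ∀ᶠ t in 𝓝[Ici s] s, t - s < e := fun he => by
        filter_upwards [nhdsWithin_le_nhds (gt_mem_nhds (lt_add_of_pos_right s he))] with t ht
        linarith [show t < s + _ from ht]
      filter_upwards [h1 hη0, h1 (pow_pos hη0 4), h1 hδ, self_mem_nhdsWithin,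
        h1 (sub_pos.2 hs.2)] with t h2 h3 h4 h5 h6
      exact ⟨⟨h5, by linarith⟩, h2.le, h3.le, h4⟩
    filter_upwards [hev] with t ⟨hst, h1, h2, h3⟩
    have hst0 : 0 ≤ t - s := by linarith [hst.1]
    have e1 := weak_increment hJ hF v ψ hst.1 ((Icc_subset_Icc hs.1 hst.2).trans hJab)
    obtain ⟨-, e2⟩ := weak_forcing ψ hst.1 (hFst hs.1 hst.2)
    have e3 : (∫ r in a..t, inner ℂ (toL2 (Δ ψ)) (u r)) - ∫ r in a..s, inner ℂ (toL2 (Δ ψ)) (u r)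
        = ∫ r in s..t, inner ℂ (toL2 (Δ ψ)) (u r) :=
      intervalIntegral.integral_interval_sub_left (hint _ _ _) (hint _ _ _)
    have e4 : (∫ r in a..t, G r) - ∫ r in a..s, G r = ∫ r in s..t, G r :=
      intervalIntegral.integral_interval_sub_left (hGint le_rfl (hs.1.trans hst.1) hst.2)
        (hGint le_rfl hs.1 hs.2.le)
    have e5 : ∫ r in s..t, inner ℂ (toL2 (Δ ψ)) (u r)
        = (∫ r in s..t, inner ℂ (toL2 (Δ ψ)) (u r - u s))
          + (t - s : ℂ) * inner ℂ (toL2 (Δ ψ)) (u s) := by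
      simp only [inner_sub_right]
      rw [intervalIntegral.integral_sub (hint _ _ _) (by simp), intervalIntegral.integral_const,
        Complex.real_smul]
      push_cast; ring
    have e6 : Complex.I * inner ℂ (U (s - t) (toL2 ψ) - toL2 ψ) (u s)
        + (t - s : ℂ) * inner ℂ (toL2 (Δ ψ)) (u s)
        = Complex.I * inner ℂ (U (s - t) (toL2 ψ) - toL2 ψ
          - (((s - t : ℝ) : ℂ) * Complex.I) • toL2 (Δ ψ)) (u s) := by
      rw [inner_sub_left (U (s - t) (toL2 ψ) - toL2 ψ), inner_smul_left]
      simp only [map_mul, Complex.conj_ofReal, Complex.conj_I]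
      push_cast
      linear_combination ((t : ℂ) - s) * inner ℂ (toL2 (Δ ψ)) (u s) * Complex.I_mul_I
    have key : D t - D s = Complex.I * inner ℂ (U (s - t) (toL2 ψ) - toL2 ψ
          - (((s - t : ℝ) : ℂ) * Complex.I) • toL2 (Δ ψ)) (u s)
        + (∫ r in s..t, inner ℂ (toL2 (Δ ψ)) (u r - u s))
        + (∫ z, starRingEnd ℂ (fld (fun r => U (r - t) (toL2 ψ)) z) * F z ∂stMeasure (Ico s t)
          - ∫ z, starRingEnd ℂ (fld (fun _ => toL2 ψ) z) * F z ∂stMeasure (Ico s t)) := by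
      have e1' : Complex.I * (inner ℂ (toL2 ψ) (u t) - inner ℂ (toL2 ψ) (u s))
        = Complex.I * inner ℂ (U (s - t) (toL2 ψ) - toL2 ψ) (u s)
        + ∫ z, starRingEnd ℂ (fld (fun r => U (r - t) (toL2 ψ)) z) * F z ∂stMeasure (Ico s t) := e1
      simp only [D]
      linear_combination e1' + e3 - e4 + e5 + e6 - e2
    rw [smul_zero, sub_zero, key]
    have b1 : ‖Complex.I * inner ℂ (U (s - t) (toL2 ψ) - toL2 ψ
          - (((s - t : ℝ) : ℂ) * Complex.I) • toL2 (Δ ψ)) (u s)‖ ≤ η * (2 * M * K) * (t - s) := by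
      rw [norm_mul, Complex.norm_I, one_mul]
      refine (norm_inner_le_norm _ _).trans ?_
      refine (mul_le_mul_of_nonneg_right (norm_U_sub_add_le (s - t) ψ) hK).trans ?_
      have : (s - t) ^ 2 ≤ η * (t - s) := by nlinarith
      calc 2 * (s - t) ^ 2 * M * K ≤ 2 * (η * (t - s)) * M * K := by gcongr
        _ = _ := by ring
    have b2 : ‖∫ r in s..t, (inner ℂ (toL2 (Δ ψ)) (u r - u s) : ℂ)‖ ≤ η * L * (t - s) := by
      have := intervalIntegral.norm_integral_le_of_norm_le_const (a := s) (b := t)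
        (f := fun r => (inner ℂ (toL2 (Δ ψ)) (u r - u s) : ℂ)) (C := η * L) (fun r hr => ?_)
      · rwa [abs_of_nonneg hst0] at this
      · rw [uIoc_of_le hst.1] at hr
        refine (norm_inner_le_norm _ _).trans ?_
        rw [mul_comm]
        gcongr
        rw [← dist_eq_norm]
        refine (hclose r ?_).le
        rw [Real.dist_eq, abs_of_nonneg (by linarith [hr.1])]
        linarith [hr.2]
    have b3 := hforce F s t η hst.1 hη0.le h2 (hFst hs.1 hst.2)
    have b3' : C * η * (t - s) * (eLpNorm F (4 / 3) (stMeasure (Ico s t))).toReal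
        ≤ η * (C * Φ) * (t - s) := by
      have : (eLpNorm F (4 / 3) (stMeasure (Ico s t))).toReal ≤ Φ := by
        refine ENNReal.toReal_mono hF.2.ne (eLpNorm_mono_measure _ (Measure.prod_mono
          (Measure.restrict_mono ?_ le_rfl) le_rfl))
        exact ((Ico_subset_Icc_self.trans (Icc_subset_Icc hs.1 hst.2)).trans hJab)
      calc _ ≤ C * η * (t - s) * Φ := by gcongr
        _ = _ := by ring
    refine (norm_add₃_le.trans (add_le_add (add_le_add b1 b2) (b3.trans b3'))).trans ?_
    rw [Real.norm_eq_abs, abs_of_nonneg hst0]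
    calc _ = η * Q * (t - s) := by rw [hQ]; ring
      _ ≤ c * (t - s) := by gcongr
  have h := constant_of_has_deriv_right_zero hDc hD' b (right_mem_Icc.2 hab)
  simp only [D, intervalIntegral.integral_same] at h
  linear_combination h

theorem weak_of_duhamel_uIcc {F : ℝ × Plane → ℂ} {J : Set ℝ} (hJ : MeasurableSet J)
    (hF : MemLp F (4 / 3) (stMeasure J)) (v : L2) (ψ : 𝓢(Plane, ℂ)) {a b : ℝ}
    (hJab : uIcc a b ⊆ J) :
    Complex.I * (inner ℂ (toL2 ψ) (U b (v - Complex.I • duhPrim F J b))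
        - inner ℂ (toL2 ψ) (U a (v - Complex.I • duhPrim F J a)))
      + ∫ r in a..b, inner ℂ (toL2 (Δ ψ)) (U r (v - Complex.I • duhPrim F J r))
      = ∫ r in a..b, ∫ x, F (r, x) * starRingEnd ℂ (ψ x) := by
  rcases le_total a b with hab | hab
  · exact weak_of_duhamel hJ hF v ψ hab (by rwa [uIcc_of_le hab] at hJab)
  · have := weak_of_duhamel hJ hF v ψ hab (by rwa [uIcc_of_ge hab] at hJab)
    rw [intervalIntegral.integral_symm b a, intervalIntegral.integral_symm b a]
    linear_combination -this

/-! ### Distributional solutions satisfy the Duhamel formula. -/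

theorem norm_laplacian_le {ψ : 𝓢(Plane, ℂ)} {R : ℝ} (hψ : ∀ ξ, R < ‖ξ‖ → (𝓕 ψ : 𝓢(Plane, ℂ)) ξ = 0) :
    ‖toL2 (Δ ψ)‖ ≤ (2 * Real.pi * R) ^ 2 * ‖toL2 ψ‖ := by
  refine norm_le_of_fourier ?_
  filter_upwards [fourier_laplacian_ae ψ, fourier_toL2_ae ψ] with ξ h1 h2
  rw [h1, h2]
  by_cases h : R < ‖ξ‖
  · simp [hψ ξ h]
  · rw [norm_mul, norm_neg, Complex.norm_real, Real.norm_eq_abs, abs_of_nonneg (by positivity)]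
    push Not at h
    gcongr

/-- Inverse transforms of smooth compactly supported functions are band limited, and pairing with
them determines `𝓕 f`. -/
theorem eq_zero_of_inner_band_limited {f : L2} (h : ∀ (ψ : 𝓢(Plane, ℂ)) (R : ℝ),
    (∀ ξ, R < ‖ξ‖ → (𝓕 ψ : 𝓢(Plane, ℂ)) ξ = 0) → inner ℂ (toL2 ψ) f = 0) : f = 0 := by
  have h0 : ((𝓕 f : L2) : Plane → ℂ) =ᵐ[volume] 0 := by
    refine ae_eq_zero_of_integral_contDiff_smul_eq_zero
      ((Lp.memLp _).locallyIntegrable (by norm_num)) fun g hg hc => ?_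
    obtain ⟨χ, hχ⟩ := exists_schwartz_ofReal hg hc
    obtain ⟨R, hR⟩ := hc.isCompact.isBounded.subset_closedBall (0 : Plane)
    have hF : (𝓕 (𝓕⁻ χ : 𝓢(Plane, ℂ)) : 𝓢(Plane, ℂ)) = χ := FourierTransform.fourier_fourierInv_eq χ
    have h1 := h (𝓕⁻ χ) R fun ξ hξ => by
      rw [hF, hχ]
      have : ξ ∉ tsupport g := fun hc' => by
        have := hR hc'
        rw [mem_closedBall_zero_iff] at this
        linarith
      rw [image_eq_zero_of_notMem_tsupport this]; simp
    rw [← Lp.inner_fourier_eq, L2.inner_def] at h1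
    rw [← h1]
    refine integral_congr_ae ((fourier_toL2_ae (𝓕⁻ χ)).mono fun x hx => ?_)
    simp only [hx, hF, hχ, RCLike.inner_apply, Complex.conj_ofReal, Complex.real_smul]
    ring
  refine L2.fourier_injective (Lp.ext (h0.trans ?_))
  have hz : (𝓕 (0 : L2) : L2) = 0 := map_zero (Lp.fourierTransformₗᵢ Plane ℂ)
  rw [hz]
  exact (Lp.coeFn_zero ..).symm

/-- Uniqueness for the free Schrödinger equation in the class of continuous curves in `L²`. -/
theorem eq_zero_of_weak {z : ℝ → L2} {c : ℂ} (hc : ‖c‖ = 1) {T : ℝ}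
    (hz : ContinuousOn z (Icc 0 T))
    (h : ∀ t ∈ Icc 0 T, ∀ ψ : 𝓢(Plane, ℂ),
      c * inner ℂ (toL2 ψ) (z t) + ∫ r in (0 : ℝ)..t, inner ℂ (toL2 (Δ ψ)) (z r) = 0) :
    ∀ t ∈ Icc 0 T, z t = 0 := by
  obtain ⟨M, hM⟩ := isCompact_Icc.exists_bound_of_continuousOn hz
  -- Each use of the equation replaces `ψ` by `Δ ψ`, which stays in the same band and costs
  -- `(2πR)²`, and adds one integration in time. After `n` uses the bound is a term of the
  -- exponential series, which tends to zero.
  have key : ∀ (R : ℝ) (n : ℕ) (ψ : 𝓢(Plane, ℂ)), (∀ ξ, R < ‖ξ‖ → (𝓕 ψ : 𝓢(Plane, ℂ)) ξ = 0) →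
      ∀ t ∈ Icc 0 T, ‖(inner ℂ (toL2 ψ) (z t) : ℂ)‖
        ≤ M * ‖toL2 ψ‖ * (((2 * Real.pi * R) ^ 2 * t) ^ n / n.factorial) := by
    intro R n
    set ρ := (2 * Real.pi * R) ^ 2 with hρ
    have hρ0 : 0 ≤ ρ := by positivity
    induction n with
    | zero =>
      intro ψ _ t ht
      simp only [pow_zero, Nat.factorial_zero, Nat.cast_one, div_one, mul_one]
      refine (norm_inner_le_norm _ _).trans ?_
      rw [mul_comm]
      gcongr
      exact hM t ht
    | succ n ih =>
      intro ψ hψ t ht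
      have hM0 : 0 ≤ M := (norm_nonneg _).trans (hM t ht)
      have e : ‖(inner ℂ (toL2 ψ) (z t) : ℂ)‖
          = ‖∫ r in (0 : ℝ)..t, (inner ℂ (toL2 (Δ ψ)) (z r) : ℂ)‖ := by
        have := h t ht ψ
        rw [← eq_neg_iff_add_eq_zero] at this
        rw [← norm_neg (∫ r in (0 : ℝ)..t, (inner ℂ (toL2 (Δ ψ)) (z r) : ℂ)), ← this, norm_mul, hc,
          one_mul]
      have hψ' : ∀ ξ, R < ‖ξ‖ → (𝓕 (Δ ψ) : 𝓢(Plane, ℂ)) ξ = 0 := fun ξ hξ => by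
        rw [fourier_laplacian, hψ ξ hξ, mul_zero]
      rw [e]
      have hb : ∀ r ∈ Ioc 0 t, ‖(inner ℂ (toL2 (Δ ψ)) (z r) : ℂ)‖
          ≤ M * (ρ * ‖toL2 ψ‖) * ρ ^ n / n.factorial * r ^ n := by
        intro r hr
        refine (ih (Δ ψ) hψ' r ⟨hr.1.le, hr.2.trans ht.2⟩).trans ?_
        have hr0 : 0 ≤ r := hr.1.le
        calc _ ≤ M * (ρ * ‖toL2 ψ‖) * ((ρ * r) ^ n / n.factorial) := by
              gcongr
              exact norm_laplacian_le hψ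
          _ = _ := by rw [mul_pow]; ring
      refine (intervalIntegral.norm_integral_le_of_norm_le ht.1
        (ae_of_all _ hb) (by apply Continuous.intervalIntegrable; fun_prop)).trans (le_of_eq ?_)
      rw [intervalIntegral.integral_const_mul, integral_pow, Nat.factorial_succ]
      have : (n.factorial : ℝ) ≠ 0 := by positivity
      push_cast
      field_simp
      simp
      ring
  intro t ht
  refine eq_zero_of_inner_band_limited fun ψ R hψ => ?_
  have hl := (FloorSemiring.tendsto_pow_div_factorial_atTop ((2 * Real.pi * R) ^ 2 * t)).const_mul
    (M * ‖toL2 ψ‖)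
  rw [mul_zero] at hl
  exact norm_le_zero_iff.1 (ge_of_tendsto' hl fun n => key R n ψ hψ t ht)

/-- A distributional solution of the Schrödinger equation with forcing `F` is given by the Duhamel
formula. -/
theorem duhamel_of_weak {F : ℝ × Plane → ℂ} {I : Set ℝ} (hm : MeasurableSet I)
    (hI : I.OrdConnected) (h0 : (0 : ℝ) ∈ I) (hF : MemLp F (4 / 3) (stMeasure I)) {u : ℝ → L2}
    (hu : ContinuousOn u I)
    (h : ∀ t ∈ I, ∀ ψ : 𝓢(Plane, ℂ),
      Complex.I * (inner ℂ (toL2 ψ) (u t) - inner ℂ (toL2 ψ) (u 0))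
        + ∫ r in (0 : ℝ)..t, inner ℂ (toL2 (Δ ψ)) (u r)
      = ∫ r in (0 : ℝ)..t, ∫ x, F (r, x) * starRingEnd ℂ (ψ x)) {t : ℝ} (ht : t ∈ I) :
    u t = U t (u 0 - Complex.I • (duhPrim F I t - duhPrim F I 0)) := by
  set v : L2 := u 0 + Complex.I • duhPrim F I 0 with hv
  set w : ℝ → L2 := fun t => U t (v - Complex.I • duhPrim F I t) with hw
  have hw0 : w 0 = u 0 := by simp only [hw, U_zero, hv]; abel
  have hwc : Continuous w := continuous_duhamel hm hF v
  have hzc : ContinuousOn (fun t => u t - w t) I := hu.sub hwc.continuousOn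
  have hsub : ∀ t ∈ I, uIcc 0 t ⊆ I := fun t ht => hI.uIcc_subset h0 ht
  have hz : ∀ t ∈ I, ∀ ψ : 𝓢(Plane, ℂ), Complex.I * inner ℂ (toL2 ψ) (u t - w t)
      + ∫ r in (0 : ℝ)..t, inner ℂ (toL2 (Δ ψ)) (u r - w r) = 0 := by
    intro t ht ψ
    have e1 := h t ht ψ
    have e2 := weak_of_duhamel_uIcc hm hF v ψ (hsub t ht)
    have hi : ∀ {f : ℝ → L2}, ContinuousOn f I →
        IntervalIntegrable (fun r => (inner ℂ (toL2 (Δ ψ)) (f r) : ℂ)) volume 0 t := fun hf =>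
      (continuousOn_const.inner (hf.mono (hsub t ht))).intervalIntegrable
    have e3 : ∫ r in (0 : ℝ)..t, (inner ℂ (toL2 (Δ ψ)) (u r - w r) : ℂ)
        = (∫ r in (0 : ℝ)..t, inner ℂ (toL2 (Δ ψ)) (u r))
          - ∫ r in (0 : ℝ)..t, inner ℂ (toL2 (Δ ψ)) (w r) := by
      simp only [inner_sub_right]
      exact intervalIntegral.integral_sub (hi hu) (hi hwc.continuousOn)
    have e2' : Complex.I * (inner ℂ (toL2 ψ) (w t) - inner ℂ (toL2 ψ) (w 0))
      + ∫ r in (0 : ℝ)..t, inner ℂ (toL2 (Δ ψ)) (w r)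
      = ∫ r in (0 : ℝ)..t, ∫ x, F (r, x) * starRingEnd ℂ (ψ x) := e2
    rw [hw0] at e2'
    rw [e3, inner_sub_right]
    linear_combination e1 - e2'
  have hfin : u t - w t = 0 := by
    rcases le_total 0 t with h1 | h1
    · have hs : Icc 0 t ⊆ I := by rw [← uIcc_of_le h1]; exact hsub t ht
      exact eq_zero_of_weak (c := Complex.I) (by simp) (hzc.mono hs)
        (fun s hs' ψ => hz s (hs hs') ψ) t ⟨h1, le_rfl⟩
    · have hs : ∀ s ∈ Icc 0 (-t), -s ∈ I := fun s hs => by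
        refine hsub t ht ?_
        rw [uIcc_of_ge h1]
        exact ⟨by linarith [hs.2], by linarith [hs.1]⟩
      -- Negative times are reached by reflection, which changes the constant `I` into `-I`.
      have := eq_zero_of_weak (z := fun s => u (-s) - w (-s)) (c := -Complex.I) (T := -t) (by simp)
        (hzc.comp (continuous_neg.continuousOn) hs) (fun s hs' ψ => by
          have e := hz (-s) (hs s hs') ψ
          have e2 := intervalIntegral.integral_comp_neg (a := 0) (b := s)
            (fun r => (inner ℂ (toL2 (Δ ψ)) (u r - w r) : ℂ))
          rw [e2, neg_zero, intervalIntegral.integral_symm]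
          linear_combination -e) (-t) ⟨by linarith, le_rfl⟩
      simpa using this
  rw [sub_eq_zero.1 hfin]
  simp only [hw, hv, smul_sub]
  congr 1
  abel

/-! ### Convergence of weighted lattice sums. -/

section

theorem Hn_eq_lintegral (W a : Lat → ℝ≥0∞) :
    Hn W a = ∫⁻ p, W p * a p ^ 2 ∂(Measure.count : Measure Lat) := (lintegral_count _).symm

/-- Dominated convergence for lattice sums. -/
theorem tendsto_Hn {ι : Type*} {l : Filter ι} [l.IsCountablyGenerated] {W b : Lat → ℝ≥0∞}
    (hW : ∀ p, W p ≠ ∞) {a : ι → Lat → ℝ≥0∞} (ha : ∀ p, Tendsto (fun i => a i p) l (𝓝 0))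
    (hab : ∀ᶠ i in l, ∀ p, a i p ≤ b p) (hb : Hn W b ≠ ∞) :
    Tendsto (fun i => Hn W (a i)) l (𝓝 0) := by
  have h := tendsto_lintegral_filter_of_dominated_convergence (μ := (Measure.count : Measure Lat))
    (l := l) (F := fun i p => W p * a i p ^ 2) (f := fun _ => 0) (fun p => W p * b p ^ 2)
    (Eventually.of_forall fun i => Measurable.of_discrete)
    (hab.mono fun i hi => ae_of_all _ fun p => by gcongr; exact hi p)
    (by rwa [← Hn_eq_lintegral])
    (ae_of_all _ fun p => by
      have := ENNReal.Tendsto.const_mul ((ENNReal.Tendsto.pow (n := 2) (ha p))) (.inr (hW p))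
      simpa using this)
  simpa [Hn_eq_lintegral] using h

theorem Hn_liminf_le (W : Lat → ℝ≥0∞) (hW : ∀ p, W p ≠ ∞) (a : ℕ → Lat → ℝ≥0∞) :
    Hn W (fun p => liminf (fun n => a n p) atTop) ≤ liminf (fun n => Hn W (a n)) atTop := by
  have h := lintegral_liminf_le (μ := (Measure.count : Measure Lat)) (u := atTop)
    (f := fun n p => W p * a n p ^ 2) fun n => Measurable.of_discrete
  simp only [Hn_eq_lintegral]
  refine le_trans (le_of_eq (lintegral_congr fun p => ?_)) h
  have hmono : Monotone fun x : ℝ≥0∞ => W p * x ^ 2 := fun x y hxy => by dsimp only; gcongr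
  have hc : Continuous fun x : ℝ≥0∞ => W p * x ^ 2 :=
    (ENNReal.continuous_const_mul (hW p)).comp (ENNReal.continuous_pow 2)
  exact hmono.map_liminf_of_continuousAt (F := atTop) (fun n => a n p) hc.continuousAt

/-- A finite partial sum involves finitely many weights, all below some `n`. Uniform bounds for the
truncations thus prove finiteness for `W` itself. -/
theorem Hn_le_of_truncate {W a : Lat → ℝ≥0∞} (hW : ∀ p, W p ≠ ∞) {c : ℝ≥0∞}
    (h : ∀ n : ℕ, Hn (fun p => W p ⊓ n) a ≤ c) : Hn W a ≤ c := by
  rw [Hn, ENNReal.tsum_eq_iSup_sum]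
  refine iSup_le fun s => ?_
  obtain ⟨n, hn⟩ := ENNReal.exists_nat_gt (ENNReal.sum_ne_top.2 fun p (_ : p ∈ s) => hW p)
  refine le_trans (Finset.sum_le_sum fun p hp => ?_) ((ENNReal.sum_le_tsum s).trans (h n))
  dsimp only
  rw [inf_eq_left.2 ((Finset.single_le_sum (fun _ _ => zero_le) hp).trans hn.le)]

theorem le_Hn {W a : Lat → ℝ≥0∞} (hW : ∀ p, 1 ≤ W p) (p : Lat) : a p ^ 2 ≤ Hn W a :=
  (le_mul_of_one_le_left' (hW p)).trans (ENNReal.le_tsum p)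

section Norms

theorem hHNorm_zero (η : ℝ) (φ : Seq) :
    hHNorm η 0 φ = Hn (weight η) (fun p => ‖φ p‖ₑ) ^ (1 / 2 : ℝ) := by
  simp only [hHNorm, sobolevSq_zero, Hn]

theorem rpow_half_lt_top {x : ℝ≥0∞} : x ^ (1 / 2 : ℝ) < ∞ ↔ x ≠ ∞ := by
  rw [lt_top_iff_ne_top, Ne, ENNReal.rpow_eq_top_iff_of_pos (by norm_num)]

theorem tendsto_rpow_half {ι : Type*} {l : Filter ι} {f : ι → ℝ≥0∞} :
    Tendsto (fun i => f i ^ (1 / 2 : ℝ)) l (𝓝 0) ↔ Tendsto f l (𝓝 0) := by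
  constructor
  · intro h
    have := (ENNReal.continuous_pow 2).tendsto' 0 0 (by simp) |>.comp h
    refine this.congr fun i => ?_
    simp only [Function.comp]
    rw [← ENNReal.rpow_natCast, ← ENNReal.rpow_mul]; norm_num
  · intro h
    exact (ENNReal.continuous_rpow_const (y := 1 / 2)).tendsto' 0 0 (by simp) |>.comp h

theorem enorm_le_hHNorm (φ : Seq) (p : Lat) : ‖φ p‖ₑ ≤ hHNorm 1 0 φ := by
  rw [hHNorm_zero, one_div, ENNReal.le_rpow_inv_iff (by norm_num)]
  have := le_Hn (W := weight 1) (a := fun p => ‖φ p‖ₑ) (one_le_weight (by norm_num)) p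
  exact_mod_cast this

theorem A4_sq {u : ℝ → Seq} (hu : MeasCurve u) (J : Set ℝ) (p : Lat) :
    A4 J u p ^ 2 = (∫⁻ t in J, (eLpNorm (u t p) 4 (volume : Measure Plane)) ^ 4) ^ (1 / 2 : ℝ) := by
  rw [← N4_pow (hu p), A4, ← ENNReal.rpow_natCast, ← ENNReal.rpow_natCast, ← ENNReal.rpow_mul]
  norm_num

theorem wNorm_eq {u : ℝ → Seq} (hu : MeasCurve u) (J : Set ℝ) :
    wNorm J u = Hn (weight 1) (A4 J u) ^ (1 / 2 : ℝ) := by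
  simp only [wNorm, Hn, A4_sq hu]

theorem wNorm_congr {u v : ℝ → Seq} {J : Set ℝ} (hJ : MeasurableSet J) (h : EqOn u v J) :
    wNorm J u = wNorm J v := by
  simp only [wNorm]
  congr 2
  ext1 p
  congr 2
  refine setLIntegral_congr_fun hJ fun t ht => ?_
  simp only [h ht]

end Norms

/-! ### Solutions of the integral equation. -/

section Mild

/-- Increments of the primitive see only the forcing between the two times, so a solution can be
restarted at any time of any subinterval. -/
theorem duhPrim_sub_local {F : ℝ × Plane → ℂ} {I J : Set ℝ} (hI : MeasurableSet I)
    (hJ : MeasurableSet J) (hJI : J ⊆ I) (hoc : J.OrdConnected)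
    (hF : MemLp F (4 / 3) (stMeasure I)) {s t : ℝ} (hs : s ∈ J) (ht : t ∈ J) :
    duhPrim F I t - duhPrim F I s = duhPrim F J t - duhPrim F J s := by
  have hF' := memLp_mono_set hJI hF
  have key : ∀ {s t : ℝ}, s ∈ J → t ∈ J → s ≤ t →
      duhPrim F I t - duhPrim F I s = duhPrim F J t - duhPrim F J s := by
    intro s t hs ht hst
    have h1 : Ico s t ⊆ J := Ico_subset_Icc_self.trans (hoc.out hs ht)
    rw [duhPrim_sub hI hF hst, duhPrim_sub hJ hF' hst, inter_eq_self_of_subset_right h1,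
      inter_eq_self_of_subset_right (h1.trans hJI)]
  rcases le_total s t with h | h
  · exact key hs ht h
  · rw [← neg_sub, key ht hs h, neg_sub]

theorem enorm_duhPrim_sub_le_univ {F : ℝ × Plane → ℂ} {J : Set ℝ} (hJ : MeasurableSet J)
    (h : MemLp F (4 / 3) (stMeasure J)) (s t : ℝ) :
    ‖duhPrim F J t - duhPrim F J s‖ₑ ≤ eLpNorm F (4 / 3) (stMeasure J) :=
  (enorm_duhPrim_sub_le' hJ h s t).trans (eLpNorm_mono_measure _
    (Measure.prod_mono (Measure.restrict_mono inter_subset_left le_rfl) le_rfl))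

theorem enorm_I : ‖Complex.I‖ₑ = 1 := by rw [← ofReal_norm]; simp

/-- The solution `t ↦ e^{itΔ} (v - i ∫_s^t e^{-irΔ} F(r) dr)` of the equation with forcing `F`. -/
def duhCurve (F : ℝ × Plane → ℂ) (J : Set ℝ) (v : L2) (s t : ℝ) : L2 :=
  U t (v - Complex.I • (duhPrim F J t - duhPrim F J s))

/-- Solutions of the integral equation on `I` with finite `W(I)` norm. -/
structure Mild (I : Set ℝ) (u : ℝ → Seq) : Prop where
  meas : MeasCurve u
  finite : Hn (weight 1) (A4 I u) ≠ ∞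
  eq : ∀ t ∈ I, ∀ p, u t p = duhCurve (nlFld u p) I (u 0 p) 0 t

variable {I J : Set ℝ} {u : ℝ → Seq}

theorem Mild.memLp (h : Mild I u) (p : Lat) : MemLp (nlFld u p) (4 / 3) (stMeasure I) :=
  memLp_nlFld h.meas h.finite p

theorem Mild.eq_from (h : Mild I u) (hI : MeasurableSet I) (hJ : MeasurableSet J) (hJI : J ⊆ I)
    (hoc : J.OrdConnected) {s t : ℝ} (hs : s ∈ J) (ht : t ∈ J) (p : Lat) :
    u t p = duhCurve (nlFld u p) J (U (-s) (u s p)) s t := by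
  rw [duhCurve, ← duhPrim_sub_local hI hJ hJI hoc (h.memLp p) hs ht, h.eq t (hJI ht),
    h.eq s (hJI hs), duhCurve, duhCurve, U_neg_U, sub_sub, ← smul_add]
  congr 4
  abel

theorem Mild.enorm_le (h : Mild I u) (hI : MeasurableSet I) (hJ : MeasurableSet J) (hJI : J ⊆ I)
    (hoc : J.OrdConnected) {s t : ℝ} (hs : s ∈ J) (ht : t ∈ J) (p : Lat) :
    ‖u t p‖ₑ ≤ ‖u s p‖ₑ + eLpNorm (nlFld u p) (4 / 3) (stMeasure J) := by
  rw [h.eq_from hI hJ hJI hoc hs ht, duhCurve, enorm_U]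
  refine enorm_sub_le.trans (add_le_add ?_ ?_)
  · rw [enorm_U]
  · rw [enorm_smul, enorm_I, one_mul]
    exact enorm_duhPrim_sub_le_univ hJ (memLp_mono_set hJI (h.memLp p)) s t

theorem continuous_duhCurve {F : ℝ × Plane → ℂ} (hJ : MeasurableSet J)
    (hF : MemLp F (4 / 3) (stMeasure J)) (v : L2) (s : ℝ) : Continuous (duhCurve F J v s) := by
  have hw : Continuous fun t => Complex.I • (duhPrim F J t - duhPrim F J s) :=
    ((continuous_duhPrim hJ hF).sub continuous_const).const_smul Complex.I
  exact continuous_U_comp continuous_id (continuous_const.sub hw)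

theorem N4_evolution_le {F : ℝ × Plane → ℂ} (hJ : MeasurableSet J)
    (hF : MemLp F (4 / 3) (stMeasure J)) {w : ℝ → L2} (hw : Measurable w)
    (hwF : ∀ s t, s ≤ t → ‖w t - w s‖ₑ ≤ eLpNorm F (4 / 3) (stMeasure (J ∩ Ico s t)))
    (v : L2) (s : ℝ) :
    N4 J (fun t => U t (v - Complex.I • (w t - w s)))
      ≤ N4 J (fun t => U t v) + 10 * eLpNorm F (4 / 3) (stMeasure J) := by
  have hm1 := (continuous_U v).measurable
  have hm2 : Measurable fun t => U t (w t - w s) := measurable_U_comp (hw.sub_const _)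
  have hm3 : Measurable fun t => Complex.I • U t (w t - w s) := hm2.const_smul Complex.I
  have e : (fun t => U t (v - Complex.I • (w t - w s)))
      = (fun t => U t v) - fun t => Complex.I • U t (w t - w s) := by
    ext1 t
    simp only [Pi.sub_apply, map_sub, ContinuousLinearMap.map_smul]
  rw [e]
  refine (N4_sub_le hm1 hm3 J).trans (add_le_add le_rfl ?_)
  have e2 : N4 J (fun t => Complex.I • U t (w t - w s)) = N4 J (fun t => U t (w t - w s)) := by
    rw [N4, eLpNorm_congr_ae (fld_smul hm2 Complex.I J), N4]
    refine eLpNorm_congr_enorm_ae (ae_of_all _ fun z => ?_)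
    rw [enorm_mul, enorm_I, one_mul]
  rw [e2]
  exact (N4_mono (subset_univ J) _).trans (N4_le_of_increments hJ hF hw hwF s)

theorem N4_duhCurve_le {F : ℝ × Plane → ℂ} (hJ : MeasurableSet J)
    (hF : MemLp F (4 / 3) (stMeasure J)) (v : L2) (s : ℝ) :
    N4 J (duhCurve F J v s) ≤ N4 J (fun t => U t v) + 10 * eLpNorm F (4 / 3) (stMeasure J) :=
  N4_evolution_le hJ hF (continuous_duhPrim hJ hF).measurable
    (fun _ _ hst => enorm_duhPrim_sub_le hJ hF hst) v s

theorem Mild.A4_le (h : Mild I u) (hI : MeasurableSet I) (hJ : MeasurableSet J) (hJI : J ⊆ I)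
    (hoc : J.OrdConnected) {s : ℝ} (hs : s ∈ J) (p : Lat) :
    A4 J u p ≤ ‖u s p‖ₑ + 10 * eLpNorm (nlFld u p) (4 / 3) (stMeasure J) := by
  have hF := memLp_mono_set hJI (h.memLp p)
  have hm := (continuous_duhCurve hJ hF (U (-s) (u s p)) s).measurable
  rw [A4, N4_congr (h.meas p) hm hJ fun t ht => h.eq_from hI hJ hJI hoc hs ht p]
  refine (N4_duhCurve_le hJ hF _ s).trans (add_le_add ?_ le_rfl)
  refine ((N4_mono (subset_univ J) _).trans (strichartz _)).trans ?_
  rw [enorm_U]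

theorem Mild.continuousOn (h : Mild I u) (hI : MeasurableSet I) (p : Lat) :
    ContinuousOn (fun t => u t p) I := by
  exact (continuous_duhCurve hI (h.memLp p) (u 0 p) 0).continuousOn.congr fun t ht => h.eq t ht p

theorem Mild.Hn_ne_top (h : Mild I u) (hI : MeasurableSet I) (hJ : MeasurableSet J) (hJI : J ⊆ I)
    (hoc : J.OrdConnected) {W : Lat → ℝ≥0∞} {s : ℝ} (hs : s ∈ J)
    (h0 : Hn W (fun p => ‖u s p‖ₑ) ≠ ∞)
    (hF : Hn W (fun p => eLpNorm (nlFld u p) (4 / 3) (stMeasure J)) ≠ ∞) {t : ℝ} (ht : t ∈ J) :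
    Hn W (fun p => ‖u t p‖ₑ) ≠ ∞ := by
  refine ne_top_of_le_ne_top ?_
    ((Hn_mono fun p => h.enorm_le hI hJ hJI hoc hs ht p).trans (Hn_add_le W _ _))
  exact ENNReal.mul_ne_top (by norm_num) (ENNReal.add_ne_top.2 ⟨h0, hF⟩)

/-- Each component is continuous and is bounded on `J` by the datum at `s` plus the norm of the
forcing, independently of time; dominated convergence over the lattice applies. -/
theorem Mild.tendsto_Hn_sub (h : Mild I u) (hI : MeasurableSet I) (hJ : MeasurableSet J)
    (hJI : J ⊆ I) (hoc : J.OrdConnected) {W : Lat → ℝ≥0∞} (hW : ∀ p, W p ≠ ∞) {s : ℝ} (hs : s ∈ J)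
    (h0 : Hn W (fun p => ‖u s p‖ₑ) ≠ ∞)
    (hF : Hn W (fun p => eLpNorm (nlFld u p) (4 / 3) (stMeasure J)) ≠ ∞) :
    Tendsto (fun t => Hn W fun p => ‖u t p - u s p‖ₑ) (𝓝[J] s) (𝓝 0) := by
  refine tendsto_Hn (b := fun p => (‖u s p‖ₑ + eLpNorm (nlFld u p) (4 / 3) (stMeasure J))
    + ‖u s p‖ₑ) hW (fun p => ?_) ?_ ?_
  · have hc := ((h.continuousOn hI p).mono hJI s hs).tendsto.sub_const (u s p)
    rw [sub_self] at hc
    have := hc.enorm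
    simpa using this
  · filter_upwards [self_mem_nhdsWithin] with t ht p
    exact enorm_sub_le.trans (add_le_add (h.enorm_le hI hJ hJI hoc hs ht p) le_rfl)
  · refine ne_top_of_le_ne_top ?_ (Hn_add_le W _ _)
    refine ENNReal.mul_ne_top (by norm_num) (ENNReal.add_ne_top.2 ⟨?_, h0⟩)
    refine ne_top_of_le_ne_top ?_ (Hn_add_le W _ _)
    exact ENNReal.mul_ne_top (by norm_num) (ENNReal.add_ne_top.2 ⟨h0, hF⟩)

theorem A4_mono (hJI : J ⊆ I) (u : ℝ → Seq) (p : Lat) : A4 J u p ≤ A4 I u p := N4_mono hJI _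

theorem Mild.Hn_nlFld_ne_top (h : Mild I u) (hJI : J ⊆ I) {A : ℝ≥0∞} (hA : A ≠ ∞)
    {W : Lat → ℝ≥0∞} (hW : Admissible A W) (hJ : Hn W (A4 J u) ≠ ∞) :
    Hn W (fun p => eLpNorm (nlFld u p) (4 / 3) (stMeasure J)) ≠ ∞ := by
  refine ne_top_of_le_ne_top ?_ (Hn_nlFld_le hW h.meas J)
  refine ENNReal.mul_ne_top (triConst_ne_top hA) (ENNReal.mul_ne_top hJ (ENNReal.pow_ne_top ?_))
  exact ne_top_of_le_ne_top h.finite (Hn_mono fun p => A4_mono hJI u p)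

end Mild

section Solutions

variable {I : Set ℝ} {u : ℝ → Seq} {u₀ : Seq}

/-- Solutions of the integral equation solve the resonant system. -/
theorem Mild.isSolution (h : Mild I u) (hI : MeasurableSet I) (hoc : I.OrdConnected)
    (h0 : (0 : ℝ) ∈ I) (hu : Hn (weight 1) (fun p => ‖u 0 p‖ₑ) ≠ ∞) : IsSolution I (u 0) u where
  continuousIn := by
    have hF := h.Hn_nlFld_ne_top subset_rfl (by norm_num) admissible_weight_one h.finite
    have hfin : ∀ t ∈ I, Hn (weight 1) (fun p => ‖u t p‖ₑ) ≠ ∞ := fun t ht =>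
      h.Hn_ne_top hI hI subset_rfl hoc h0 hu hF ht
    refine ⟨fun t ht => ?_, fun t ht => ?_⟩
    · rw [hHNorm_zero, rpow_half_lt_top]
      exact hfin t ht
    · simp only [hHNorm_zero, tendsto_rpow_half]
      exact h.tendsto_Hn_sub hI hI subset_rfl hoc (weight_ne_top 1) ht (hfin t ht) hF
  wNorm_lt_top := by
    rw [wNorm_eq h.meas, rpow_half_lt_top]
    exact h.finite
  initial := rfl
  equation := by
    intro j t ht φ
    have hsub : uIcc 0 t ⊆ I := hoc.uIcc_subset h0 ht
    have e := weak_of_duhamel_uIcc hI (h.memLp j)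
      (u 0 j + Complex.I • duhPrim (nlFld u j) I 0) (conjS φ) hsub
    have hu' : ∀ r ∈ I, U r (u 0 j + Complex.I • duhPrim (nlFld u j) I 0
        - Complex.I • duhPrim (nlFld u j) I r) = u r j := by
      intro r hr
      rw [h.eq r hr, duhCurve]
      congr 1
      rw [smul_sub]; abel
    rw [hu' t ht, hu' 0 h0, ← integral_mul_schwartz, ← integral_mul_schwartz] at e
    have e1 : ∫ r in (0 : ℝ)..t, ∫ x, u r j x * (Δ φ) x
        = ∫ r in (0 : ℝ)..t, inner ℂ (toL2 (Δ (conjS φ)))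
          (U r (u 0 j + Complex.I • duhPrim (nlFld u j) I 0
            - Complex.I • duhPrim (nlFld u j) I r)) := by
      refine intervalIntegral.integral_congr fun r hr => ?_
      simp only [hu' r (hsub hr), laplacian_conjS, ← integral_mul_schwartz]
    have e2 : ∫ r in (0 : ℝ)..t, ∫ x, nonlinearity (u r) j x * φ x
        = ∫ r in (0 : ℝ)..t, ∫ x, nlFld u j (r, x) * starRingEnd ℂ (conjS φ x) := by
      refine intervalIntegral.integral_congr fun r _ => ?_
      refine integral_congr_ae ((nlFld_ae u j r).mono fun x hx => ?_)
      simp only [hx, conjS_apply, Complex.conj_conj]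
    rw [e1, e2, e]

/-- A solution of the resonant system, extended by zero, solves the integral equation. -/
theorem IsSolution.mild (h : IsSolution I u₀ u) (hI : MeasurableSet I) (hoc : I.OrdConnected)
    (h0 : (0 : ℝ) ∈ I) : Mild I (I.indicator u) := by
  have hc : ∀ p, ContinuousOn (fun t => u t p) I := by
    intro p t₀ ht₀
    have h1 := h.continuousIn.2 t₀ ht₀
    refine tendsto_iff_edist_tendsto_0.2 (tendsto_of_tendsto_of_tendsto_of_le_of_le
      tendsto_const_nhds h1 (fun _ => zero_le) fun t => ?_)
    rw [edist_eq_enorm_sub]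
    exact enorm_le_hHNorm (u t - u t₀) p
  have hcut : ∀ t ∈ I, I.indicator u t = u t := fun t ht => indicator_of_mem ht u
  have hm : MeasCurve (I.indicator u) := by
    intro p
    have e : (fun t => I.indicator u t p) = I.indicator fun t => u t p := by
      ext1 t; by_cases ht : t ∈ I <;> simp [ht]
    rw [e]
    classical
    rw [← piecewise_eq_indicator]
    exact (hc p).measurable_piecewise continuousOn_const hI
  have hfin : Hn (weight 1) (A4 I (I.indicator u)) ≠ ∞ := by
    rw [← rpow_half_lt_top, ← wNorm_eq hm, wNorm_congr hI hcut]
    exact h.wNorm_lt_top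
  refine ⟨hm, hfin, fun t ht j => ?_⟩
  refine duhamel_of_weak (u := fun t => I.indicator u t j) hI hoc h0 (memLp_nlFld hm hfin j)
    ((hc j).congr fun t ht => by simp only [hcut t ht]) (fun t ht ψ => ?_) ht
  have hsub : uIcc 0 t ⊆ I := hoc.uIcc_subset h0 ht
  have e := h.equation j t ht (conjS ψ)
  have e1 : ∫ r in (0 : ℝ)..t, inner ℂ (toL2 (Δ ψ)) (I.indicator u r j)
      = ∫ r in (0 : ℝ)..t, ∫ x, u r j x * (Δ (conjS ψ)) x := by
    refine intervalIntegral.integral_congr fun r hr => ?_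
    simp only [hcut r (hsub hr), integral_mul_schwartz, laplacian_conjS, conjS_conjS]
  have e2 : ∫ r in (0 : ℝ)..t, ∫ x, nlFld (I.indicator u) j (r, x) * starRingEnd ℂ (ψ x)
      = ∫ r in (0 : ℝ)..t, ∫ x, nonlinearity (u r) j x * conjS ψ x := by
    refine intervalIntegral.integral_congr fun r hr => ?_
    refine integral_congr_ae ((nlFld_ae (I.indicator u) j r).mono fun x hx => ?_)
    simp only [hx, conjS_apply, hcut r (hsub hr)]
  rw [hcut t ht, hcut 0 h0, e1, e2, ← e, integral_mul_schwartz, integral_mul_schwartz, conjS_conjS,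
    h.initial]

end Solutions

end

section Duhamel

variable {J : Set ℝ} {F G : ℝ × Plane → ℂ}

theorem duhPrim_sub_fun (hF : MemLp F (4 / 3) (stMeasure J)) (hG : MemLp G (4 / 3) (stMeasure J))
    (t : ℝ) : duhPrim F J t - duhPrim G J t = duhPrim (F - G) J t :=
  duh_sub (memLp_mono_set inter_subset_left hF) (memLp_mono_set inter_subset_left hG)

theorem duhCurve_sub (hF : MemLp F (4 / 3) (stMeasure J)) (hG : MemLp G (4 / 3) (stMeasure J))
    (v w : L2) (s t : ℝ) :
    duhCurve F J v s t - duhCurve G J w s t = duhCurve (F - G) J (v - w) s t := by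
  simp only [duhCurve]
  rw [← map_sub, ← duhPrim_sub_fun hF hG, ← duhPrim_sub_fun hF hG]
  congr 1
  simp only [smul_sub]
  abel

theorem enorm_duhCurve_le (hJ : MeasurableSet J) (hF : MemLp F (4 / 3) (stMeasure J)) (v : L2)
    (s t : ℝ) : ‖duhCurve F J v s t‖ₑ ≤ ‖v‖ₑ + eLpNorm F (4 / 3) (stMeasure J) := by
  rw [duhCurve, enorm_U]
  refine enorm_sub_le.trans (add_le_add le_rfl ?_)
  rw [enorm_smul, enorm_I, one_mul]
  exact enorm_duhPrim_sub_le_univ hJ hF s t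

theorem N4_duhCurve_le' (hJ : MeasurableSet J) (hF : MemLp F (4 / 3) (stMeasure J)) (v : L2)
    (s : ℝ) : N4 J (duhCurve F J v s) ≤ ‖v‖ₑ + 10 * eLpNorm F (4 / 3) (stMeasure J) :=
  (N4_duhCurve_le hJ hF v s).trans
    (add_le_add ((N4_mono (subset_univ J) _).trans (strichartz v)) le_rfl)

theorem duhCurve_self (F : ℝ × Plane → ℂ) (J : Set ℝ) (v : L2) : duhCurve F J v 0 0 = v := by
  simp [duhCurve, U_zero]

end Duhamel

/-- Absolute continuity in time for each component, then dominated convergence over the lattice.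
This is the source of smallness for large data. -/
theorem tendsto_A4_shrink {I : Set ℝ} {u : ℝ → Seq} (hu : MeasCurve u) {W : Lat → ℝ≥0∞}
    (hW : ∀ p, W p ≠ ∞) (hW0 : ∀ p, W p ≠ 0) (h : Hn W (A4 I u) ≠ ∞) (t₀ : ℝ) :
    Tendsto (fun δ => Hn W (A4 (I ∩ Ioo (t₀ - δ) (t₀ + δ)) u)) (𝓝[>] 0) (𝓝 0) := by
  refine tendsto_Hn hW (fun p => ?_) (Eventually.of_forall fun δ p => A4_mono inter_subset_left u p) h
  have hp : A4 I u p ≠ ∞ := ne_top_of_Hn hW0 h p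
  rw [ENNReal.tendsto_nhds_zero]
  intro ε hε
  have h4 : ∀ K, A4 K u p ^ 4 = ∫⁻ z, ‖cfld u p z‖ₑ ^ (4 : ℝ) ∂stMeasure K := by
    intro K
    rw [A4, N4, eLpNorm_four_pow]
    refine lintegral_congr fun z => ?_
    rw [← ENNReal.rpow_natCast]; rfl
  obtain ⟨δ, hδ, hsm⟩ := exists_small_time (f := cfld u p) (J := I) (p := 4)
    (measurable_cfld hu p).aestronglyMeasurable
    (by rw [← h4]; exact ENNReal.pow_ne_top hp) (ε := ε ^ 4) (pow_ne_zero 4 hε.ne')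
  have : ∀ᶠ δ' in 𝓝[>] (0 : ℝ), δ' < δ / 2 :=
    nhdsWithin_le_nhds (gt_mem_nhds (by linarith))
  filter_upwards [this] with δ' hδ'
  rw [← ENNReal.pow_le_pow_left_iff (n := 4) (by norm_num), h4]
  refine hsm _ measurableSet_Ioo ?_
  rw [Real.volume_Ioo]
  exact ENNReal.ofReal_le_ofReal (by linarith)

/-! ### The Picard iteration. -/

section Picard

/-- The free evolution of a sequence. -/
def freeCurve (u₀ : Seq) (t : ℝ) : Seq := fun p => U t (u₀ p)

/-- The Picard iterates for the integral equation. -/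
def picard (I : Set ℝ) (u₀ : Seq) : ℕ → ℝ → Seq
  | 0 => freeCurve u₀
  | n + 1 => fun t p => duhCurve (nlFld (picard I u₀ n) p) I (u₀ p) 0 t

theorem measCurve_freeCurve (u₀ : Seq) : MeasCurve (freeCurve u₀) := fun p =>
  (continuous_U (u₀ p)).measurable

theorem A4_freeCurve_le (I : Set ℝ) (u₀ : Seq) (p : Lat) : A4 I (freeCurve u₀) p ≤ ‖u₀ p‖ₑ :=
  (N4_mono (subset_univ I) _).trans (strichartz _)

/-- One step of the contraction, with constants. -/
theorem Hn_duhCurve_sub_le {J : Set ℝ} (hJ : MeasurableSet J) {A : ℝ≥0∞} {W : Lat → ℝ≥0∞}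
    (hW : Admissible A W) (h1 : ∀ p, weight 1 p ≤ W p) {u v : ℝ → Seq} (hu : MeasCurve u)
    (hv : MeasCurve v) (fu : Hn (weight 1) (A4 J u) ≠ ∞) (fv : Hn (weight 1) (A4 J v) ≠ ∞)
    (u₀ : Seq) (s : ℝ) :
    Hn W (A4 J ((fun t p => duhCurve (nlFld u p) J (u₀ p) s t)
        - fun t p => duhCurve (nlFld v p) J (u₀ p) s t))
      ≤ 1000 * triConst A * (Hn W (A4 J (u - v)) * (Hn W (A4 J u) + Hn W (A4 J v)) ^ 2) ∧
    ∀ t, Hn W (fun p => ‖duhCurve (nlFld u p) J (u₀ p) s t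
        - duhCurve (nlFld v p) J (u₀ p) s t‖ₑ)
      ≤ 1000 * triConst A * (Hn W (A4 J (u - v)) * (Hn W (A4 J u) + Hn W (A4 J v)) ^ 2) := by
  have mu := fun p => memLp_nlFld hu fu p
  have mv := fun p => memLp_nlFld hv fv p
  have hb := Hn_nlFld_sub_le hW h1 hu hv fu fv
  constructor
  · calc _ ≤ Hn W (fun p => 10 * eLpNorm (nlFld u p - nlFld v p) (4 / 3) (stMeasure J)) := by
          refine Hn_mono fun p => ?_
          have e : (fun t => ((fun t p => duhCurve (nlFld u p) J (u₀ p) s t)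
              - fun t p => duhCurve (nlFld v p) J (u₀ p) s t : ℝ → Seq) t p)
              = duhCurve (nlFld u p - nlFld v p) J 0 s := by
            ext1 t
            simp only [Pi.sub_apply, duhCurve_sub (mu p) (mv p), sub_self]
          rw [A4, e]
          refine (N4_duhCurve_le' hJ ((mu p).sub (mv p)) 0 s).trans ?_
          simp
      _ ≤ 10 ^ 2 * (10 * triConst A *
          (Hn W (A4 J (u - v)) * (Hn W (A4 J u) + Hn W (A4 J v)) ^ 2)) := by
          rw [Hn_const_mul]; gcongr
      _ = _ := by ring
  · intro t
    calc _ ≤ Hn W (fun p => eLpNorm (nlFld u p - nlFld v p) (4 / 3) (stMeasure J)) := by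
          refine Hn_mono fun p => ?_
          rw [duhCurve_sub (mu p) (mv p), sub_self]
          refine (enorm_duhCurve_le hJ ((mu p).sub (mv p)) 0 s t).trans ?_
          simp
      _ ≤ _ := hb.trans (by gcongr; norm_num)

variable {I : Set ℝ} {u₀ : Seq}

/-- If `ε` is the squared `W` norm of the free evolution, an iterate of size `4ε` has a Duhamel term
of size `ε² · ε` up to a constant, and the hypothesis makes it at most `ε`. The constant `1000000`
exceeds both the `12800` needed here and the `256000` needed for the contraction. -/
theorem picard_bound (hI : MeasurableSet I)
    (hfin : Hn (weight 1) (A4 I (freeCurve u₀)) ≠ ∞)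
    (hsmall : 1000000 * triConst 2 * Hn (weight 1) (A4 I (freeCurve u₀)) ^ 2 ≤ 1) (n : ℕ) :
    MeasCurve (picard I u₀ n) ∧
      Hn (weight 1) (A4 I (picard I u₀ n)) ≤ 4 * Hn (weight 1) (A4 I (freeCurve u₀)) := by
  set ε := Hn (weight 1) (A4 I (freeCurve u₀)) with hε
  induction n with
  | zero =>
    exact ⟨measCurve_freeCurve u₀, le_mul_of_one_le_left' (by norm_num)⟩
  | succ n ih =>
    obtain ⟨hm, hb⟩ := ih
    have hf : Hn (weight 1) (A4 I (picard I u₀ n)) ≠ ∞ :=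
      ne_top_of_le_ne_top (ENNReal.mul_ne_top (by norm_num) hfin) hb
    have hF := fun p => memLp_nlFld hm hf p
    refine ⟨fun p => (continuous_duhCurve hI (hF p) (u₀ p) 0).measurable, ?_⟩
    calc Hn (weight 1) (A4 I (picard I u₀ (n + 1)))
        ≤ Hn (weight 1) (fun p => A4 I (freeCurve u₀) p
          + 10 * eLpNorm (nlFld (picard I u₀ n) p) (4 / 3) (stMeasure I)) :=
          Hn_mono fun p => N4_duhCurve_le hI (hF p) (u₀ p) 0
      _ ≤ 2 * (ε + 10 ^ 2 * (triConst 2 * (4 * ε * (4 * ε) ^ 2))) := by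
          refine (Hn_add_le _ _ _).trans ?_
          rw [Hn_const_mul]
          gcongr
          refine (Hn_nlFld_le admissible_weight_one hm I).trans ?_
          gcongr
      _ = 2 * ε + 12800 * triConst 2 * ε ^ 2 * ε := by ring
      _ ≤ 2 * ε + 1000000 * triConst 2 * ε ^ 2 * ε := by gcongr; norm_num
      _ ≤ 2 * ε + 1 * ε := by gcongr
      _ ≤ 4 * ε := by rw [← add_mul]; gcongr; norm_num

/-- The difference estimate is quadratic in the sizes `4ε`, and smallness brings the factor down to
`1/4`. The second assertion, at every time, is what yields limits pointwise in time. -/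
theorem picard_contract (hI : MeasurableSet I)
    (hfin : Hn (weight 1) (A4 I (freeCurve u₀)) ≠ ∞)
    (hsmall : 1000000 * triConst 2 * Hn (weight 1) (A4 I (freeCurve u₀)) ^ 2 ≤ 1) {v w : ℝ → Seq}
    (hv : MeasCurve v) (hw : MeasCurve w)
    (bv : Hn (weight 1) (A4 I v) ≤ 4 * Hn (weight 1) (A4 I (freeCurve u₀)))
    (bw : Hn (weight 1) (A4 I w) ≤ 4 * Hn (weight 1) (A4 I (freeCurve u₀))) :
    Hn (weight 1) (A4 I ((fun t p => duhCurve (nlFld v p) I (u₀ p) 0 t)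
        - fun t p => duhCurve (nlFld w p) I (u₀ p) 0 t))
      ≤ 1 / 4 * Hn (weight 1) (A4 I (v - w)) ∧
    ∀ t, Hn (weight 1) (fun p => ‖duhCurve (nlFld v p) I (u₀ p) 0 t
        - duhCurve (nlFld w p) I (u₀ p) 0 t‖ₑ) ≤ 1 / 4 * Hn (weight 1) (A4 I (v - w)) := by
  set ε := Hn (weight 1) (A4 I (freeCurve u₀)) with hε
  have h4 : 4 * ε ≠ ∞ := ENNReal.mul_ne_top (by norm_num) hfin
  have h := Hn_duhCurve_sub_le hI admissible_weight_one (fun _ => le_rfl) hv hw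
    (ne_top_of_le_ne_top h4 bv) (ne_top_of_le_ne_top h4 bw) u₀ 0
  have hq : 1000 * triConst 2 * (Hn (weight 1) (A4 I (v - w))
      * (Hn (weight 1) (A4 I v) + Hn (weight 1) (A4 I w)) ^ 2)
      ≤ 1 / 4 * Hn (weight 1) (A4 I (v - w)) := by
    calc _ ≤ 1000 * triConst 2 * (Hn (weight 1) (A4 I (v - w)) * (4 * ε + 4 * ε) ^ 2) := by gcongr
      _ = (64000 * triConst 2 * ε ^ 2) * Hn (weight 1) (A4 I (v - w)) := by ring
      _ ≤ 1 / 4 * Hn (weight 1) (A4 I (v - w)) := by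
        gcongr
        rw [ENNReal.le_div_iff_mul_le (by norm_num) (by norm_num)]
        refine le_trans ?_ hsmall
        calc 64000 * triConst 2 * ε ^ 2 * 4 = 256000 * triConst 2 * ε ^ 2 := by ring
          _ ≤ _ := by gcongr; norm_num
  exact ⟨h.1.trans hq, fun t => (h.2 t).trans hq⟩

theorem picard_cauchy (hI : MeasurableSet I)
    (hfin : Hn (weight 1) (A4 I (freeCurve u₀)) ≠ ∞)
    (hsmall : 1000000 * triConst 2 * Hn (weight 1) (A4 I (freeCurve u₀)) ^ 2 ≤ 1) (N : ℕ) :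
    ∀ n m, N ≤ n → N ≤ m →
    Hn (weight 1) (A4 I (picard I u₀ n - picard I u₀ m))
      ≤ (1 / 4) ^ N * (16 * Hn (weight 1) (A4 I (freeCurve u₀))) := by
  set ε := Hn (weight 1) (A4 I (freeCurve u₀)) with hε
  have hb := picard_bound hI hfin hsmall
  induction N with
  | zero =>
    intro n m _ _
    rw [pow_zero, one_mul]
    calc _ ≤ Hn (weight 1) (fun p => A4 I (picard I u₀ n) p + A4 I (picard I u₀ m) p) :=
          Hn_mono fun p => N4_sub_le ((hb n).1 p) ((hb m).1 p) I
      _ ≤ 2 * (4 * ε + 4 * ε) :=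
          (Hn_add_le _ _ _).trans (by gcongr; exacts [(hb n).2, (hb m).2])
      _ = 16 * ε := by ring
  | succ N ih =>
    rintro (_ | n) (_ | m) hn hm
    · omega
    · omega
    · omega
    · refine (picard_contract hI hfin hsmall (hb n).1 (hb m).1 (hb n).2 (hb m).2).1.trans ?_
      rw [pow_succ', mul_assoc]
      gcongr
      exact ih n m (by omega) (by omega)

theorem tendsto_quarter_pow {c : ℝ≥0∞} (hc : c ≠ ∞) :
    Tendsto (fun n : ℕ => (1 / 4 : ℝ≥0∞) ^ n * c) atTop (𝓝 0) := by
  have h : (1 / 4 : ℝ≥0∞) < 1 := by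
    rw [ENNReal.div_lt_iff (by norm_num) (by norm_num)]; norm_num
  have := ENNReal.Tendsto.mul_const (ENNReal.tendsto_pow_atTop_nhds_zero_of_lt_one h) (.inr hc)
  simpa using this

theorem enorm_le_of_Hn {a : Lat → ℝ≥0∞} {c : ℝ≥0∞} (h : Hn (weight 1) a ≤ c) (p : Lat) :
    a p ≤ c ^ (1 / 2 : ℝ) := by
  rw [one_div, ENNReal.le_rpow_inv_iff (by norm_num)]
  have := (le_Hn (W := weight 1) (a := a) (one_le_weight (by norm_num)) p).trans h
  exact_mod_cast this

theorem exists_mild (hI : MeasurableSet I)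
    (hfin : Hn (weight 1) (A4 I (freeCurve u₀)) ≠ ∞)
    (hsmall : 1000000 * triConst 2 * Hn (weight 1) (A4 I (freeCurve u₀)) ^ 2 ≤ 1) :
    ∃ u, Mild I u ∧ u 0 = u₀ ∧ ∀ t p, u t p = duhCurve (nlFld u p) I (u₀ p) 0 t := by
  set ε := Hn (weight 1) (A4 I (freeCurve u₀)) with hε
  have hb := picard_bound hI hfin hsmall
  have hcau := picard_cauchy hI hfin hsmall
  have hK : 16 * ε ≠ ∞ := ENNReal.mul_ne_top (by norm_num) hfin
  -- The shift by one is needed because the bound at each time concerns images of the iteration map,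
  -- and the starting curve is not defined as one.
  have hpt : ∀ t p, CauchySeq fun n => picard I u₀ (n + 1) t p := by
    intro t p
    refine EMetric.cauchySeq_iff_le_tendsto_0.2
      ⟨fun N => ((1 / 4) ^ N * (16 * ε)) ^ (1 / 2 : ℝ), fun n m N hn hm => ?_,
        tendsto_rpow_half.2 (tendsto_quarter_pow hK)⟩
    rw [edist_eq_enorm_sub]
    refine enorm_le_of_Hn (a := fun p => ‖picard I u₀ (n + 1) t p - picard I u₀ (m + 1) t p‖ₑ)
      (((picard_contract hI hfin hsmall (hb n).1 (hb m).1 (hb n).2 (hb m).2).2 t).trans ?_) p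
    refine le_trans ?_ (hcau N n m hn hm)
    refine mul_le_of_le_one_left' ?_
    rw [ENNReal.div_le_iff (by norm_num) (by norm_num)]; norm_num
  choose u hu using fun t p => cauchySeq_tendsto_of_complete (hpt t p)
  have hu' : ∀ t p, Tendsto (fun n => picard I u₀ n t p) atTop (𝓝 (u t p)) := fun t p =>
    (tendsto_add_atTop_iff_nat (f := fun n => picard I u₀ n t p) 1).1 (hu t p)
  have hm : MeasCurve u := fun p =>
    measurable_of_tendsto_metrizable (fun n => (hb n).1 p) (tendsto_pi_nhds.2 fun t => hu' t p)
  have hbu : Hn (weight 1) (A4 I u) ≤ 4 * ε := by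
    calc _ ≤ Hn (weight 1) (fun p => liminf (fun n => A4 I (picard I u₀ n) p) atTop) :=
          Hn_mono fun p => N4_le_liminf (fun n => (hb n).1 p) (hm p) hI fun t _ => hu' t p
      _ ≤ liminf (fun n => Hn (weight 1) (A4 I (picard I u₀ n))) atTop :=
          Hn_liminf_le _ (weight_ne_top 1) _
      _ ≤ 4 * ε := by
          refine (liminf_le_liminf (Eventually.of_forall fun n => (hb n).2)).trans ?_
          rw [liminf_const]
  have hfu : Hn (weight 1) (A4 I u) ≠ ∞ :=
    ne_top_of_le_ne_top (ENNReal.mul_ne_top (by norm_num) hfin) hbu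
  have hdiff : ∀ n, Hn (weight 1) (A4 I (picard I u₀ n - u)) ≤ (1 / 4) ^ n * (16 * ε) := by
    intro n
    calc _ ≤ Hn (weight 1) (fun p => liminf (fun m => A4 I (picard I u₀ n - picard I u₀ m) p) atTop) :=
          Hn_mono fun p => N4_le_liminf (u := fun m t => (picard I u₀ n - picard I u₀ m) t p)
            (fun m => ((hb n).1.sub (hb m).1) p) (((hb n).1.sub hm) p) hI
            fun t _ => tendsto_const_nhds.sub (hu' t p)
      _ ≤ liminf (fun m => Hn (weight 1) (A4 I (picard I u₀ n - picard I u₀ m))) atTop :=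
          Hn_liminf_le _ (weight_ne_top 1) _
      _ ≤ _ := by
          refine (liminf_le_liminf (v := fun _ => (1 / 4) ^ n * (16 * ε)) ?_).trans (by simp)
          filter_upwards [eventually_ge_atTop n] with m hmn
          exact hcau n n m le_rfl hmn
  -- The iterates converge to `u` in the `W` norm, so their images converge at every time to the
  -- image of `u`; the fixed point equation thus holds for all `t`, not just almost all.
  have heq : ∀ t p, u t p = duhCurve (nlFld u p) I (u₀ p) 0 t := by
    intro t p
    refine tendsto_nhds_unique (hu t p) (tendsto_iff_edist_tendsto_0.2 ?_)
    refine tendsto_of_tendsto_of_tendsto_of_le_of_le tendsto_const_nhds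
      (tendsto_rpow_half.2 (tendsto_quarter_pow hK)) (fun _ => zero_le) fun n => ?_
    rw [edist_eq_enorm_sub]
    refine enorm_le_of_Hn (a := fun p => ‖picard I u₀ (n + 1) t p
      - duhCurve (nlFld u p) I (u₀ p) 0 t‖ₑ)
      (((picard_contract hI hfin hsmall (hb n).1 hm (hb n).2 hbu).2 t).trans ?_) p
    refine le_trans ?_ (hdiff n)
    refine mul_le_of_le_one_left' ?_
    rw [ENNReal.div_le_iff (by norm_num) (by norm_num)]; norm_num
  have h0 : u 0 = u₀ := by
    ext1 p
    rw [heq 0 p, duhCurve_self]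
  exact ⟨u, ⟨hm, hfu, fun t _ p => by rw [h0]; exact heq t p⟩, h0, heq⟩

end Picard

section

theorem eventually_mul_sq_le_one {ι : Type*} {l : Filter ι} {x : ι → ℝ≥0∞} {c : ℝ≥0∞} (hc : c ≠ ∞)
    (hx : Tendsto x l (𝓝 0)) : ∀ᶠ i in l, c * x i ^ 2 ≤ 1 := by
  have h := ENNReal.Tendsto.const_mul (ENNReal.Tendsto.pow (n := 2) hx) (.inr hc)
  simp only [ne_eq, OfNat.ofNat_ne_zero, not_false_eq_true, zero_pow, mul_zero] at h
  exact (h.eventually (gt_mem_nhds one_pos)).mono fun i hi => hi.le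

theorem hHNorm_one_lt_top {φ : Seq} :
    hHNorm 1 0 φ < ∞ ↔ Hn (weight 1) (fun p => ‖φ p‖ₑ) ≠ ∞ := by
  rw [hHNorm_zero, rpow_half_lt_top]

/-- Local existence. -/
theorem exists_solution {u₀ : Seq} (h : hHNorm 1 0 u₀ < ∞) :
    ∃ I : Set ℝ, IsOpen I ∧ I.OrdConnected ∧ (0 : ℝ) ∈ I ∧ ∃ u, IsSolution I u₀ u := by
  rw [hHNorm_one_lt_top] at h
  have hfin : ∀ J, Hn (weight 1) (A4 J (freeCurve u₀)) ≠ ∞ := fun J =>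
    ne_top_of_le_ne_top h (Hn_mono (A4_freeCurve_le J u₀))
  -- The data may be large: only the `W` norm of the free evolution must be small, and it shrinks
  -- with the interval.
  have ht := tendsto_A4_shrink (measCurve_freeCurve u₀) (weight_ne_top 1) (weight_ne_zero 1)
    (hfin univ) 0
  have hc : 1000000 * triConst 2 ≠ ∞ :=
    ENNReal.mul_ne_top (by norm_num) (triConst_ne_top (by norm_num))
  obtain ⟨δ, hδ, hδ0⟩ := ((eventually_mul_sq_le_one hc ht).and self_mem_nhdsWithin).exists
  simp only [univ_inter, zero_sub, zero_add] at hδ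
  obtain ⟨u, hu, hu0, -⟩ := exists_mild (measurableSet_Ioo) (hfin _) hδ
  have h0 : (0 : ℝ) ∈ Ioo (-δ) δ := ⟨neg_lt_zero.2 hδ0, hδ0⟩
  refine ⟨Ioo (-δ) δ, isOpen_Ioo, ordConnected_Ioo, h0, u, ?_⟩
  have := hu.isSolution measurableSet_Ioo ordConnected_Ioo h0 (by rw [hu0]; exact h)
  rwa [hu0] at this

/-! ### Uniqueness and propagation along an interval. -/

section Uniqueness

theorem A4_congr {u v : ℝ → Seq} (hu : MeasCurve u) (hv : MeasCurve v) {J : Set ℝ}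
    (hJ : MeasurableSet J) (h : EqOn u v J) : A4 J u = A4 J v := by
  ext1 p
  exact N4_congr (hu p) (hv p) hJ fun t ht => by simp only [h ht]

theorem measCurve_duhCurve {J : Set ℝ} (hJ : MeasurableSet J) {u : ℝ → Seq} (hu : MeasCurve u)
    (fu : Hn (weight 1) (A4 J u) ≠ ∞) (v : Seq) (s : ℝ) :
    MeasCurve fun t p => duhCurve (nlFld u p) J (v p) s t := fun p =>
  (continuous_duhCurve hJ (memLp_nlFld hu fu p) (v p) s).measurable

/-- A property which locally propagates holds on the whole interval. -/
theorem propagate {I : Set ℝ} (hoc : I.OrdConnected) {P : ℝ → Prop} {a : ℝ} (ha : a ∈ I) (hPa : P a)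
    (hloc : ∀ t₀ ∈ I, ∃ δ > 0, ∀ s ∈ I ∩ Ioo (t₀ - δ) (t₀ + δ), P s →
      ∀ t ∈ I ∩ Ioo (t₀ - δ) (t₀ + δ), P t) : ∀ t ∈ I, P t := by
  intro t ht
  refine (hoc.isPreconnected.induction₂ (fun x y => P x ↔ P y) ?_ ?_ ?_ ha ht).1 hPa
  · intro x hx
    obtain ⟨δ, hδ, h⟩ := hloc x hx
    have hmem : Ioo (x - δ) (x + δ) ∈ 𝓝 x := Ioo_mem_nhds (by linarith) (by linarith)
    have hx' : x ∈ I ∩ Ioo (x - δ) (x + δ) := ⟨hx, mem_of_mem_nhds hmem⟩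
    filter_upwards [self_mem_nhdsWithin, nhdsWithin_le_nhds hmem] with y hy hy'
    exact ⟨fun hp => h x hx' hp y ⟨hy, hy'⟩, fun hp => h y ⟨hy, hy'⟩ hp x hx'⟩
  · intro x y z _ _ _ h1 h2; exact h1.trans h2
  · intro x y _ _ h; exact h.symm

variable {I : Set ℝ} {u v : ℝ → Seq}

/-- The squared distance satisfies `d ≤ d / 2` and is finite, hence zero. The second half of the
difference estimate then gives equality at every time. -/
theorem Mild.eqOn_local (hu : Mild I u) (hv : Mild I v) (hI : MeasurableSet I) {J : Set ℝ}
    (hJ : MeasurableSet J) (hJI : J ⊆ I) (hoc : J.OrdConnected)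
    (hsmall : 2000 * triConst 2 * (Hn (weight 1) (A4 J u) + Hn (weight 1) (A4 J v)) ^ 2 ≤ 1) {s : ℝ}
    (hs : s ∈ J) (heq : u s = v s) : EqOn u v J := by
  have fu : Hn (weight 1) (A4 J u) ≠ ∞ :=
    ne_top_of_le_ne_top hu.finite (Hn_mono fun p => A4_mono hJI u p)
  have fv : Hn (weight 1) (A4 J v) ≠ ∞ :=
    ne_top_of_le_ne_top hv.finite (Hn_mono fun p => A4_mono hJI v p)
  have hb := Hn_duhCurve_sub_le hJ admissible_weight_one (fun _ => le_rfl) hu.meas hv.meas fu fv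
    (fun p => U (-s) (u s p)) s
  have eu : ∀ t ∈ J, ∀ p, u t p = duhCurve (nlFld u p) J (U (-s) (u s p)) s t :=
    fun t ht p => hu.eq_from hI hJ hJI hoc hs ht p
  have ev : ∀ t ∈ J, ∀ p, v t p = duhCurve (nlFld v p) J (U (-s) (u s p)) s t :=
    fun t ht p => by rw [heq]; exact hv.eq_from hI hJ hJI hoc hs ht p
  set d := Hn (weight 1) (A4 J (u - v)) with hd
  have hdfin : d ≠ ∞ := by
    refine ne_top_of_le_ne_top ?_ ((Hn_mono fun p => N4_sub_le (hu.meas p) (hv.meas p) J).trans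
      (Hn_add_le _ _ _))
    exact ENNReal.mul_ne_top (by norm_num) (ENNReal.add_ne_top.2 ⟨fu, fv⟩)
  have hhalf : 1000 * triConst 2 * (d * (Hn (weight 1) (A4 J u) + Hn (weight 1) (A4 J v)) ^ 2)
      ≤ d / 2 := by
    rw [ENNReal.le_div_iff_mul_le (by norm_num) (by norm_num)]
    calc _ = 2000 * triConst 2 * (Hn (weight 1) (A4 J u) + Hn (weight 1) (A4 J v)) ^ 2 * d := by ring
      _ ≤ 1 * d := by gcongr
      _ = d := one_mul d
  have hd0 : d = 0 := by
    by_contra hne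
    have h1 : d ≤ d / 2 := by
      refine le_trans (le_of_eq ?_) (hb.1.trans hhalf)
      rw [hd, A4_congr (hu.meas.sub hv.meas) ((measCurve_duhCurve hJ hu.meas fu _ s).sub
        (measCurve_duhCurve hJ hv.meas fv _ s)) hJ fun t ht => ?_]
      ext1 p
      rw [Pi.sub_apply, Pi.sub_apply, Pi.sub_apply, Pi.sub_apply, eu t ht, ev t ht]
    exact absurd h1 (not_le.2 (ENNReal.half_lt_self hne hdfin))
  intro t ht
  ext1 p
  have h2 := (hb.2 t).trans hhalf
  rw [hd0, ENNReal.zero_div] at h2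
  have h3 := enorm_le_of_Hn h2 p
  rw [ENNReal.zero_rpow_of_pos (by norm_num)] at h3
  rw [eu t ht, ev t ht]
  exact sub_eq_zero.1 (by simpa using h3)

theorem Mild.eqOn (hu : Mild I u) (hv : Mild I v) (hI : MeasurableSet I) (hoc : I.OrdConnected)
    (h0 : (0 : ℝ) ∈ I) (heq : u 0 = v 0) : EqOn u v I := by
  refine propagate hoc (P := fun t => u t = v t) h0 heq fun t₀ _ => ?_
  have h1 := (tendsto_A4_shrink hu.meas (weight_ne_top 1) (weight_ne_zero 1) hu.finite t₀).add
    (tendsto_A4_shrink hv.meas (weight_ne_top 1) (weight_ne_zero 1) hv.finite t₀)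
  rw [add_zero] at h1
  have hc : 2000 * triConst 2 ≠ ∞ :=
    ENNReal.mul_ne_top (by norm_num) (triConst_ne_top (by norm_num))
  obtain ⟨δ, hδ, hδ0⟩ := ((eventually_mul_sq_le_one hc h1).and self_mem_nhdsWithin).exists
  refine ⟨δ, hδ0, fun s hs hP t ht => ?_⟩
  exact hu.eqOn_local hv hI (hI.inter measurableSet_Ioo) inter_subset_left
    (hoc.inter ordConnected_Ioo) hδ hs hP ht

theorem IsSolution.eqOn {u₀ : Seq} (hu : IsSolution I u₀ u) (hv : IsSolution I u₀ v)
    (hI : MeasurableSet I) (hoc : I.OrdConnected) (h0 : (0 : ℝ) ∈ I) : EqOn u v I := by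
  intro t ht
  have := (hu.mild hI hoc h0).eqOn (hv.mild hI hoc h0) hI hoc h0
    (by rw [indicator_of_mem h0, indicator_of_mem h0, hu.initial, hv.initial]) ht
  rwa [indicator_of_mem ht, indicator_of_mem ht] at this

end Uniqueness

/-! ### Scattering and global solutions for small data. -/

section Scattering

theorem tendsto_mass {F : ℝ × Plane → ℂ} (hF : MemLp F (4 / 3) (stMeasure univ)) {l : Filter ℝ}
    [l.IsCountablyGenerated] {K : ℝ → Set ℝ} (hK : ∀ t, MeasurableSet (K t))
    (h : ∀ s, ∀ᶠ t in l, s ∉ K t) :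
    Tendsto (fun t => eLpNorm F (4 / 3) (stMeasure (K t))) l (𝓝 0) := by
  have e : ∀ t, mass F (K t) = ∫⁻ z, (K t ×ˢ univ).indicator (fun z => ‖F z‖ₑ ^ (4 / 3 : ℝ)) z
      ∂stMeasure univ := by
    intro t
    rw [lintegral_indicator ((hK t).prod MeasurableSet.univ), mass]
    congr 1
    rw [stMeasure, stMeasure, Measure.restrict_univ, ← Measure.prod_restrict, Measure.restrict_univ]
  have h0 : Tendsto (fun t => mass F (K t)) l (𝓝 0) := by
    simp only [e]
    have := tendsto_lintegral_filter_of_dominated_convergence' (μ := stMeasure univ) (l := l)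
      (F := fun t z => (K t ×ˢ univ).indicator (fun z => ‖F z‖ₑ ^ (4 / 3 : ℝ)) z) (f := fun _ => 0)
      (fun z => ‖F z‖ₑ ^ (4 / 3 : ℝ))
      (Eventually.of_forall fun t => (hF.1.enorm.pow_const _).indicator
        ((hK t).prod MeasurableSet.univ))
      (Eventually.of_forall fun t => ae_of_all _ fun z => indicator_le_self _ _ _)
      (mass_ne_top hF)
      (ae_of_all _ fun z => by
        refine tendsto_const_nhds.congr' ?_
        filter_upwards [h z.1] with t ht
        rw [indicator_of_notMem (fun hc => ht hc.1)])
    simpa using this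
  simp only [eLpNorm_eq_mass]
  exact (ENNReal.continuous_rpow_const (y := 3 / 4)).tendsto' 0 0 (by simp) |>.comp h0

/-- Pulled back by the free flow, the solution is its datum minus `I` times an increment of the
Duhamel primitive, so it converges as soon as the primitive does. The error of each component is at
most a tail of its forcing, and the full forcing norms dominate over the lattice. -/
theorem scatters_of_tendsto {u : ℝ → Seq} {u₀ : Seq} {l : Filter ℝ} [l.IsCountablyGenerated]
    (hu : Mild univ u) (hu0 : u 0 = u₀) (h0 : Hn (weight 1) (fun p => ‖u₀ p‖ₑ) ≠ ∞)
    {K : ℝ → Set ℝ} (hK : ∀ t, MeasurableSet (K t)) (hKl : ∀ s, ∀ᶠ t in l, s ∉ K t) (w : Lat → L2)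
    (hw : ∀ p t, ‖duhPrim (nlFld u p) univ t - w p‖ₑ
      ≤ eLpNorm (nlFld u p) (4 / 3) (stMeasure (K t))) : Scatters l u := by
  have hF := hu.Hn_nlFld_ne_top subset_rfl (by norm_num) admissible_weight_one hu.finite
  have hmono : ∀ p t, eLpNorm (nlFld u p) (4 / 3) (stMeasure (K t))
      ≤ eLpNorm (nlFld u p) (4 / 3) (stMeasure univ) := fun p t => eLpNorm_mono_measure _
    (Measure.prod_mono (Measure.restrict_mono (subset_univ _) le_rfl) le_rfl)
  refine ⟨fun p => u₀ p - Complex.I • (w p - duhPrim (nlFld u p) univ 0), ?_, ?_⟩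
  · rw [hHNorm_one_lt_top]
    refine ne_top_of_le_ne_top ?_ ((Hn_mono fun p => ?_).trans (Hn_add_le (weight 1)
      (fun p => ‖u₀ p‖ₑ) fun p => eLpNorm (nlFld u p) (4 / 3) (stMeasure univ)))
    · exact ENNReal.mul_ne_top (by norm_num) (ENNReal.add_ne_top.2 ⟨h0, hF⟩)
    · refine enorm_sub_le.trans (add_le_add le_rfl ?_)
      rw [enorm_smul, enorm_I, one_mul, ← enorm_neg, neg_sub]
      exact (hw p 0).trans (hmono p 0)
  · have e : ∀ t p, ‖(u t - fun p => propagator t (u₀ p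
        - Complex.I • (w p - duhPrim (nlFld u p) univ 0))) p‖ₑ
        = ‖duhPrim (nlFld u p) univ t - w p‖ₑ := by
      intro t p
      rw [Pi.sub_apply, propagator_eq, hu.eq t (mem_univ t) p, duhCurve, hu0, ← map_sub, enorm_U,
        sub_sub_sub_cancel_left, ← smul_sub, enorm_smul, enorm_I, one_mul, ← enorm_neg]
      congr 1
      abel
    simp only [hHNorm_zero, e, tendsto_rpow_half]
    refine tendsto_Hn (b := fun p => eLpNorm (nlFld u p) (4 / 3) (stMeasure univ))
      (weight_ne_top 1) (fun p => ?_) (Eventually.of_forall fun t p => (hw p t).trans (hmono p t)) hF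
    exact tendsto_of_tendsto_of_tendsto_of_le_of_le tendsto_const_nhds
      (tendsto_mass (hu.memLp p) hK hKl) (fun _ => zero_le) (fun t => hw p t)

/-- The primitive starts at `-∞`: its limit is the full Duhamel vector at `+∞` and zero at `-∞`,
with tails over `[t, ∞)` and `(-∞, t)`. -/
theorem Mild.scatters {u : ℝ → Seq} (hu : Mild univ u)
    (h0 : Hn (weight 1) (fun p => ‖u 0 p‖ₑ) ≠ ∞) : Scatters atTop u ∧ Scatters atBot u := by
  constructor
  · refine scatters_of_tendsto hu rfl h0 (K := Ici) (fun _ => measurableSet_Ici)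
      (fun s => (eventually_gt_atTop s).mono fun t ht => not_le.2 ht)
      (fun p => duh (nlFld u p) univ) fun p t => ?_
    have e := duh_union (F := nlFld u p) (J := Iio t) (K := Ici t)
      (Set.disjoint_left.2 fun x (hx : x < t) (hx' : t ≤ x) => absurd hx' hx.not_ge) measurableSet_Ici
      (by rw [Iio_union_Ici]; exact hu.memLp p)
    rw [Iio_union_Ici] at e
    rw [duhPrim, univ_inter, e, sub_add_cancel_left, enorm_neg]
    exact enorm_duh_le _ _
  · refine scatters_of_tendsto hu rfl h0 (K := Iio) (fun _ => measurableSet_Iio)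
      (fun s => (eventually_le_atBot s).mono fun t ht => not_lt.2 ht)
      (fun p => 0) fun p t => ?_
    rw [duhPrim, univ_inter, sub_zero]
    exact enorm_duh_le _ _

/-- Global existence and scattering for small data. -/
theorem exists_global_solution : ∃ E₀ : ℝ, 0 < E₀ ∧ ∀ u₀ : Seq,
    hHNorm 1 0 u₀ ≤ ENNReal.ofReal E₀ →
      ∃ u, IsSolution univ u₀ u ∧ Scatters atTop u ∧ Scatters atBot u := by
  have hc : 1000000 * triConst 2 ≠ ∞ :=
    ENNReal.mul_ne_top (by norm_num) (triConst_ne_top (by norm_num))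
  have ht : Tendsto (fun E : ℝ => ENNReal.ofReal E ^ 2) (𝓝[>] 0) (𝓝 0) := by
    have : Tendsto (fun E : ℝ => ENNReal.ofReal E ^ 2) (𝓝 0) (𝓝 0) :=
      ((ENNReal.continuous_pow 2).comp ENNReal.continuous_ofReal).tendsto' 0 0 (by simp)
    exact this.mono_left nhdsWithin_le_nhds
  obtain ⟨E₀, hE, hE0⟩ := ((eventually_mul_sq_le_one hc ht).and self_mem_nhdsWithin).exists
  refine ⟨E₀, hE0, fun u₀ hu₀ => ?_⟩
  have hH : Hn (weight 1) (fun p => ‖u₀ p‖ₑ) ≤ ENNReal.ofReal E₀ ^ 2 := by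
    rw [hHNorm_zero, one_div, ENNReal.rpow_inv_le_iff (by norm_num)] at hu₀
    exact_mod_cast hu₀
  have hfin : Hn (weight 1) (fun p => ‖u₀ p‖ₑ) ≠ ∞ :=
    ne_top_of_le_ne_top (ENNReal.pow_ne_top ENNReal.ofReal_ne_top) hH
  have hA := Hn_mono (W := weight 1) (A4_freeCurve_le univ u₀)
  obtain ⟨u, hu, hu0, -⟩ := exists_mild MeasurableSet.univ (ne_top_of_le_ne_top hfin hA)
    (le_trans (by gcongr; exact hA.trans hH) hE)
  have h0' : Hn (weight 1) (fun p => ‖u 0 p‖ₑ) ≠ ∞ := by rw [hu0]; exact hfin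
  have hs := hu.isSolution MeasurableSet.univ ordConnected_univ (mem_univ 0) h0'
  rw [hu0] at hs
  exact ⟨u, hs, hu.scatters h0'⟩

end Scattering

end

/-! ### Persistence of lattice weights. -/

section

variable {I J : Set ℝ} {u : ℝ → Seq}

/-- A fixed point inequality in `[0, ∞]`. -/
theorem le_of_le_add_half {x a : ℝ≥0∞} (hx : x ≠ ∞) (h : x ≤ a + x / 2) : x ≤ 2 * a := by
  have h1 : x / 2 + x / 2 ≤ a + x / 2 := by rwa [ENNReal.add_halves]
  have h2 : x / 2 ≤ a :=
    (ENNReal.add_le_add_iff_right (ENNReal.div_ne_top hx (by norm_num))).1 h1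
  calc x = x / 2 + x / 2 := (ENNReal.add_halves x).symm
    _ ≤ a + a := add_le_add h2 h2
    _ = 2 * a := (two_mul a).symm

/-- The weighted estimate is linear in the `W` norm, with a coefficient governed by the `h¹` norm
alone and at most `1/2` here, so the term is absorbed. Absorption requires a finite quantity,
supplied by the weight `W ⊓ n`; the bound is uniform in `n`. -/
theorem Mild.Hn_A4_le (h : Mild I u) (hI : MeasurableSet I) (hJ : MeasurableSet J) (hJI : J ⊆ I)
    (hoc : J.OrdConnected) {A : ℝ≥0∞} {W : Lat → ℝ≥0∞} (hW : Admissible A W) (hA : 1 ≤ A)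
    (hWt : ∀ p, W p ≠ ∞) (hsmall : 400 * triConst A * Hn (weight 1) (A4 J u) ^ 2 ≤ 1) {s : ℝ}
    (hs : s ∈ J) : Hn W (A4 J u) ≤ 4 * Hn W (fun p => ‖u s p‖ₑ) := by
  have fu : Hn (weight 1) (A4 J u) ≠ ∞ :=
    ne_top_of_le_ne_top h.finite (Hn_mono fun p => A4_mono hJI u p)
  refine Hn_le_of_truncate hWt fun n => ?_
  set V : Lat → ℝ≥0∞ := fun p => W p ⊓ n
  have hfin : Hn V (A4 J u) ≠ ∞ := by
    refine ne_top_of_le_ne_top (ENNReal.mul_ne_top (ENNReal.natCast_ne_top n) fu) ?_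
    rw [Hn, Hn, ← ENNReal.tsum_mul_left]
    refine ENNReal.tsum_le_tsum fun p => ?_
    rw [← mul_assoc]
    gcongr
    exact inf_le_right.trans (le_mul_of_one_le_right' (one_le_weight (by norm_num) p))
  have key : Hn V (A4 J u) ≤ 2 * Hn W (fun p => ‖u s p‖ₑ) + Hn V (A4 J u) / 2 := by
    calc Hn V (A4 J u)
        ≤ 2 * (Hn V (fun p => ‖u s p‖ₑ)
          + 10 ^ 2 * (triConst A * (Hn V (A4 J u) * Hn (weight 1) (A4 J u) ^ 2))) := by
          refine (Hn_mono fun p => h.A4_le hI hJ hJI hoc hs p).trans ((Hn_add_le _ _ _).trans ?_)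
          rw [Hn_const_mul]
          gcongr
          exact Hn_nlFld_le (hW.min hA n) h.meas J
      _ = 2 * Hn V (fun p => ‖u s p‖ₑ)
          + 200 * triConst A * Hn (weight 1) (A4 J u) ^ 2 * Hn V (A4 J u) := by ring
      _ ≤ _ := by
          refine add_le_add ?_ ?_
          · gcongr
            exact Hn_mono_weight fun p => inf_le_left
          · rw [ENNReal.le_div_iff_mul_le (by norm_num) (by norm_num)]
            calc _ = 400 * triConst A * Hn (weight 1) (A4 J u) ^ 2 * Hn V (A4 J u) := by ring
              _ ≤ 1 * Hn V (A4 J u) := by gcongr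
              _ = _ := one_mul _
  refine (le_of_le_add_half hfin key).trans (le_of_eq ?_)
  rw [← mul_assoc]; norm_num

/-- Persistence of weights on the lattice. -/
theorem Mild.persist_weight (h : Mild I u) (hI : MeasurableSet I) (hoc : I.OrdConnected)
    (h0 : (0 : ℝ) ∈ I) {A : ℝ≥0∞} (hA : 1 ≤ A) (hA' : A ≠ ∞) {W : Lat → ℝ≥0∞}
    (hW : Admissible A W) (hWt : ∀ p, W p ≠ ∞) (hu : Hn W (fun p => ‖u 0 p‖ₑ) ≠ ∞) :
    (∀ t ∈ I, Hn W (fun p => ‖u t p‖ₑ) ≠ ∞) ∧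
      ∀ t₀ ∈ I, ∃ δ > 0, Hn W (A4 (I ∩ Ioo (t₀ - δ) (t₀ + δ)) u) ≠ ∞ := by
  have hc : 400 * triConst A ≠ ∞ := ENNReal.mul_ne_top (by norm_num) (triConst_ne_top hA')
  have hloc : ∀ t₀, ∃ δ > 0, ∀ s ∈ I ∩ Ioo (t₀ - δ) (t₀ + δ),
      Hn W (A4 (I ∩ Ioo (t₀ - δ) (t₀ + δ)) u) ≤ 4 * Hn W (fun p => ‖u s p‖ₑ) := by
    intro t₀
    obtain ⟨δ, hδ, hδ0⟩ := ((eventually_mul_sq_le_one hc (tendsto_A4_shrink h.meas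
      (weight_ne_top 1) (weight_ne_zero 1) h.finite t₀)).and self_mem_nhdsWithin).exists
    exact ⟨δ, hδ0, fun s hs => h.Hn_A4_le hI (hI.inter measurableSet_Ioo) inter_subset_left
      (hoc.inter ordConnected_Ioo) hW hA hWt hδ hs⟩
  have hall : ∀ t ∈ I, Hn W (fun p => ‖u t p‖ₑ) ≠ ∞ := by
    refine propagate hoc (P := fun t => Hn W (fun p => ‖u t p‖ₑ) ≠ ∞) h0 hu fun t₀ _ => ?_
    obtain ⟨δ, hδ0, hδ⟩ := hloc t₀
    refine ⟨δ, hδ0, fun s hs hP t ht => ?_⟩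
    refine h.Hn_ne_top hI (hI.inter measurableSet_Ioo) inter_subset_left
      (hoc.inter ordConnected_Ioo) hs hP (h.Hn_nlFld_ne_top inter_subset_left hA' hW ?_) ht
    exact ne_top_of_le_ne_top (ENNReal.mul_ne_top (by norm_num) hP) (hδ s hs)
  refine ⟨hall, fun t₀ ht₀ => ?_⟩
  obtain ⟨δ, hδ0, hδ⟩ := hloc t₀
  have hδ0' : 0 < δ := hδ0
  refine ⟨δ, hδ0, ne_top_of_le_ne_top (ENNReal.mul_ne_top (by norm_num) (hall t₀ ht₀))
    (hδ t₀ ⟨ht₀, by linarith, by linarith⟩)⟩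

end

/-! ### Sharp frequency cutoffs and the support of cubic products. -/

/-- The symbol of the sharp cutoff to frequencies of size less than `R`. -/
def lowSymbol (R : ℝ) : Symbol where
  toFun := (Metric.ball (0 : Plane) R).indicator fun _ => 1
  measurable' := measurable_const.indicator measurableSet_ball
  bound' ξ := by
    refine (norm_indicator_le_norm_self _ _).trans ?_
    simp

/-- The symbol of the sharp cutoff to frequencies of size at least `R`. -/
def highSymbol (R : ℝ) : Symbol where
  toFun := (Metric.ball (0 : Plane) R)ᶜ.indicator fun _ => 1
  measurable' := measurable_const.indicator measurableSet_ball.compl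
  bound' ξ := by
    refine (norm_indicator_le_norm_self _ _).trans ?_
    simp

/-- The projection to frequencies of size less than `R`. -/
def low (R : ℝ) : L2 →L[ℂ] L2 := (lowSymbol R).op

/-- The projection to frequencies of size at least `R`. -/
def high (R : ℝ) : L2 →L[ℂ] L2 := (highSymbol R).op

theorem high_U (R t : ℝ) (f : L2) : high R (U t f) = U t (high R f) := Symbol.op_comm _ _ f

theorem enorm_high_le (R : ℝ) (f : L2) : ‖high R f‖ₑ ≤ ‖f‖ₑ := Symbol.enorm_op_le _ f

theorem inner_high (R : ℝ) (f g : L2) : inner ℂ (high R f) g = inner ℂ f (high R g) := by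
  refine Symbol.inner_op (fun ξ => ?_) f g
  simp only [highSymbol]
  by_cases h : ξ ∈ (Metric.ball (0 : Plane) R)ᶜ <;> simp [h]

theorem fourier_high_ae (R : ℝ) (f : L2) : (𝓕 (high R f) : L2) =ᵐ[volume]
    fun ξ => (Metric.ball (0 : Plane) R)ᶜ.indicator (fun _ => (1 : ℂ)) ξ * (𝓕 f : L2) ξ :=
  (highSymbol R).fourier_op_ae f

theorem fourier_low_ae (R : ℝ) (f : L2) : (𝓕 (low R f) : L2) =ᵐ[volume]
    fun ξ => (Metric.ball (0 : Plane) R).indicator (fun _ => (1 : ℂ)) ξ * (𝓕 f : L2) ξ :=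
  (lowSymbol R).fourier_op_ae f

theorem sub_low (R : ℝ) (f : L2) : f - low R f = high R f := by
  refine L2.fourier_injective (Lp.ext ?_)
  filter_upwards [L2.fourier_sub_ae f (low R f), fourier_low_ae R f, fourier_high_ae R f]
    with ξ h1 h2 h3
  rw [h1, h2, h3]
  by_cases h : ξ ∈ Metric.ball (0 : Plane) R
  · have h' : ξ ∉ (Metric.ball (0 : Plane) R)ᶜ := fun hc => hc h
    rw [indicator_of_mem h, indicator_of_notMem h']; ring
  · have h' : ξ ∈ (Metric.ball (0 : Plane) R)ᶜ := h
    rw [indicator_of_notMem h, indicator_of_mem h']; ring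

section BandLimited

/-- Inverse Fourier transforms of functions in `L¹ ∩ L²` supported in the ball of radius `r`. -/
def BandLimited (r : ℝ) (f : Plane → ℂ) : Prop :=
  ∃ φ : Plane → ℂ, Integrable φ ∧ MemLp φ 2 volume ∧ (∀ ξ, r ≤ ‖ξ‖ → φ ξ = 0) ∧ f = 𝓕⁻ φ

theorem BandLimited.conj {r : ℝ} {f : Plane → ℂ} (hf : BandLimited r f) :
    BandLimited r fun x => starRingEnd ℂ (f x) := by
  obtain ⟨φ, h1, h2, h3, rfl⟩ := hf
  have hmp : MeasurePreserving (fun x : Plane => -x) volume volume :=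
    Measure.measurePreserving_neg _
  refine ⟨fun ξ => starRingEnd ℂ (φ (-ξ)), ?_, ?_, fun ξ hξ => ?_, ?_⟩
  · exact Complex.conjCLE.toContinuousLinearMap.integrable_comp h1.comp_neg
  · have := h2.comp_measurePreserving hmp
    refine this.of_le (f := fun ξ => starRingEnd ℂ (φ (-ξ)))
      (Complex.continuous_conj.comp_aestronglyMeasurable this.1) (ae_of_all _ fun ξ => ?_)
    simp
  · simp only [h3 (-ξ) (by rwa [norm_neg]), map_zero]
  · ext1 x
    rw [Real.fourierInv_eq, Real.fourierInv_eq, ← integral_conj, ← integral_neg_eq_self]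
    refine integral_congr_ae (ae_of_all _ fun ξ => ?_)
    simp only [Circle.smul_def, smul_eq_mul, map_mul, inner_neg_left, AddChar.map_neg_eq_inv,
      Circle.coe_inv_eq_conj]
    simp

/-- The transform of the product is a convolution, whose support lies in the sum of the balls. Young
puts it in `L¹` and Cauchy-Schwarz makes it bounded, so it is again in `L²` and the class is stable
under products. -/
theorem BandLimited.mul {r s : ℝ} {f g : Plane → ℂ} (hf : BandLimited r f) (hg : BandLimited s g) :
    BandLimited (r + s) fun x => f x * g x := by
  obtain ⟨φ, h1, h2, h3, rfl⟩ := hf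
  obtain ⟨χ, k1, k2, k3, rfl⟩ := hg
  set B := ContinuousLinearMap.mul ℂ ℂ
  have hint : Integrable (convolution φ χ B volume) := h1.integrable_convolution B k1
  have hbd : ∀ x, ‖convolution φ χ B volume x‖ₑ ^ 2
      ≤ (∫⁻ ξ, ‖φ ξ‖ₑ ^ 2) * ∫⁻ ξ, ‖χ ξ‖ₑ ^ 2 := by
    intro x
    have hm : AEMeasurable (fun t => ‖χ (x - t)‖ₑ) volume :=
      (k2.1.comp_measurePreserving (Measure.measurePreserving_sub_left volume x)).enorm
    have h := sq_lintegral_mul_le volume h2.1.enorm hm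
    rw [lintegral_sub_left_eq_self (fun t => ‖χ t‖ₑ ^ 2) x] at h
    refine le_trans ?_ h
    rw [convolution_def]
    gcongr
    refine (enorm_integral_le_lintegral_enorm _).trans (le_of_eq (lintegral_congr fun t => ?_))
    simp only [B, ContinuousLinearMap.mul_apply', enorm_mul]
  refine ⟨convolution φ χ B volume, hint, ?_, fun ξ hξ => ?_, ?_⟩
  · set M := (∫⁻ ξ, ‖φ ξ‖ₑ ^ 2) * ∫⁻ ξ, ‖χ ξ‖ₑ ^ 2 with hM
    have hMt : M ≠ ∞ := ENNReal.mul_ne_top (lintegral_sq_ne_top h2) (lintegral_sq_ne_top k2)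
    refine memLp_two_of_bounded hint (M := (M ^ (1 / 2 : ℝ)).toReal) fun x => ?_
    have h := hbd x
    rw [← toReal_enorm]
    refine ENNReal.toReal_mono (ENNReal.rpow_ne_top_of_nonneg (by norm_num) hMt) ?_
    rw [one_div, ENNReal.le_rpow_inv_iff (by norm_num)]
    exact_mod_cast h
  · rw [convolution_def]
    refine integral_eq_zero_of_ae (ae_of_all _ fun t => ?_)
    simp only [Pi.zero_apply, B, ContinuousLinearMap.mul_apply']
    by_cases ht : r ≤ ‖t‖
    · rw [h3 t ht, zero_mul]
    · rw [k3 (ξ - t), mul_zero]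
      have := norm_sub_norm_le ξ t
      linarith
  · ext1 x
    rw [Real.fourierInv_eq_fourier_neg, Real.fourierInv_eq_fourier_neg,
      Real.fourierInv_eq_fourier_neg, Real.fourier_mul_convolution_eq h1 k1]

theorem exists_bandLimited_low (R : ℝ) (f : L2) :
    ∃ g, BandLimited R g ∧ low R f =ᵐ[volume] g := by
  set φ : Plane → ℂ := (Metric.ball (0 : Plane) R).indicator (𝓕 f : L2) with hφ
  have h2 : MemLp φ 2 volume := (Lp.memLp _).indicator measurableSet_ball
  have h1 : Integrable φ := by
    rw [hφ, integrable_indicator_iff measurableSet_ball]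
    have : IsFiniteMeasure ((volume : Measure Plane).restrict (Metric.ball 0 R)) :=
      ⟨by rw [Measure.restrict_apply_univ]; exact measure_ball_lt_top⟩
    exact ((Lp.memLp (𝓕 f : L2)).restrict (Metric.ball 0 R)).integrable (by norm_num)
  refine ⟨𝓕⁻ φ, ⟨φ, h1, h2, fun ξ hξ => ?_, rfl⟩, ?_⟩
  · exact indicator_of_notMem (by simpa using hξ) _
  · refine EventuallyEq.trans ?_ (fourierInv_toLp_ae_eq h1 h2)
    have : low R f = 𝓕⁻ (h2.toLp φ) := by
      refine L2.fourier_injective (Lp.ext ?_)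
      rw [FourierTransform.fourier_fourierInv_eq]
      filter_upwards [fourier_low_ae R f, h2.coeFn_toLp] with ξ h3 h4
      rw [h3, h4, hφ]
      by_cases h : ξ ∈ Metric.ball (0 : Plane) R <;> simp [h]
    rw [this]

theorem BandLimited.integral_high_eq_zero {r : ℝ} {f : Plane → ℂ} (hf : BandLimited r f) (g : L2) :
    ∫ x, high r g x * starRingEnd ℂ (f x) = 0 := by
  obtain ⟨φ, h1, h2, h3, rfl⟩ := hf
  have e : ∫ x, high r g x * starRingEnd ℂ (𝓕⁻ φ x)
      = inner ℂ (𝓕⁻ (h2.toLp φ) : L2) (high r g) := by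
    rw [L2.inner_def]
    refine integral_congr_ae ((fourierInv_toLp_ae_eq h1 h2).mono fun x hx => ?_)
    simp only [hx, RCLike.inner_apply]
  rw [e, ← Lp.inner_fourier_eq, FourierTransform.fourier_fourierInv_eq, L2.inner_def]
  refine integral_eq_zero_of_ae ?_
  filter_upwards [fourier_high_ae r g, h2.coeFn_toLp] with ξ h4 h5
  rw [h4, h5, RCLike.inner_apply, Pi.zero_apply]
  by_cases h : r ≤ ‖ξ‖
  · rw [h3 ξ h]; simp
  · rw [indicator_of_notMem (by simpa using h)]; simp

end BandLimited

/-- The image of a curve under an operator acting on each component. -/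
def mapCurve (T : L2 →L[ℂ] L2) (u : ℝ → Seq) (t : ℝ) : Seq := fun p => T (u t p)

theorem MeasCurve.map {u : ℝ → Seq} (hu : MeasCurve u) (T : L2 →L[ℂ] L2) :
    MeasCurve (mapCurve T u) := fun p => T.continuous.measurable.comp (hu p)

theorem integral_high_mul_trilinear (R : ℝ) (g a b c : L2) :
    ∫ x, high (3 * R) g x * starRingEnd ℂ (low R a x * starRingEnd ℂ (low R b x) * low R c x)
      = 0 := by
  obtain ⟨a', ha, ha'⟩ := exists_bandLimited_low R a
  obtain ⟨b', hb, hb'⟩ := exists_bandLimited_low R b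
  obtain ⟨c', hc, hc'⟩ := exists_bandLimited_low R c
  have h := (ha.mul hb.conj).mul hc
  rw [show R + R + R = 3 * R by ring] at h
  rw [← h.integral_high_eq_zero g]
  refine integral_congr_ae ?_
  filter_upwards [ha', hb', hc'] with x h1 h2 h3
  rw [h1, h2, h3]

/-- The nonlinearity of functions of frequency less than `R` has no frequencies above `3R`. -/
theorem high_duh_low {u : ℝ → Seq} (hu : MeasCurve u) (R : ℝ) {J : Set ℝ}
    (h : Hn (weight 1) (A4 J (mapCurve (low R) u)) ≠ ∞) (j : Lat) :
    high (3 * R) (duh (nlFld (mapCurve (low R) u) j) J) = 0 := by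
  set v := mapCurve (low R) u with hv
  have hvm : MeasCurve v := hu.map _
  refine ext_inner_right ℂ fun g => ?_
  rw [inner_high, inner_duh (memLp_nlFld hvm h j), inner_zero_left]
  set f := fld (fun t => U t (high (3 * R) g)) with hf
  have hf4 : MemLp f 4 (stMeasure J) := memLp_fld_U J _
  let F : resonantSet j → ℝ × Plane → ℂ := fun q z =>
    cfld v q.1.1 z * starRingEnd ℂ (cfld v q.1.2.1 z) * cfld v q.1.2.2 z
  have hmF : ∀ q, Measurable (F q) := fun q => ((measurable_cfld hvm _).mul
    (Complex.continuous_conj.measurable.comp (measurable_cfld hvm _))).mul (measurable_cfld hvm _)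
  have hmf : Measurable f := measurable_fld (continuous_U _).measurable
  have hmfF : ∀ q, Measurable fun z => f z * starRingEnd ℂ (F q z) := fun q =>
    hmf.mul (Complex.continuous_conj.measurable.comp (hmF q))
  have hb : ∀ q, ∫⁻ z, ‖f z * starRingEnd ℂ (F q z)‖ₑ ∂stMeasure J
      ≤ eLpNorm f 4 (stMeasure J) * (A4 J v q.1.1 * A4 J v q.1.2.1 * A4 J v q.1.2.2) := by
    intro q
    refine (lintegral_mul_conj_le hf4.1 (hmF q).aestronglyMeasurable).trans ?_
    gcongr
    refine le_trans (le_of_eq ?_) (eLpNorm_mul_three_le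
      (measurable_cfld hvm q.1.1).aestronglyMeasurable
      (measurable_cfld hvm q.1.2.1).aestronglyMeasurable
      (measurable_cfld hvm q.1.2.2).aestronglyMeasurable)
    rw [← eLpNorm_enorm]
    congr 1
    ext1 z
    simp only [F, enorm_mul, RCLike.enorm_conj]
    rfl
  -- Hölder and the trilinear bound give absolute convergence, which permits testing one resonant
  -- triple at a time.
  have hsum : ∑' q, ∫⁻ z, ‖f z * starRingEnd ℂ (F q z)‖ₑ ∂stMeasure J ≠ ∞ := by
    refine ne_top_of_le_ne_top ?_ (ENNReal.tsum_le_tsum hb)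
    rw [ENNReal.tsum_mul_left]
    exact ENNReal.mul_ne_top hf4.2.ne (triSum_A4_ne_top h j)
  have hz : ∀ q, ∫ z, f z * starRingEnd ℂ (F q z) ∂stMeasure J = 0 := by
    intro q
    have hi : Integrable (fun z => f z * starRingEnd ℂ (F q z)) (stMeasure J) :=
      ⟨(hmfF q).aestronglyMeasurable, (ENNReal.ne_top_of_tsum_ne_top hsum q).lt_top⟩
    rw [stMeasure, integral_prod _ hi]
    refine integral_eq_zero_of_ae (ae_of_all _ fun t => ?_)
    rw [Pi.zero_apply, ← integral_high_mul_trilinear R (U t g) (u t q.1.1) (u t q.1.2.1)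
      (u t q.1.2.2)]
    refine integral_congr_ae ?_
    filter_upwards [fld_ae (fun t => U t (high (3 * R) g)) t, fld_ae (fun t => v t q.1.1) t,
      fld_ae (fun t => v t q.1.2.1) t, fld_ae (fun t => v t q.1.2.2) t] with x h1 h2 h3 h4
    simp only [F, hf, cfld, h1, h2, h3, h4, high_U]
    rfl
  calc ∫ z, f z * starRingEnd ℂ (nlFld v j z) ∂stMeasure J
      = ∫ z, ∑' q, f z * starRingEnd ℂ (F q z) ∂stMeasure J := by
        refine integral_congr_ae (ae_of_all _ fun z => ?_)
        simp only [nlFld, F]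
        rw [tsum_mul_left, Complex.conj_tsum]
    _ = ∑' q, ∫ z, f z * starRingEnd ℂ (F q z) ∂stMeasure J :=
        integral_tsum (fun q => (hmfF q).aestronglyMeasurable) hsum
    _ = 0 := by simp [hz]

section

variable {I J : Set ℝ} {u : ℝ → Seq}

theorem Mild.op_eq (h : Mild I u) (hI : MeasurableSet I) (hJ : MeasurableSet J) (hJI : J ⊆ I)
    (hoc : J.OrdConnected) (m : Symbol) {s t : ℝ} (hs : s ∈ J) (ht : t ∈ J) (p : Lat) :
    m.op (u t p) = U t (U (-s) (m.op (u s p))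
      - Complex.I • (m.op (duhPrim (nlFld u p) J t) - m.op (duhPrim (nlFld u p) J s))) := by
  have e : ∀ r (f : L2), m.op (U r f) = U r (m.op f) := fun r f => Symbol.op_comm _ _ f
  rw [h.eq_from hI hJ hJI hoc hs ht p, duhCurve, e]
  congr 1
  rw [map_sub, e, ContinuousLinearMap.map_smul, map_sub]

/-- A multiplier commutes with the free flow, so the image of `u` has its own Duhamel formula. The
forcing `F` only has to dominate the projected increments, which allows terms killed by the
projection to be discarded first. -/
theorem Mild.A4_map_le (h : Mild I u) (hI : MeasurableSet I) (hJ : MeasurableSet J) (hJI : J ⊆ I)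
    (hoc : J.OrdConnected) (m : Symbol) {s : ℝ} (hs : s ∈ J) (p : Lat) {F : ℝ × Plane → ℂ}
    (hF : MemLp F (4 / 3) (stMeasure J))
    (hinc : ∀ a b, a ≤ b → ‖m.op (duh (nlFld u p) (J ∩ Ico a b))‖ₑ
      ≤ eLpNorm F (4 / 3) (stMeasure (J ∩ Ico a b))) :
    A4 J (mapCurve m.op u) p ≤ N4 J (fun t => U t (U (-s) (m.op (u s p))))
      + 10 * eLpNorm F (4 / 3) (stMeasure J) ∧
    ∀ t ∈ J, ‖m.op (u t p)‖ₑ ≤ ‖m.op (u s p)‖ₑ + eLpNorm F (4 / 3) (stMeasure J) := by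
  have hn := memLp_mono_set hJI (h.memLp p)
  set w : ℝ → L2 := fun t => m.op (duhPrim (nlFld u p) J t) with hw
  have hwm : Measurable w := (m.op.continuous.comp (continuous_duhPrim hJ hn)).measurable
  have hinc' : ∀ a b, a ≤ b → ‖w b - w a‖ₑ ≤ eLpNorm F (4 / 3) (stMeasure (J ∩ Ico a b)) := by
    intro a b hab
    simp only [hw]
    rw [← map_sub, duhPrim_sub hJ hn hab]
    exact hinc a b hab
  have hinc2 : ∀ a b, ‖w b - w a‖ₑ ≤ eLpNorm F (4 / 3) (stMeasure J) := by
    have hmono : ∀ a b, eLpNorm F (4 / 3) (stMeasure (J ∩ Ico a b))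
        ≤ eLpNorm F (4 / 3) (stMeasure J) := fun a b => eLpNorm_mono_measure _
      (Measure.prod_mono (Measure.restrict_mono inter_subset_left le_rfl) le_rfl)
    intro a b
    rcases le_total a b with hab | hab
    · exact (hinc' a b hab).trans (hmono a b)
    · rw [← enorm_neg, neg_sub]
      exact (hinc' b a hab).trans (hmono b a)
  set c : ℝ → L2 := fun t => U t (U (-s) (m.op (u s p)) - Complex.I • (w t - w s)) with hc
  have heq : ∀ t ∈ J, m.op (u t p) = c t := fun t ht => h.op_eq hI hJ hJI hoc m hs ht p
  have hcm : Measurable c := by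
    have hw' : Measurable fun t => U (-s) (m.op (u s p)) - Complex.I • (w t - w s) :=
      measurable_const.sub ((hwm.sub_const _).const_smul Complex.I)
    exact measurable_U_comp hw'
  constructor
  · rw [A4, N4_congr ((h.meas.map m.op) p) hcm hJ heq]
    exact N4_evolution_le hJ hF hwm hinc' _ s
  · intro t ht
    rw [heq t ht]
    simp only [hc]
    rw [enorm_U]
    refine enorm_sub_le.trans (add_le_add (by rw [enorm_U]) ?_)
    rw [enorm_smul, enorm_I, one_mul]
    exact hinc2 s t

/-- The sharp cutoff is not bounded on `L⁴` of the plane, so the low part cannot be estimated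
directly by `u`. Duhamel needs the cutoff only on `L²`: the low part of the datum evolves as the
free solution minus its high part, and the cutoff does not increase the increments. -/
theorem Mild.A4_low_le (h : Mild I u) (hI : MeasurableSet I) (hJ : MeasurableSet J) (hJI : J ⊆ I)
    (hoc : J.OrdConnected) (R : ℝ) {s : ℝ} (hs : s ∈ J) (p : Lat) :
    A4 J (mapCurve (low R) u) p ≤ (A4 J (freeCurve fun p => U (-s) (u s p)) p
      + ‖high R (u s p)‖ₑ) + 10 * eLpNorm (nlFld u p) (4 / 3) (stMeasure J) := by
  refine (h.A4_map_le hI hJ hJI hoc (lowSymbol R) hs p (memLp_mono_set hJI (h.memLp p))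
    (fun a b _ => (Symbol.enorm_op_le _ _).trans (enorm_duh_le _ _))).1.trans
    (add_le_add ?_ le_rfl)
  have e : (fun t => U t (U (-s) ((lowSymbol R).op (u s p))))
      = (fun t => U t (U (-s) (u s p))) - fun t => U t (U (-s) (high R (u s p))) := by
    ext1 t
    have : (lowSymbol R).op (u s p) = u s p - high R (u s p) := by
      rw [← sub_low, sub_sub_cancel]; rfl
    rw [this, map_sub, map_sub, Pi.sub_apply]
  rw [e]
  refine (N4_sub_le (continuous_U _).measurable (continuous_U _).measurable J).trans
    (add_le_add le_rfl ?_)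
  refine ((N4_mono (subset_univ J) _).trans (strichartz _)).trans ?_
  rw [enorm_U]

theorem sub_mapCurve_low (R : ℝ) (u : ℝ → Seq) :
    u - mapCurve (low R) u = mapCurve (high R) u := by
  ext1 t; ext1 p
  exact sub_low R (u t p)

/-- The part of the solution of frequency at least `3R` is only forced by the part of frequency at
least `R`. -/
theorem Mild.high_le (h : Mild I u) (hI : MeasurableSet I) (hJ : MeasurableSet J) (hJI : J ⊆ I)
    (hoc : J.OrdConnected) {A : ℝ≥0∞} {W : Lat → ℝ≥0∞} (hW : Admissible A W)
    (h1 : ∀ p, weight 1 p ≤ W p) {R : ℝ} (hlow : Hn W (A4 J (mapCurve (low R) u)) ≠ ∞) {s : ℝ}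
    (hs : s ∈ J) :
    Hn W (A4 J (mapCurve (high (3 * R)) u)) ≤ 2 * Hn W (fun p => ‖high (3 * R) (u s p)‖ₑ)
      + 2000 * triConst A * (Hn W (A4 J u) + Hn W (A4 J (mapCurve (low R) u))) ^ 2
        * Hn W (A4 J (mapCurve (high R) u)) ∧
    ∀ t ∈ J, Hn W (fun p => ‖high (3 * R) (u t p)‖ₑ)
      ≤ 2 * Hn W (fun p => ‖high (3 * R) (u s p)‖ₑ)
      + 2000 * triConst A * (Hn W (A4 J u) + Hn W (A4 J (mapCurve (low R) u))) ^ 2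
        * Hn W (A4 J (mapCurve (high R) u)) := by
  have fu : Hn (weight 1) (A4 J u) ≠ ∞ :=
    ne_top_of_le_ne_top h.finite (Hn_mono fun p => A4_mono hJI u p)
  have fl : Hn (weight 1) (A4 J (mapCurve (low R) u)) ≠ ∞ :=
    ne_top_of_le_ne_top hlow (Hn_mono_weight h1)
  have ml : MeasCurve (mapCurve (low R) u) := h.meas.map _
  set G : Lat → ℝ × Plane → ℂ := fun p => nlFld u p - nlFld (mapCurve (low R) u) p with hG
  have hGm : ∀ p, MemLp (G p) (4 / 3) (stMeasure J) := fun p =>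
    (memLp_nlFld h.meas fu p).sub (memLp_nlFld ml fl p)
  have hGb := Hn_nlFld_sub_le hW h1 h.meas ml fu fl
  rw [sub_mapCurve_low] at hGb
  -- Beyond frequency `3R` the nonlinearity of the low part contributes nothing and may be
  -- subtracted; every term of the difference has the factor `u - low R u = high R u`.
  have hinc : ∀ p a b, a ≤ b → ‖(highSymbol (3 * R)).op (duh (nlFld u p) (J ∩ Ico a b))‖ₑ
      ≤ eLpNorm (G p) (4 / 3) (stMeasure (J ∩ Ico a b)) := by
    intro p a b _
    have hsub : J ∩ Ico a b ⊆ J := inter_subset_left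
    have h0 := high_duh_low h.meas R (J := J ∩ Ico a b)
      (ne_top_of_le_ne_top fl (Hn_mono fun p => A4_mono hsub _ p)) p
    have e : (highSymbol (3 * R)).op (duh (nlFld u p) (J ∩ Ico a b))
        = high (3 * R) (duh (G p) (J ∩ Ico a b)) := by
      rw [hG, ← duh_sub (memLp_mono_set hsub (memLp_nlFld h.meas fu p))
        (memLp_mono_set hsub (memLp_nlFld ml fl p)), map_sub, h0, sub_zero]
      rfl
    rw [e]
    exact (enorm_high_le _ _).trans (enorm_duh_le _ _)
  have key := fun p => h.A4_map_le hI hJ hJI hoc (highSymbol (3 * R)) hs p (hGm p) (hinc p)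
  set X := Hn W (A4 J u) + Hn W (A4 J (mapCurve (low R) u))
  set M := Hn W (A4 J (mapCurve (high R) u))
  constructor
  · calc Hn W (A4 J (mapCurve (high (3 * R)) u))
        ≤ Hn W (fun p => ‖high (3 * R) (u s p)‖ₑ + 10 * eLpNorm (G p) (4 / 3) (stMeasure J)) := by
          refine Hn_mono fun p => (key p).1.trans (add_le_add ?_ le_rfl)
          refine ((N4_mono (subset_univ J) _).trans (strichartz _)).trans ?_
          rw [enorm_U]
          rfl
      _ ≤ 2 * (Hn W (fun p => ‖high (3 * R) (u s p)‖ₑ)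
          + 10 ^ 2 * (10 * triConst A * (M * X ^ 2))) := by
          refine (Hn_add_le _ _ _).trans ?_
          rw [Hn_const_mul]
          gcongr
      _ = _ := by ring
  · intro t ht
    calc Hn W (fun p => ‖high (3 * R) (u t p)‖ₑ)
        ≤ Hn W (fun p => ‖high (3 * R) (u s p)‖ₑ + eLpNorm (G p) (4 / 3) (stMeasure J)) :=
          Hn_mono fun p => (key p).2 t ht
      _ ≤ 2 * (Hn W (fun p => ‖high (3 * R) (u s p)‖ₑ) + 10 * triConst A * (M * X ^ 2)) := by
          refine (Hn_add_le _ _ _).trans ?_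
          gcongr
      _ = 2 * Hn W (fun p => ‖high (3 * R) (u s p)‖ₑ) + 20 * triConst A * X ^ 2 * M := by ring
      _ ≤ _ := by gcongr; norm_num

theorem tendsto_high (f : L2) : Tendsto (fun R => ‖high R f‖ₑ) atTop (𝓝 0) := by
  have h := Symbol.tendsto_op (l := atTop) (m := lowSymbol) (m₀ := freeSymbol 0) (fun ξ => by
    refine tendsto_const_nhds.congr' ?_
    filter_upwards [eventually_gt_atTop ‖ξ‖] with R hR
    have : ξ ∈ Metric.ball (0 : Plane) R := by simpa using hR
    simp [lowSymbol, freeSymbol, this]) f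
  have e : (freeSymbol 0).op f = f := U_zero f
  rw [e] at h
  have h2 := (tendsto_const_nhds (x := f)).sub h
  rw [sub_self] at h2
  have h3 := h2.enorm
  rw [enorm_zero] at h3
  exact h3.congr fun R => by rw [← sub_low]; rfl

/-- On short time intervals the solution and its low frequency parts are small. -/
theorem Mild.exists_small (h : Mild I u) (hI : MeasurableSet I) (hoc : I.OrdConnected)
    {A : ℝ≥0∞} (hA : A ≠ ∞) {W : Lat → ℝ≥0∞} (hW : Admissible A W) (hW0 : ∀ p, W p ≠ 0)
    (hWt : ∀ p, W p ≠ ∞) {t₀ : ℝ} (ht₀ : t₀ ∈ I) (hu : Hn W (fun p => ‖u t₀ p‖ₑ) ≠ ∞)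
    (hδ : ∃ δ > 0, Hn W (A4 (I ∩ Ioo (t₀ - δ) (t₀ + δ)) u) ≠ ∞) {K : ℝ≥0∞} (hK : K ≠ ∞) :
    ∃ δ > 0, ∃ R₀ : ℝ, 1 ≤ R₀ ∧ Hn W (A4 (I ∩ Ioo (t₀ - δ) (t₀ + δ)) u) ≠ ∞ ∧ ∀ R ≥ R₀,
      Hn W (A4 (I ∩ Ioo (t₀ - δ) (t₀ + δ)) (mapCurve (low R) u)) ≠ ∞ ∧
      K * (Hn W (A4 (I ∩ Ioo (t₀ - δ) (t₀ + δ)) u)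
        + Hn W (A4 (I ∩ Ioo (t₀ - δ) (t₀ + δ)) (mapCurve (low R) u))) ^ 2 ≤ 1 := by
  obtain ⟨δ₀, hδ₀, hfin⟩ := hδ
  let J : ℝ → Set ℝ := fun δ => I ∩ Ioo (t₀ - δ) (t₀ + δ)
  let v : Seq := fun p => U (-t₀) (u t₀ p)
  let x : ℝ → ℝ≥0∞ := fun δ => Hn W (A4 (J δ) u)
  let a : ℝ → ℝ≥0∞ := fun δ => Hn W (A4 (J δ) (freeCurve v))
  let b : ℝ → ℝ≥0∞ := fun R => Hn W (fun p => ‖high R (u t₀ p)‖ₑ)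
  let c : ℝ → ℝ≥0∞ := fun δ => triConst A * (x δ * Hn (weight 1) (A4 (J δ) u) ^ 2)
  have hx : Tendsto x (𝓝[>] 0) (𝓝 0) := by
    have := tendsto_A4_shrink h.meas hWt hW0 hfin t₀
    refine tendsto_of_tendsto_of_tendsto_of_le_of_le' tendsto_const_nhds this
      (Eventually.of_forall fun _ => zero_le) ?_
    have hev : ∀ᶠ δ in 𝓝[>] (0 : ℝ), δ < δ₀ := nhdsWithin_le_nhds (gt_mem_nhds hδ₀)
    filter_upwards [hev] with δ hδ
    refine Hn_mono fun p => A4_mono ?_ u p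
    exact fun r hr => ⟨⟨hr.1, by linarith [hr.2.1], by linarith [hr.2.2]⟩, hr.2⟩
  have hva : Hn W (A4 I (freeCurve v)) ≠ ∞ := by
    refine ne_top_of_le_ne_top hu (Hn_mono fun p => (A4_freeCurve_le I v p).trans ?_)
    simp only [v, enorm_U]; rfl
  have ha : Tendsto a (𝓝[>] 0) (𝓝 0) :=
    tendsto_A4_shrink (measCurve_freeCurve v) hWt hW0 hva t₀
  have hc : Tendsto c (𝓝[>] 0) (𝓝 0) := by
    have h1 := tendsto_A4_shrink h.meas (weight_ne_top 1) (weight_ne_zero 1) h.finite t₀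
    have h2 := ENNReal.Tendsto.const_mul (a := triConst A) (ENNReal.Tendsto.mul hx
      (.inr (by simp)) (ENNReal.Tendsto.pow (n := 2) h1) (.inr (by simp)))
      (.inr (triConst_ne_top hA))
    simpa using h2
  have hb : Tendsto b atTop (𝓝 0) :=
    tendsto_Hn hWt (fun p => tendsto_high _)
      (Eventually.of_forall fun R p => enorm_high_le R (u t₀ p)) hu
  have hy : ∀ δ > 0, ∀ R, Hn W (A4 (J δ) (mapCurve (low R) u))
      ≤ 4 * a δ + 4 * b R + 200 * c δ := by
    intro δ hδ R
    have hmem : t₀ ∈ J δ := ⟨ht₀, by linarith, by linarith⟩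
    calc _ ≤ 2 * (2 * (a δ + b R) + 10 ^ 2 * c δ) := by
          refine (Hn_mono fun p => h.A4_low_le hI (hI.inter measurableSet_Ioo) inter_subset_left
            (hoc.inter ordConnected_Ioo) R hmem p).trans ((Hn_add_le _ _ _).trans ?_)
          rw [Hn_const_mul]
          gcongr
          · exact Hn_add_le _ _ _
          · exact Hn_nlFld_le hW h.meas _
      _ = _ := by ring
  have hf : Tendsto (fun z : ℝ × ℝ => (x z.1 + 4 * a z.1 + 200 * c z.1) + 4 * b z.2)
      (𝓝[>] 0 ×ˢ atTop) (𝓝 0) := by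
    have h4 : ∀ {n : ℝ≥0∞} {l : Filter ℝ} {f : ℝ → ℝ≥0∞}, n ≠ ∞ → Tendsto f l (𝓝 0) →
        Tendsto (fun t => n * f t) l (𝓝 0) := fun hn hf => by
      simpa using ENNReal.Tendsto.const_mul hf (.inr hn)
    have h1 := (hx.add (h4 (n := 4) (by norm_num) ha)).add (h4 (n := 200) (by norm_num) hc)
    have h2 := h4 (n := 4) (by norm_num) hb
    have h3 := (h1.comp (tendsto_fst (g := atTop (α := ℝ)))).add
      (h2.comp (tendsto_snd (f := 𝓝[>] (0 : ℝ))))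
    simpa using h3
  have hfin' : ∀ᶠ δ in 𝓝[>] (0 : ℝ), x δ < ∞ ∧ a δ < ∞ ∧ c δ < ∞ :=
    (hx.eventually (gt_mem_nhds ENNReal.zero_lt_top)).and
      ((ha.eventually (gt_mem_nhds ENNReal.zero_lt_top)).and
        (hc.eventually (gt_mem_nhds ENNReal.zero_lt_top)))
  -- `δ` is fixed before `R` is taken large, so that one interval serves all scales.
  obtain ⟨δ, ⟨hδ1, hδ2, hδ3, hδ4⟩, hδ0⟩ := (((eventually_mul_sq_le_one hK hf).curry.and
    hfin').and self_mem_nhdsWithin).exists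
  obtain ⟨R₀, hR₀⟩ := eventually_atTop.1 hδ1
  refine ⟨δ, hδ0, max 1 R₀, le_max_left _ _, hδ2.ne, fun R hR => ⟨?_, ?_⟩⟩
  · refine ne_top_of_le_ne_top ?_ (hy δ hδ0 R)
    have hbR : b R ≠ ∞ := ne_top_of_le_ne_top hu (Hn_mono fun p => enorm_high_le R (u t₀ p))
    exact ENNReal.add_ne_top.2 ⟨ENNReal.add_ne_top.2 ⟨ENNReal.mul_ne_top (by norm_num) hδ3.ne,
      ENNReal.mul_ne_top (by norm_num) hbR⟩, ENNReal.mul_ne_top (by norm_num) hδ4.ne⟩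
  · refine le_trans ?_ (hR₀ R ((le_max_right _ _).trans hR))
    refine mul_le_mul' le_rfl (pow_le_pow_left' ?_ 2)
    refine (add_le_add (le_refl (x δ)) (hy δ hδ0 R)).trans (le_of_eq ?_)
    ring

end

/-! ### Sobolev norms as sums over the scales `R 3ⁿ`. -/

section Dyadic

/-- The ratio of the weights of consecutive frequency scales. -/
def scaleRatio (k : ℝ) : ℝ≥0∞ := ENNReal.ofReal ((9 : ℝ) ^ k)

theorem scaleRatio_ne_top (k : ℝ) : scaleRatio k ≠ ∞ := ENNReal.ofReal_ne_top

theorem scaleRatio_pow (k : ℝ) (n : ℕ) : scaleRatio k ^ n = ENNReal.ofReal (((9 : ℝ) ^ k) ^ n) :=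
  (ENNReal.ofReal_pow (by positivity) n).symm

/-- The multiplier of the sum of the squared high frequency norms over the scales `R 3ⁿ`. -/
def scaleSum (R k : ℝ) (ξ : Plane) : ℝ≥0∞ :=
  ∑' n : ℕ, scaleRatio k ^ n * (Metric.ball (0 : Plane) (R * 3 ^ n))ᶜ.indicator (fun _ => 1) ξ

theorem enorm_sq_high (R : ℝ) (f : L2) : ‖high R f‖ₑ ^ 2
    = ∫⁻ ξ, (Metric.ball (0 : Plane) R)ᶜ.indicator (fun _ => 1) ξ * ‖(𝓕 f : L2) ξ‖ₑ ^ 2 := by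
  rw [← enorm_fourier_eq, enorm_sq_Lp]
  refine lintegral_congr_ae ((fourier_high_ae R f).mono fun ξ hξ => ?_)
  simp only [hξ]
  by_cases h : ξ ∈ (Metric.ball (0 : Plane) R)ᶜ
  · simp only [indicator_of_mem h, one_mul]
  · simp only [indicator_of_notMem h, zero_mul, enorm_zero]
    simp

theorem tsum_enorm_sq_high (R k : ℝ) (f : L2) :
    ∑' n : ℕ, scaleRatio k ^ n * ‖high (R * 3 ^ n) f‖ₑ ^ 2
      = ∫⁻ ξ, scaleSum R k ξ * ‖(𝓕 f : L2) ξ‖ₑ ^ 2 := by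
  have hm : ∀ n : ℕ, Measurable fun ξ : Plane =>
      (Metric.ball (0 : Plane) (R * 3 ^ n))ᶜ.indicator (fun _ => (1 : ℝ≥0∞)) ξ := fun n =>
    measurable_const.indicator measurableSet_ball.compl
  have hf : AEMeasurable (fun ξ => ‖(𝓕 f : L2) ξ‖ₑ ^ 2) volume :=
    (Lp.aestronglyMeasurable _).enorm.pow_const 2
  simp only [enorm_sq_high, scaleSum, ← ENNReal.tsum_mul_right]
  have hms : ∀ n : ℕ, AEMeasurable (fun ξ : Plane => scaleRatio k ^ n *
      (Metric.ball (0 : Plane) (R * 3 ^ n))ᶜ.indicator (fun _ => (1 : ℝ≥0∞)) ξ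
        * ‖(𝓕 f : L2) ξ‖ₑ ^ 2) volume := fun n => ((hm n).const_mul _).aemeasurable.mul hf
  rw [lintegral_tsum hms]
  refine tsum_congr fun n => ?_
  simp only [mul_assoc]
  rw [lintegral_const_mul' _ _ (ENNReal.pow_ne_top (scaleRatio_ne_top k))]

theorem exists_scale {R ρ : ℝ} (hR : 0 < R) (hρ : R ≤ ρ) :
    ∃ n : ℕ, R * 3 ^ n ≤ ρ ∧ ρ < R * 3 ^ (n + 1) := by
  obtain ⟨n, h1, h2⟩ := exists_nat_pow_near (x := ρ / R) (y := 3) (by rwa [one_le_div hR])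
    (by norm_num)
  rw [le_div_iff₀ hR] at h1
  rw [div_lt_iff₀ hR] at h2
  exact ⟨n, by linarith, by linarith⟩

/-- In the shell `R 3ⁿ ≤ |ξ| < R 3ⁿ⁺¹` the term of index `n` alone suffices, at the cost of the
shell ratio `9^k`. Below `R` the summand `1` is used. -/
theorem japanese_le_scaleSum {R k : ℝ} (hR : 0 < R) (hk : 0 ≤ k) (ξ : Plane) :
    ENNReal.ofReal ((1 + (2 * Real.pi * ‖ξ‖) ^ 2) ^ k)
      ≤ ENNReal.ofReal ((1 + (2 * Real.pi * R) ^ 2) ^ k * 9 ^ k) * (1 + scaleSum R k ξ) := by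
  have h9 : (1 : ℝ) ≤ 9 ^ k := Real.one_le_rpow (by norm_num) hk
  rcases lt_or_ge ‖ξ‖ R with h | h
  · refine le_trans (ENNReal.ofReal_le_ofReal ?_) (le_mul_of_one_le_right' le_self_add)
    calc (1 + (2 * Real.pi * ‖ξ‖) ^ 2) ^ k ≤ (1 + (2 * Real.pi * R) ^ 2) ^ k := by gcongr
      _ ≤ _ := le_mul_of_one_le_right (by positivity) h9
  · obtain ⟨n, h1, h2⟩ := exists_scale hR h
    have hmem : ξ ∈ (Metric.ball (0 : Plane) (R * 3 ^ n))ᶜ := by simpa using h1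
    have hs : scaleRatio k ^ n ≤ scaleSum R k ξ := by
      refine le_trans (le_of_eq ?_) (ENNReal.le_tsum n)
      rw [indicator_of_mem hmem, mul_one]
    refine le_trans ?_ (mul_le_mul' le_rfl (hs.trans le_add_self))
    rw [scaleRatio_pow, ← ENNReal.ofReal_mul (by positivity)]
    refine ENNReal.ofReal_le_ofReal ?_
    calc (1 + (2 * Real.pi * ‖ξ‖) ^ 2) ^ k
        ≤ ((1 + (2 * Real.pi * R) ^ 2) * 9 ^ (n + 1)) ^ k := by
          refine Real.rpow_le_rpow (by positivity) ?_ hk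
          have h3 : (2 * Real.pi * ‖ξ‖) ^ 2 ≤ (2 * Real.pi * (R * 3 ^ (n + 1))) ^ 2 := by gcongr
          have h4 : (2 * Real.pi * (R * 3 ^ (n + 1))) ^ 2
              = (2 * Real.pi * R) ^ 2 * 9 ^ (n + 1) := by
            rw [show (9 : ℝ) = 3 ^ 2 by norm_num, ← pow_mul]; ring
          have h5 : (1 : ℝ) ≤ 9 ^ (n + 1) := one_le_pow₀ (by norm_num)
          nlinarith
      _ = (1 + (2 * Real.pi * R) ^ 2) ^ k * 9 ^ k * (9 ^ k) ^ n := by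
          rw [Real.mul_rpow (by positivity) (by positivity), ← Real.rpow_natCast 9 (n + 1),
            ← Real.rpow_mul (by norm_num), mul_comm _ k, Real.rpow_mul (by norm_num),
            Real.rpow_natCast, pow_succ']
          ring

/-- A geometric sum of ratio `9^k > 1` is comparable to its last term, which is why `k > 0` is
required. -/
theorem scaleSum_le_japanese {R k : ℝ} (hR : 1 ≤ R) (hk : 0 < k) (ξ : Plane) :
    scaleSum R k ξ ≤ ENNReal.ofReal (9 ^ k / (9 ^ k - 1))
      * ENNReal.ofReal ((1 + (2 * Real.pi * ‖ξ‖) ^ 2) ^ k) := by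
  have h9 : (1 : ℝ) < 9 ^ k := Real.one_lt_rpow (by norm_num) hk
  rcases lt_or_ge ‖ξ‖ R with h | h
  · have : scaleSum R k ξ = 0 := by
      refine ENNReal.tsum_eq_zero.2 fun n => ?_
      have h3 : (1 : ℝ) ≤ 3 ^ n := one_le_pow₀ (by norm_num)
      have hmem : ξ ∉ (Metric.ball (0 : Plane) (R * 3 ^ n))ᶜ := by
        simp only [mem_compl_iff, mem_ball_zero_iff, not_lt, not_le]
        nlinarith
      rw [indicator_of_notMem hmem, mul_zero]
    rw [this]
    exact zero_le
  · obtain ⟨N, h1, h2⟩ := exists_scale (by linarith) h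
    have hsum : scaleSum R k ξ ≤ ∑ n ∈ Finset.range (N + 1), scaleRatio k ^ n := by
      rw [scaleSum, tsum_eq_sum (s := Finset.range (N + 1))]
      · refine Finset.sum_le_sum fun n _ => mul_le_of_le_one_right' ?_
        exact indicator_le_self' (fun _ _ => zero_le) ξ
      · intro n hn
        have hn' : N + 1 ≤ n := by simpa using hn
        have h3 : (3 : ℝ) ^ (N + 1) ≤ 3 ^ n := pow_le_pow_right₀ (by norm_num) hn'
        have hmem : ξ ∉ (Metric.ball (0 : Plane) (R * 3 ^ n))ᶜ := by
          simp only [mem_compl_iff, mem_ball_zero_iff, not_lt, not_le]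
          nlinarith
        rw [indicator_of_notMem hmem, mul_zero]
    refine hsum.trans ?_
    simp only [scaleRatio_pow]
    rw [← ENNReal.ofReal_sum_of_nonneg fun n _ => by positivity,
      ← ENNReal.ofReal_mul (div_nonneg (by positivity) (by linarith))]
    refine ENNReal.ofReal_le_ofReal ?_
    rw [geom_sum_eq h9.ne', div_mul_eq_mul_div]
    refine div_le_div_of_nonneg_right ?_ (by linarith)
    have h4 : ((9 : ℝ) ^ k) ^ N ≤ (1 + (2 * Real.pi * ‖ξ‖) ^ 2) ^ k := by
      rw [← Real.rpow_natCast, ← Real.rpow_mul (by norm_num), mul_comm, Real.rpow_mul (by norm_num),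
        Real.rpow_natCast]
      refine Real.rpow_le_rpow (by positivity) ?_ hk.le
      have h5 : (3 : ℝ) ^ N ≤ ‖ξ‖ := le_trans (le_mul_of_one_le_left (by positivity) hR) h1
      have h6 : (3 : ℝ) ^ N ≤ 2 * Real.pi * ‖ξ‖ := by nlinarith [Real.pi_gt_three, norm_nonneg ξ]
      have h7 : ((3 : ℝ) ^ N) ^ 2 ≤ (2 * Real.pi * ‖ξ‖) ^ 2 := by gcongr
      rw [show (9 : ℝ) = 3 ^ 2 by norm_num, ← pow_mul, mul_comm, pow_mul]
      linarith
    rw [pow_succ']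
    nlinarith

end Dyadic

section Sobolev

/-- The squared norm of `h^η H^k` for a general weight. -/
def hHsq (W : Lat → ℝ≥0∞) (k : ℝ) (φ : Seq) : ℝ≥0∞ := ∑' p, W p * sobolevSq k (φ p)

theorem hHNorm_eq (η k : ℝ) (φ : Seq) : hHNorm η k φ = hHsq (weight η) k φ ^ (1 / 2 : ℝ) := rfl

theorem hHsq_zero (W : Lat → ℝ≥0∞) (φ : Seq) : hHsq W 0 φ = Hn W (fun p => ‖φ p‖ₑ) := by
  simp only [hHsq, sobolevSq_zero, Hn]

theorem enorm_sq_le_sobolevSq {k : ℝ} (hk : 0 ≤ k) (f : L2) : ‖f‖ₑ ^ 2 ≤ sobolevSq k f := by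
  rw [← enorm_fourier_eq, enorm_sq_Lp]
  refine lintegral_mono fun ξ => le_mul_of_one_le_left' ?_
  rw [← ENNReal.ofReal_one]
  refine ENNReal.ofReal_le_ofReal (Real.one_le_rpow ?_ hk)
  nlinarith [sq_nonneg (2 * Real.pi * ‖ξ‖)]

theorem Hn_le_hHsq (W : Lat → ℝ≥0∞) {k : ℝ} (hk : 0 ≤ k) (φ : Seq) :
    Hn W (fun p => ‖φ p‖ₑ) ≤ hHsq W k φ :=
  ENNReal.tsum_le_tsum fun _ => mul_le_mul' le_rfl (enorm_sq_le_sobolevSq hk _)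

theorem tsum_Hn_high (W : Lat → ℝ≥0∞) (R k : ℝ) (φ : Seq) :
    ∑' n : ℕ, scaleRatio k ^ n * Hn W (fun p => ‖high (R * 3 ^ n) (φ p)‖ₑ)
      = ∑' p, W p * ∫⁻ ξ, scaleSum R k ξ * ‖(𝓕 (φ p) : L2) ξ‖ₑ ^ 2 := by
  simp only [Hn, ← ENNReal.tsum_mul_left, ← tsum_enorm_sq_high]
  rw [ENNReal.tsum_comm]
  refine tsum_congr fun p => tsum_congr fun n => ?_
  ring

theorem hHsq_le (W : Lat → ℝ≥0∞) {R k : ℝ} (hR : 0 < R) (hk : 0 ≤ k) (φ : Seq) :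
    hHsq W k φ ≤ ENNReal.ofReal ((1 + (2 * Real.pi * R) ^ 2) ^ k * 9 ^ k)
      * (Hn W (fun p => ‖φ p‖ₑ)
        + ∑' n : ℕ, scaleRatio k ^ n * Hn W (fun p => ‖high (R * 3 ^ n) (φ p)‖ₑ)) := by
  rw [tsum_Hn_high, Hn, ← ENNReal.tsum_add, ← ENNReal.tsum_mul_left]
  refine ENNReal.tsum_le_tsum fun p => ?_
  rw [← mul_add, mul_left_comm]
  gcongr
  rw [← enorm_fourier_eq, enorm_sq_Lp,
    ← lintegral_add_left' ((Lp.aestronglyMeasurable _).enorm.pow_const 2),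
    ← lintegral_const_mul' _ _ ENNReal.ofReal_ne_top]
  refine lintegral_mono fun ξ => ?_
  refine (mul_le_mul' (japanese_le_scaleSum hR hk ξ) le_rfl).trans (le_of_eq ?_)
  ring

theorem tsum_Hn_high_le (W : Lat → ℝ≥0∞) {R k : ℝ} (hR : 1 ≤ R) (hk : 0 < k) (φ : Seq) :
    ∑' n : ℕ, scaleRatio k ^ n * Hn W (fun p => ‖high (R * 3 ^ n) (φ p)‖ₑ)
      ≤ ENNReal.ofReal (9 ^ k / (9 ^ k - 1)) * hHsq W k φ := by
  rw [tsum_Hn_high, hHsq, ← ENNReal.tsum_mul_left]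
  refine ENNReal.tsum_le_tsum fun p => ?_
  rw [mul_left_comm]
  gcongr
  rw [sobolevSq, ← lintegral_const_mul' _ _ ENNReal.ofReal_ne_top]
  refine lintegral_mono fun ξ => ?_
  rw [← mul_assoc]
  exact mul_le_mul' (scaleSum_le_japanese hR hk ξ) le_rfl

end Sobolev

/-! ### The recursion over scales and persistence of Sobolev regularity. -/

theorem tsum_le_of_le_add_half {c b : ℕ → ℝ≥0∞} (h : ∀ n, c (n + 1) ≤ b (n + 1) + c n / 2) :
    ∑' n, c n ≤ 2 * (c 0 + ∑' n, b n) := by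
  set S := c 0 + ∑' n, b n
  refine ENNReal.tsum_le_of_sum_range_le fun N => ?_
  induction N with
  | zero => simp
  | succ N ih =>
    rw [Finset.sum_range_succ']
    calc ∑ n ∈ Finset.range N, c (n + 1) + c 0
        ≤ ∑ n ∈ Finset.range N, (b (n + 1) + c n / 2) + c 0 := by
          gcongr with n _; exact h n
      _ = ∑ n ∈ Finset.range N, b (n + 1) + (∑ n ∈ Finset.range N, c n) / 2 + c 0 := by
          simp only [Finset.sum_add_distrib, ENNReal.div_eq_inv_mul, Finset.mul_sum]
      _ ≤ ∑' n, b n + (2 * S) / 2 + c 0 := by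
          gcongr
          exact (ENNReal.sum_le_tsum _).trans
            (ENNReal.tsum_comp_le_tsum_of_injective (add_left_injective 1) b)
      _ = 2 * S := by
          rw [mul_div_assoc, mul_comm 2 (S / 2), ENNReal.div_mul_cancel (by norm_num) (by norm_num),
            two_mul]
          simp only [S]
          ring

theorem exists_cons {α : Type*} (x : α) (f : ℕ → α) :
    ∃ g : ℕ → α, g 0 = x ∧ ∀ n, g (n + 1) = f n :=
  ⟨fun n => Nat.casesOn n x f, rfl, fun _ => rfl⟩

/-- The weights `qⁿ` turn the coefficient `θ` into `q θ ≤ 1/2`, so decay of the data over the scales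
passes to `a` by `tsum_le_of_le_add_half`, which assumes no summability. The entry `B 0` is free
because the recursion says nothing about the first scale. -/
theorem exists_summable_bound {q B₀ : ℝ≥0∞} {a d θ : ℕ → ℝ≥0∞} (hθ : ∀ n, q * θ n ≤ 1 / 2)
    (hrec : ∀ n, a (n + 1) ≤ 2 * d (n + 1) + θ n * a n) (ha0 : a 0 ≠ ∞)
    (hd : ∑' n, q ^ n * d n ≠ ∞) (hB : B₀ ≠ ∞) :
    ∃ B : ℕ → ℝ≥0∞, ∑' n, q ^ n * B n ≠ ∞ ∧ B 0 = B₀ ∧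
      ∀ n, B (n + 1) = 2 * d (n + 1) + θ n * a n := by
  have hqθ : ∀ n, q ^ (n + 1) * (2 * d (n + 1) + θ n * a n)
      ≤ 2 * (q ^ (n + 1) * d (n + 1)) + q ^ n * a n / 2 := by
    intro n
    calc _ = 2 * (q ^ (n + 1) * d (n + 1)) + (q * θ n) * (q ^ n * a n) := by ring
      _ ≤ 2 * (q ^ (n + 1) * d (n + 1)) + 1 / 2 * (q ^ n * a n) := by gcongr; exact hθ n
      _ = _ := by rw [one_div, ENNReal.div_eq_inv_mul]
  have hd2 : ∑' n, 2 * (q ^ n * d n) ≠ ∞ := by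
    rw [ENNReal.tsum_mul_left]
    exact ENNReal.mul_ne_top (by norm_num) hd
  have ha : ∑' n, q ^ n * a n ≠ ∞ := by
    refine ne_top_of_le_ne_top ?_ (tsum_le_of_le_add_half (c := fun n => q ^ n * a n)
      (b := fun n => 2 * (q ^ n * d n)) fun n => (mul_le_mul' le_rfl (hrec n)).trans (hqθ n))
    refine ENNReal.mul_ne_top (by norm_num) (ENNReal.add_ne_top.2 ⟨?_, hd2⟩)
    simpa using ha0
  obtain ⟨B, hB0, hBs⟩ := exists_cons B₀ fun n => 2 * d (n + 1) + θ n * a n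
  refine ⟨B, ?_, hB0, hBs⟩
  rw [tsum_eq_zero_add' (f := fun n => q ^ n * B n) ENNReal.summable, hB0, pow_zero, one_mul]
  simp only [hBs]
  refine ENNReal.add_ne_top.2 ⟨hB, ne_top_of_le_ne_top ?_ (ENNReal.tsum_le_tsum hqθ)⟩
  rw [ENNReal.tsum_add]
  refine ENNReal.add_ne_top.2 ⟨ne_top_of_le_ne_top hd2
    (ENNReal.tsum_comp_le_tsum_of_injective (add_left_injective 1)
      fun n => 2 * (q ^ n * d n)), ?_⟩
  simp only [ENNReal.div_eq_inv_mul]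
  rw [ENNReal.tsum_mul_left]
  exact ENNReal.mul_ne_top (by norm_num) ha

variable {I J : Set ℝ} {u : ℝ → Seq}

/-- Propagation of Sobolev regularity on a short time interval. -/
theorem Mild.sobolev_local (h : Mild I u) (hI : MeasurableSet I) (hJ : MeasurableSet J)
    (hJI : J ⊆ I) (hoc : J.OrdConnected) {A : ℝ≥0∞} (hA : A ≠ ∞) {W : Lat → ℝ≥0∞}
    (hW : Admissible A W) (h1 : ∀ p, weight 1 p ≤ W p) {k : ℝ} (hk : 0 < k) {R : ℝ} (hR : 1 ≤ R)
    (hfin : Hn W (A4 J u) ≠ ∞) (hsmall : ∀ r ≥ R, Hn W (A4 J (mapCurve (low r) u)) ≠ ∞ ∧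
      (2 * scaleRatio k * (2000 * triConst A)) * (Hn W (A4 J u)
        + Hn W (A4 J (mapCurve (low r) u))) ^ 2 ≤ 1) {s : ℝ} (hs : s ∈ J)
    (hu : hHsq W k (u s) ≠ ∞) :
    ∃ B : ℕ → ℝ≥0∞, ∑' n, scaleRatio k ^ n * B n ≠ ∞ ∧
      ∀ t ∈ J, ∀ n, Hn W (fun p => ‖high (R * 3 ^ n) (u t p)‖ₑ) ≤ B n := by
  set q := scaleRatio k with hq
  let a : ℕ → ℝ≥0∞ := fun n => Hn W (A4 J (mapCurve (high (R * 3 ^ n)) u))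
  let d : ℕ → ℝ≥0∞ := fun n => Hn W (fun p => ‖high (R * 3 ^ n) (u s p)‖ₑ)
  let θ : ℕ → ℝ≥0∞ := fun n => 2000 * triConst A * (Hn W (A4 J u)
    + Hn W (A4 J (mapCurve (low (R * 3 ^ n)) u))) ^ 2
  have hRn : ∀ n : ℕ, R ≤ R * 3 ^ n := fun n =>
    le_mul_of_one_le_right (by linarith) (one_le_pow₀ (by norm_num))
  have hstep : ∀ n : ℕ, R * 3 ^ (n + 1) = 3 * (R * 3 ^ n) := fun n => by ring
  have hθ : ∀ n, q * θ n ≤ 1 / 2 := by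
    intro n
    rw [ENNReal.le_div_iff_mul_le (by norm_num) (by norm_num)]
    refine le_trans (le_of_eq ?_) (hsmall _ (hRn n)).2
    simp only [θ]
    ring
  -- The threshold triples from one scale to the next, exactly the loss of a cubic product.
  have hrec : ∀ n, a (n + 1) ≤ 2 * d (n + 1) + θ n * a n ∧
      ∀ t ∈ J, Hn W (fun p => ‖high (R * 3 ^ (n + 1)) (u t p)‖ₑ) ≤ 2 * d (n + 1) + θ n * a n := by
    intro n
    simp only [a, d, hstep]
    exact h.high_le hI hJ hJI hoc hW h1 (hsmall _ (hRn n)).1 hs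
  have hd : ∑' n, q ^ n * d n ≠ ∞ :=
    ne_top_of_le_ne_top (ENNReal.mul_ne_top ENNReal.ofReal_ne_top hu)
      (tsum_Hn_high_le W hR hk (u s))
  have ha0 : a 0 ≠ ∞ := by
    have hl : Hn W (A4 J (mapCurve (low (R * 3 ^ 0)) u)) ≠ ∞ := (hsmall _ (hRn 0)).1
    have hle : Hn W (A4 J (u - mapCurve (low (R * 3 ^ 0)) u))
        ≤ 2 * (Hn W (A4 J u) + Hn W (A4 J (mapCurve (low (R * 3 ^ 0)) u))) :=
      (Hn_mono fun p => N4_sub_le (h.meas p) ((h.meas.map _) p) J).trans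
        (Hn_add_le W (A4 J u) (A4 J (mapCurve (low (R * 3 ^ 0)) u)))
    rw [sub_mapCurve_low] at hle
    exact ne_top_of_le_ne_top
      (ENNReal.mul_ne_top (by norm_num) (ENNReal.add_ne_top.2 ⟨hfin, hl⟩)) hle
  have hF := h.Hn_nlFld_ne_top hJI hA hW hfin
  have hus : Hn W (fun p => ‖u s p‖ₑ) ≠ ∞ := ne_top_of_le_ne_top hu (Hn_le_hHsq W hk.le (u s))
  obtain ⟨B, hB, hB0, hBs⟩ := exists_summable_bound (a := a) (d := d) (θ := θ) hθ
    (fun n => (hrec n).1) ha0 hd (ENNReal.mul_ne_top (a := 2) (by norm_num)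
      (ENNReal.add_ne_top.2 ⟨hus, hF⟩))
  refine ⟨B, hB, fun t ht n => ?_⟩
  cases n with
  | zero =>
    rw [hB0]
    exact (Hn_mono fun p => (enorm_high_le _ _).trans (h.enorm_le hI hJ hJI hoc hs ht p)).trans
      (Hn_add_le _ _ _)
  | succ n =>
    rw [hBs]
    exact (hrec n).2 t ht

/-- At each scale the difference tends to zero because the `W`-weighted `L²` norm does; the bound `4
qⁿ Bₙ`, uniform in time, allows dominated convergence over the scales. -/
theorem Mild.hHsq_ne_top_of_scales (h : Mild I u) (hI : MeasurableSet I) (hJ : MeasurableSet J)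
    (hJI : J ⊆ I) (hoc : J.OrdConnected) {A : ℝ≥0∞} (hA : A ≠ ∞) {W : Lat → ℝ≥0∞}
    (hW : Admissible A W) (hWt : ∀ p, W p ≠ ∞) {k : ℝ} (hk : 0 ≤ k) {R : ℝ} (hR : 0 < R)
    (hfin : Hn W (A4 J u) ≠ ∞) {B : ℕ → ℝ≥0∞} (hB : ∑' n, scaleRatio k ^ n * B n ≠ ∞)
    (hb : ∀ t ∈ J, ∀ n, Hn W (fun p => ‖high (R * 3 ^ n) (u t p)‖ₑ) ≤ B n) {t : ℝ} (ht : t ∈ J)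
    (hu : Hn W (fun p => ‖u t p‖ₑ) ≠ ∞) :
    hHsq W k (u t) ≠ ∞ ∧ Tendsto (fun r => hHsq W k (u r - u t)) (𝓝[J] t) (𝓝 0) := by
  constructor
  · refine ne_top_of_le_ne_top ?_ (hHsq_le W hR hk (u t))
    refine ENNReal.mul_ne_top ENNReal.ofReal_ne_top (ENNReal.add_ne_top.2 ⟨hu, ?_⟩)
    exact ne_top_of_le_ne_top hB (ENNReal.tsum_le_tsum fun n => mul_le_mul' le_rfl (hb t ht n))
  · have hF := h.Hn_nlFld_ne_top hJI hA hW hfin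
    have h0 := h.tendsto_Hn_sub hI hJ hJI hoc hWt ht hu hF
    set C := ENNReal.ofReal ((1 + (2 * Real.pi * R) ^ 2) ^ k * 9 ^ k)
    have hn : ∀ n : ℕ, Tendsto (fun r => Hn W (fun p => ‖high (R * 3 ^ n) ((u r - u t) p)‖ₑ))
        (𝓝[J] t) (𝓝 0) := fun n =>
      tendsto_of_tendsto_of_tendsto_of_le_of_le tendsto_const_nhds h0 (fun _ => zero_le)
        fun r => Hn_mono fun p => enorm_high_le _ _
    have hsum : Tendsto (fun r => ∑' n : ℕ, scaleRatio k ^ n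
        * Hn W (fun p => ‖high (R * 3 ^ n) ((u r - u t) p)‖ₑ)) (𝓝[J] t) (𝓝 0) := by
      have := tendsto_lintegral_filter_of_dominated_convergence
        (μ := (Measure.count : Measure ℕ)) (l := 𝓝[J] t)
        (F := fun r n => scaleRatio k ^ n * Hn W (fun p => ‖high (R * 3 ^ n) ((u r - u t) p)‖ₑ))
        (f := fun _ => 0) (fun n => 4 * (scaleRatio k ^ n * B n))
        (Eventually.of_forall fun r => Measurable.of_discrete)
        (by
          filter_upwards [self_mem_nhdsWithin] with r hr
          refine ae_of_all _ fun n => ?_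
          calc _ ≤ scaleRatio k ^ n * (2 * (B n + B n)) := by
                refine mul_le_mul' le_rfl ?_
                refine (Hn_mono fun p => ?_).trans ((Hn_add_le W
                  (fun p => ‖high (R * 3 ^ n) (u r p)‖ₑ)
                  fun p => ‖high (R * 3 ^ n) (u t p)‖ₑ).trans ?_)
                · rw [Pi.sub_apply, map_sub]
                  exact enorm_sub_le
                · gcongr
                  · exact hb r hr n
                  · exact hb t ht n
            _ = _ := by ring)
        (by
          rw [lintegral_count, ENNReal.tsum_mul_left]
          exact ENNReal.mul_ne_top (by norm_num) hB)
        (ae_of_all _ fun n => by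
          have := ENNReal.Tendsto.const_mul (hn n)
            (.inr (ENNReal.pow_ne_top (n := n) (scaleRatio_ne_top k)))
          simpa using this)
      simpa only [lintegral_count, tsum_zero] using this
    have hlim := ENNReal.Tendsto.const_mul (a := C) (h0.add hsum) (.inr ENNReal.ofReal_ne_top)
    rw [add_zero, mul_zero] at hlim
    exact tendsto_of_tendsto_of_tendsto_of_le_of_le tendsto_const_nhds hlim (fun _ => zero_le)
      fun r => hHsq_le W hR hk (u r - u t)

/-- Persistence of regularity for the integral equation. -/
theorem Mild.persist (h : Mild I u) (hI : MeasurableSet I) (hoc : I.OrdConnected) (h0 : (0 : ℝ) ∈ I)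
    {A : ℝ≥0∞} (hA1 : 1 ≤ A) (hA : A ≠ ∞) {W : Lat → ℝ≥0∞} (hW : Admissible A W)
    (h1 : ∀ p, weight 1 p ≤ W p) (hWt : ∀ p, W p ≠ ∞) {k : ℝ} (hk : 0 ≤ k)
    (hu : hHsq W k (u 0) ≠ ∞) {t : ℝ} (ht : t ∈ I) :
    hHsq W k (u t) ≠ ∞ ∧ Tendsto (fun r => hHsq W k (u r - u t)) (𝓝[I] t) (𝓝 0) := by
  have hW0 : ∀ p, W p ≠ 0 := fun p hp => weight_ne_zero 1 p (le_antisymm (hp ▸ h1 p) zero_le)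
  obtain ⟨hall, hloc⟩ := h.persist_weight hI hoc h0 hA1 hA hW hWt
    (ne_top_of_le_ne_top hu (Hn_le_hHsq W hk (u 0)))
  have hJ : ∀ t₀ δ, MeasurableSet (I ∩ Ioo (t₀ - δ) (t₀ + δ)) := fun _ _ =>
    hI.inter measurableSet_Ioo
  have hJo : ∀ t₀ δ : ℝ, (I ∩ Ioo (t₀ - δ) (t₀ + δ)).OrdConnected := fun _ _ =>
    hoc.inter ordConnected_Ioo
  have hnhds : ∀ {t₀ δ : ℝ}, 0 < δ → 𝓝[I ∩ Ioo (t₀ - δ) (t₀ + δ)] t₀ = 𝓝[I] t₀ := fun hδ =>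
    nhdsWithin_inter_of_mem' (nhdsWithin_le_nhds (Ioo_mem_nhds (by linarith) (by linarith)))
  -- For `k = 0` the result on lattice weights suffices; the sum over scales is comparable to the
  -- norm only for `k > 0`.
  rcases hk.eq_or_lt with rfl | hk0
  · obtain ⟨δ, hδ, hfin⟩ := hloc t ht
    have hδ' : 0 < δ := hδ
    have := h.tendsto_Hn_sub hI (hJ t δ) inter_subset_left (hJo t δ) hWt
      ⟨ht, by linarith, by linarith⟩ (hall t ht) (h.Hn_nlFld_ne_top inter_subset_left hA hW hfin)
    rw [hnhds hδ] at this
    simp only [hHsq_zero]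
    exact ⟨hall t ht, this⟩
  · have hK : 2 * scaleRatio k * (2000 * triConst A) ≠ ∞ :=
      ENNReal.mul_ne_top (ENNReal.mul_ne_top (by norm_num) (scaleRatio_ne_top k))
        (ENNReal.mul_ne_top (by norm_num) (triConst_ne_top hA))
    -- `δ` is chosen from the `W`-weighted `L²` theory, before any Sobolev norm is known to be
    -- finite. Finiteness at one time therefore spreads over the whole neighborhood, and
    -- connectedness carries it through `I`.
    have key : ∀ t₀ ∈ I, ∃ δ > 0, ∀ s ∈ I ∩ Ioo (t₀ - δ) (t₀ + δ), hHsq W k (u s) ≠ ∞ →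
        ∀ r ∈ I ∩ Ioo (t₀ - δ) (t₀ + δ), hHsq W k (u r) ≠ ∞ ∧
          Tendsto (fun r' => hHsq W k (u r' - u r)) (𝓝[I ∩ Ioo (t₀ - δ) (t₀ + δ)] r) (𝓝 0) := by
      intro t₀ ht₀
      obtain ⟨δ, hδ, R, hR, hfin, hsm⟩ := h.exists_small hI hoc hA hW hW0 hWt ht₀ (hall t₀ ht₀)
        (hloc t₀ ht₀) hK
      refine ⟨δ, hδ, fun s hs hus r hr => ?_⟩
      obtain ⟨B, hB, hb⟩ := h.sobolev_local hI (hJ t₀ δ) inter_subset_left (hJo t₀ δ) hA hW h1 hk0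
        hR hfin hsm hs hus
      exact h.hHsq_ne_top_of_scales hI (hJ t₀ δ) inter_subset_left (hJo t₀ δ) hA hW hWt hk
        (by linarith) hfin hB hb hr (hall r hr.1)
    have hfinall : ∀ t ∈ I, hHsq W k (u t) ≠ ∞ :=
      propagate hoc h0 hu fun t₀ ht₀ => by
        obtain ⟨δ, hδ, hkey⟩ := key t₀ ht₀
        exact ⟨δ, hδ, fun s hs hP r hr => (hkey s hs hP r hr).1⟩
    refine ⟨hfinall t ht, ?_⟩
    obtain ⟨δ, hδ, hkey⟩ := key t ht
    have hδ' : 0 < δ := hδ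
    have hmem : t ∈ I ∩ Ioo (t - δ) (t + δ) := ⟨ht, by linarith, by linarith⟩
    have := (hkey t hmem (hfinall t ht) t hmem).2
    rwa [hnhds hδ] at this

/-- Persistence of regularity. -/
theorem IsSolution.continuousIn_of_data {u₀ : Seq} (h : IsSolution I u₀ u) (hI : MeasurableSet I)
    (hoc : I.OrdConnected) (h0 : (0 : ℝ) ∈ I) {η k : ℝ} (hη : 1 ≤ η) (hk : 0 ≤ k)
    (hu : hHNorm η k u₀ < ∞) : ContinuousIn η k I u := by
  have hm := h.mild hI hoc h0
  have hcut : ∀ t ∈ I, I.indicator u t = u t := fun t ht => indicator_of_mem ht u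
  rw [hHNorm_eq, rpow_half_lt_top] at hu
  have hA1 : (1 : ℝ≥0∞) ≤ ENNReal.ofReal (2 ^ η) := by
    rw [← ENNReal.ofReal_one]
    exact ENNReal.ofReal_le_ofReal (Real.one_le_rpow (by norm_num) (by linarith))
  have key := fun {t : ℝ} (ht : t ∈ I) => hm.persist hI hoc h0 hA1 ENNReal.ofReal_ne_top
    (admissible_weight (by linarith)) (weight_mono hη) (weight_ne_top η) hk
    (by rw [hcut 0 h0, h.initial]; exact hu) ht
  refine ⟨fun t ht => ?_, fun t ht => ?_⟩
  · rw [hHNorm_eq, rpow_half_lt_top, ← hcut t ht]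
    exact (key ht).1
  · simp only [hHNorm_eq, tendsto_rpow_half]
    refine (key ht).2.congr' ?_
    filter_upwards [self_mem_nhdsWithin] with r hr
    rw [hcut t ht, hcut r hr]

end Resonant

end

theorem theorem8p1 :
    -- existence on some open interval containing 0
    (∀ u₀ : Resonant.Seq, Resonant.hHNorm 1 0 u₀ < ∞ →
      ∃ I : Set ℝ, IsOpen I ∧ I.OrdConnected ∧ (0 : ℝ) ∈ I ∧
        ∃ u : ℝ → Resonant.Seq, Resonant.IsSolution I u₀ u) ∧
    -- uniqueness on every open interval containing 0
    (∀ u₀ : Resonant.Seq, Resonant.hHNorm 1 0 u₀ < ∞ →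
      ∀ I : Set ℝ, IsOpen I → I.OrdConnected → (0 : ℝ) ∈ I →
        ∀ u v : ℝ → Resonant.Seq, Resonant.IsSolution I u₀ u → Resonant.IsSolution I u₀ v →
          Set.EqOn u v I) ∧
    -- small data: global existence and scattering in both directions
    (∃ E₀ : ℝ, 0 < E₀ ∧ ∀ u₀ : Resonant.Seq, Resonant.hHNorm 1 0 u₀ ≤ ENNReal.ofReal E₀ →
      ∃ u : ℝ → Resonant.Seq, Resonant.IsSolution Set.univ u₀ u ∧
        Resonant.Scatters Filter.atTop u ∧ Resonant.Scatters Filter.atBot u) ∧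
    -- persistence of regularity, on the whole interval on which the solution is given
    (∀ u₀ : Resonant.Seq, Resonant.hHNorm 1 0 u₀ < ∞ →
      ∀ I : Set ℝ, IsOpen I → I.OrdConnected → (0 : ℝ) ∈ I →
        ∀ u : ℝ → Resonant.Seq, Resonant.IsSolution I u₀ u →
          ∀ η k : ℝ, 1 ≤ η → 0 ≤ k → Resonant.hHNorm η k u₀ < ∞ →
            Resonant.ContinuousIn η k I u) := by
  refine ⟨fun u₀ h => Resonant.exists_solution h, fun u₀ _ I hI hoc h0 u v hu hv =>
    hu.eqOn hv hI.measurableSet hoc h0, Resonant.exists_global_solution, ?_⟩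
  intro u₀ _ I hI hoc h0 u hu η k hη hk h
  exact hu.continuousIn_of_data hI.measurableSet hoc h0 hη hk h
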